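/- Let $d\in\{2,3\}$, $Y=(0,1)^d$, and let $Y_s$ be a nonempty open set with $\overline{Y_s}\subset Y$ and with smooth boundary $\Gamma=\partial Y_s$, such that $Y_g:=Y\setminus\overline{Y_s}$ is connected. Let $n$ be the unit normal on $\Gamma$ exterior to $Y_g$, $\sigma$ the surface measure on $\Gamma$ and $e_1,\dots,e_d$ the standard basis of $\mathbb R^d$. Let $c_g,c_s,\lambda_g,\lambda_s,D,Q,A,T_a\in(0,\infty)$ be constants and $f(T)=\exp(-T_a/T)$. Let $b$ be a $Y$-periodic vector field, bounded on $Y_g$, with $\operatorname{div} b=0$ in $Y_g$ and $b\cdot n=0$ on $\Gamma$ (weakly: $\int_{Y_g} b\cdot\nabla\eta\,dy=0$ for all smooth $Y$-periodic $\eta$). Let $T^0>0$ and $C^0\ge 0$ be given real numbers (the values at a fixed $(t,x)$). Put $c^{\rm eff}=\int_{Y_g}c_g\,dy+\int_{Y_s}c_s\,dy$ and $$b_T=\frac{c_g}{c^{\rm eff}}\int_{Y_g}b\,dy,\qquad b_C=\frac1{|Y_g|}\int_{Y_g}b\,dy .$$ (i) Two vectors $v,w\in\mathbb R^d$ satisfy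 the compatibility conditions $$\int_{Y_g}c_g(v-b)\cdot e_j\,dy+\int_{Y_s}c_s\,v\cdot e_j\,dy=0,\qquad \int_{Y_g}(w-b)\cdot e_j\,dy=0\qquad(j=1,\dots,d)$$ (the source terms have zero average) if and only if $v=b_T$ and $w=b_C$. (ii) There is a weak solution $(\chi,\omega)=(\chi_j,\omega_j)_{j=1,\dots,d}\in[H^1_\#(Y)]^d\times[H^1_\#(Y_g)]^d$ of the cell problem $$\begin{cases} c_g\, b\cdot\nabla\chi_j-\nabla\cdot(\lambda_g(\nabla\chi_j+e_j))=c_g(b_T-b)\cdot e_j&\text{in }Y_g,\\ -\nabla\cdot(\lambda_s(\nabla\chi_j+e_j))=c_s\,b_T\cdot e_j&\text{in }Y_s,\\ \chi_j|_{Y_g}=\chi_j|_{Y_s}&\text{on }\Gamma,\\ [\lambda_s(\nabla\chi_j|_{Y_s}+e_j)-\lambda_g(\nabla\chi_j|_{Y_g}+e_j)]\cdot n=QA\,[f'(T^0)C^0\chi_j+f(T^0)\omega_j]&\text{on }\Gamma,\\ b\cdot\nabla\omega_j-\nabla\cdot(D(\nabla\omega_j+e_j))=(b_C-b)\cdot e_j&\text{in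 }Y_g,\\ D(\nabla\omega_j+e_j)\cdot n=-A\,[f'(T^0)C^0\chi_j+f(T^0)\omega_j]&\text{on }\Gamma,\\ \chi_j,\ \omega_j\ \text{are }Y\text{-periodic,} \end{cases}$$ and it is unique up to additive constants: the solutions are exactly the pairs $$\big(\chi_j+\kappa_j f(T^0),\ \omega_j-\kappa_j f'(T^0)C^0\big)_{j=1,\dots,d},\qquad \kappa\in\mathbb R^d .$$ Here $H^1_\#(Y)$ and $H^1_\#(Y_g)$ are the spaces of $Y$-periodic $H^1$ functions, and $(\chi_j,\omega_j)$ is a weak solution if, for all $\phi\in H^1_\#(Y)$ and $\psi\in H^1_\#(Y_g)$, with values on $\Gamma$ in the sense of traces, $$\int_{Y_g}c_g\,b\cdot\nabla\chi_j\,\phi+\int_{Y_g}\lambda_g(\nabla\chi_j+e_j)\cdot\nabla\phi+\int_{Y_s}\lambda_s(\nabla\chi_j+e_j)\cdot\nabla\phi+QA\int_\Gamma[f'(T^0)C^0\chi_j+f(T^0)\omega_j]\,\phi\,d\sigma=\int_{Y_g}c_g(b_T-b)\cdot e_j\,\phi+\int_{Y_s}c_s\,b_T\cdot e_j\,\phi,$$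 $$\int_{Y_g}b\cdot\nabla\omega_j\,\psi+\int_{Y_g}D(\nabla\omega_j+e_j)\cdot\nabla\psi+A\int_\Gamma[f'(T^0)C^0\chi_j+f(T^0)\omega_j]\,\psi\,d\sigma=\int_{Y_g}(b_C-b)\cdot e_j\,\psi .$$ -/

import Mathlib

open MeasureTheory Set Filter
open scoped Topology Gradient RealInnerProductSpace

noncomputable section

namespace FiltrationCombustion

/-- The ambient Euclidean space of dimension `d`. -/
abbrev Space (d : ℕ) : Type := EuclideanSpace ℝ (Fin d)

/-- The open reference cell `Y = (0,1)^d`. -/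
def unitCell (d : ℕ) : Set (Space d) := {y | ∀ i, y i ∈ Ioo (0 : ℝ) 1}

/-- The gas-filled part `Y_g` of the cell: the complement in `Y` of the closure of the solid
part `Y_s`. -/
def gasCell {d : ℕ} (Ys : Set (Space d)) : Set (Space d) := unitCell d \ closure Ys

/-- The gas phase of the periodic medium: what remains of the whole space after removal of all
integer translates of the closure of `Y_s`. -/
def periodicGas {d : ℕ} (Ys : Set (Space d)) : Set (Space d) :=
  {x | ∀ k : Fin d → ℤ, x + WithLp.toLp 2 (fun i => (k i : ℝ)) ∉ closure Ys}

/-- The surface measure on the interface `Γ = ∂Y_s`, that is the normalized `(d-1)`-dimensional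
Hausdorff measure restricted to `Γ`. -/
def surface {d : ℕ} (Ys : Set (Space d)) : Measure (Space d) :=
  (Measure.euclideanHausdorffMeasure (d - 1)).restrict (frontier Ys)

/-- `S` has a smooth boundary: near each boundary point it is the sublevel set `{g < 0}` of a
smooth function `g` whose gradient does not vanish there. -/
def HasSmoothBoundary {d : ℕ} (S : Set (Space d)) : Prop :=
  ∀ p ∈ frontier S, ∃ g : Space d → ℝ, ContDiff ℝ (⊤ : ℕ∞) g ∧ ∇ g p ≠ 0 ∧
    ∀ᶠ x in 𝓝 p, (x ∈ S ↔ g x < 0)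

/-- The admissible solid parts `Y_s`: nonempty open sets (possibly with several components) with
smooth boundary, lying compactly in the cell, whose complementary gas part is connected. -/
structure IsSolidPart {d : ℕ} (Ys : Set (Space d)) : Prop where
  isOpen : IsOpen Ys
  nonempty : Ys.Nonempty
  closure_subset : closure Ys ⊆ unitCell d
  smooth : HasSmoothBoundary Ys
  connected : IsConnected (gasCell Ys)

/-- `Y`-periodicity: period one in every coordinate direction. -/
def IsCellPeriodic {d : ℕ} {β : Type*} (u : Space d → β) : Prop :=
  ∀ i, Function.Periodic u (EuclideanSpace.single i (1 : ℝ))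

/-- Lebesgue measure on one cell of the periodic set `U`. -/
def cellVolume {d : ℕ} (U : Set (Space d)) : Measure (Space d) :=
  volume.restrict (U ∩ unitCell d)

/-- `u`, with weak gradient `Du`, belongs to the periodic Sobolev space `H¹_#` of the periodic open
set `U`. For `U = univ` this is `H¹_#(Y)`, for `U = periodicGas Ys` it is `H¹_#(Y_g)`. Only the
values on `U` are relevant. -/
structure MemH1Per {d : ℕ} (U : Set (Space d)) (u : Space d → ℝ) (Du : Space d → Space d) :
    Prop where
  periodic : IsCellPeriodic u
  periodic_grad : IsCellPeriodic Du
  memLp : MemLp u 2 (cellVolume U)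
  memLp_grad : MemLp Du 2 (cellVolume U)
  weak : ∀ η : Space d → ℝ, ContDiff ℝ (⊤ : ℕ∞) η → HasCompactSupport η → tsupport η ⊆ U →
    ∫ x in U, u x • ∇ η x = - ∫ x in U, η x • Du x

/-- `τ ∈ L²(σ)` is the trace of `u`: it is the `L²(σ)`-limit of the restrictions of smooth periodic
functions that converge to `u` in `H¹_#` of the periodic open set `U`. -/
def HasTrace {d : ℕ} (U : Set (Space d)) (σ : Measure (Space d)) (u : Space d → ℝ)
    (Du : Space d → Space d) (τ : Space d → ℝ) : Prop :=
  MemLp τ 2 σ ∧ ∃ η : ℕ → Space d → ℝ,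
    (∀ n, ContDiff ℝ (⊤ : ℕ∞) (η n) ∧ IsCellPeriodic (η n)) ∧
    Tendsto (fun n => eLpNorm (η n - u) 2 (cellVolume U)) atTop (𝓝 0) ∧
    Tendsto (fun n => eLpNorm (∇ (η n) - Du) 2 (cellVolume U)) atTop (𝓝 0) ∧
    Tendsto (fun n => eLpNorm (η n - τ) 2 σ) atTop (𝓝 0)

/-- The positive physical constants: heat capacities, heat conductivities, diffusivity, heat
release, pre-exponential factor and activation temperature. -/
structure Coefficients where
  (cg cs lamg lams D Q A Ta : ℝ)
  cg_pos : 0 < cg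
  cs_pos : 0 < cs
  lamg_pos : 0 < lamg
  lams_pos : 0 < lams
  D_pos : 0 < D
  Q_pos : 0 < Q
  A_pos : 0 < A
  Ta_pos : 0 < Ta

/-- The Arrhenius law `f(T) = exp(-T_a / T)`. -/
def arrhenius (Ta T : ℝ) : ℝ := Real.exp (-Ta / T)

/-- The admissible velocities: periodic, essentially bounded, and (in the weak sense) divergence
free in the gas with vanishing normal component on `Γ`. -/
structure IsVelocity {d : ℕ} (Ys : Set (Space d)) (b : Space d → Space d) : Prop where
  periodic : IsCellPeriodic b
  bounded : MemLp b ⊤ (volume.restrict (gasCell Ys))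
  divFree : ∀ η : Space d → ℝ, ContDiff ℝ (⊤ : ℕ∞) η → IsCellPeriodic η →
    ∫ y in gasCell Ys, ⟪b y, ∇ η y⟫ = 0

/-- The effective heat capacity `∫_{Y_g} c_g + ∫_{Y_s} c_s`. -/
def effCapacity {d : ℕ} (c : Coefficients) (Ys : Set (Space d)) : ℝ :=
  (∫ _ in gasCell Ys, c.cg) + ∫ _ in Ys, c.cs

/-- The effective drift `b_T` of the temperature. -/
def driftT {d : ℕ} (c : Coefficients) (Ys : Set (Space d)) (b : Space d → Space d) : Space d :=
  (c.cg / effCapacity c Ys) • ∫ y in gasCell Ys, b y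

/-- The effective drift `b_C` of the concentration. -/
def driftC {d : ℕ} (Ys : Set (Space d)) (b : Space d → Space d) : Space d :=
  (volume.real (gasCell Ys))⁻¹ • ∫ y in gasCell Ys, b y

/-- The `j`-th unit vector. -/
def unitVec {d : ℕ} (j : Fin d) : Space d := EuclideanSpace.single j (1 : ℝ)

/-- The linearized reaction rate `f'(T⁰) C⁰ χ + f(T⁰) ω` for the values `χ`, `ω` at a point. -/
def rate (c : Coefficients) (T0 C0 χ ω : ℝ) : ℝ :=
  deriv (arrhenius c.Ta) T0 * C0 * χ + arrhenius c.Ta T0 * ω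

/-- `(χ, ω) ∈ H¹_#(Y) × H¹_#(Y_g)` solves the `j`-th cell problem with drifts `v`, `w`
(for the temperature and the concentration), weakly, that is after multiplication with test
functions in `H¹_#(Y)` and `H¹_#(Y_g)` and integration by parts:

* `c_g b·∇χ - div(λ_g(∇χ + e_j)) = c_g (v - b)·e_j` in `Y_g`,
* `-div(λ_s(∇χ + e_j)) = c_s v·e_j` in `Y_s`, with `χ` continuous across `Γ`,
* `[λ_s(∇χ_s + e_j) - λ_g(∇χ_g + e_j)]·n = Q A (f'(T⁰) C⁰ χ + f(T⁰) ω)` on `Γ`,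
* `b·∇ω - div(D(∇ω + e_j)) = (w - b)·e_j` in `Y_g`,
* `D(∇ω + e_j)·n = -A (f'(T⁰) C⁰ χ + f(T⁰) ω)` on `Γ`,

where `n` is the unit normal on `Γ` exterior to `Y_g`. The functions `τχ`, `τω`, `τφ`, `τψ` are
the traces on `Γ`. -/
def IsCellSolution {d : ℕ} (c : Coefficients) (Ys : Set (Space d)) (b : Space d → Space d)
    (T0 C0 : ℝ) (v w : Space d) (j : Fin d) (χ ω : Space d → ℝ) : Prop :=
  ∃ (Dχ Dω : Space d → Space d) (τχ τω : Space d → ℝ),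
    MemH1Per univ χ Dχ ∧ HasTrace univ (surface Ys) χ Dχ τχ ∧
    MemH1Per (periodicGas Ys) ω Dω ∧ HasTrace (periodicGas Ys) (surface Ys) ω Dω τω ∧
    (∀ (φ : Space d → ℝ) (Dφ : Space d → Space d) (τφ : Space d → ℝ),
      MemH1Per univ φ Dφ → HasTrace univ (surface Ys) φ Dφ τφ →
      (∫ y in gasCell Ys, c.cg * ⟪b y, Dχ y⟫ * φ y)
        + (∫ y in gasCell Ys, c.lamg * ⟪Dχ y + unitVec j, Dφ y⟫)
        + (∫ y in Ys, c.lams * ⟪Dχ y + unitVec j, Dφ y⟫)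
        + c.Q * c.A * (∫ y, rate c T0 C0 (τχ y) (τω y) * τφ y ∂(surface Ys))
      = (∫ y in gasCell Ys, c.cg * ⟪v - b y, unitVec j⟫ * φ y)
        + ∫ y in Ys, c.cs * ⟪v, unitVec j⟫ * φ y) ∧
    (∀ (ψ : Space d → ℝ) (Dψ : Space d → Space d) (τψ : Space d → ℝ),
      MemH1Per (periodicGas Ys) ψ Dψ → HasTrace (periodicGas Ys) (surface Ys) ψ Dψ τψ →
      (∫ y in gasCell Ys, ⟪b y, Dω y⟫ * ψ y)
        + (∫ y in gasCell Ys, c.D * ⟪Dω y + unitVec j, Dψ y⟫)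
        + c.A * (∫ y, rate c T0 C0 (τχ y) (τω y) * τψ y ∂(surface Ys))
      = ∫ y in gasCell Ys, ⟪w - b y, unitVec j⟫ * ψ y)

/-- The compatibility condition for drifts `v`, `w`: for every `j` the source terms of the
temperature equation have zero total average over the cell, and so does the source term of the
concentration equation over the gas part. -/
def Compatible {d : ℕ} (c : Coefficients) (Ys : Set (Space d)) (b : Space d → Space d)
    (v w : Space d) : Prop :=
  ∀ j : Fin d,
    (∫ y in gasCell Ys, c.cg * ⟪v - b y, unitVec j⟫) + (∫ _ in Ys, c.cs * ⟪v, unitVec j⟫) = 0 ∧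
    ∫ y in gasCell Ys, ⟪w - b y, unitVec j⟫ = 0

end FiltrationCombustion

end

open FiltrationCombustion

/-! Part (i) is linear algebra: the averages of the sources are affine in `v` and `w`, with leading
coefficients `effCapacity c Ys` and `volume.real (gasCell Ys)`, both positive.

For part (ii), fix `j` and put α = f'(T⁰)C⁰ ≥ 0, β = f(T⁰) > 0. The cell problem reads a₁(χ, φ) +
QA⟨r, φ⟩ = ℓ₁(φ), a₂(ω, ψ) + A⟨r, ψ⟩ = ℓ₂(ψ), where r = αχ + βω and the brackets are L²(Γ) products
of traces. Since `b` is divergence free and tangential, transport is skew-symmetric, so a₁(χ, χ) and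
a₂(ω, ω) are weighted Dirichlet energies, and constants lie in both the left and the right kernel of
each form.

The reaction is not symmetric, but adding α/(βQ) times the first equation to the second, tested with
the solution itself, turns the reaction terms into (A/β)‖r‖². The weight is raised by a small δ > 0,
so that it controls χ even when α = 0; the surplus reaction term is absorbed by the trace
inequality. With the rank-one term m(χ)m(φ) added to the heat equation, m being the mean over `Y`,
the combined form is coercive (`CoupledForms.exists_weight`): m and the energy control χ, then r and
χ control the trace of ω, and trace and energy control ω.

Lax-Milgram solves the modified problem. Compatibility means ℓ₁(1) = ℓ₂(1) = 0. Testing the second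
equation with 1 gives ∫r = 0 on Γ, and then testing the first with 1 gives m(χ) = 0: the added term
vanishes and the original problem is solved (`CoupledForms.exists_solution`). For uniqueness, a
multiple of the kernel element (β, -α) is subtracted from the difference of two solutions to make
its temperature mean zero, and coercivity forces the rest to vanish.

The analytic input is the Poincaré inequality on `Y` (convex) and on `Y_g` (connected, smooth
interface), the trace inequality on Γ, and 0 < σ(Γ) < ∞. All are local: near a point of Γ there is a
cylinder in which every point outside `Y_s` reaches a convex cap along a vertical segment in the gas
(`IsGraphCylinder`). The Sobolev spaces are closures of the triples (η, ∇η, η|Γ) of smooth periodic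
functions in L² × L² × L²(σ). By the definition of `HasTrace`, these closures contain exactly the
solutions and test functions of the weak formulation, so every estimate need only be proved for
smooth functions. -/

open scoped ENNReal NNReal

/-! ### Poincaré inequality on bounded convex sets. -/

noncomputable section

namespace FiltrationCombustion

/-- Cauchy--Schwarz inequality for a lower Lebesgue integral against the constant function. -/
lemma sq_lintegral_le {α : Type*} [MeasurableSpace α] (μ : Measure α) {f : α → ℝ≥0∞}
    (hf : AEMeasurable f μ) : (∫⁻ x, f x ∂μ) ^ 2 ≤ μ univ * ∫⁻ x, f x ^ 2 ∂μ := by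
  have h := ENNReal.lintegral_mul_le_Lp_mul_Lq μ Real.HolderConjugate.two_two hf
    (aemeasurable_const (b := (1 : ℝ≥0∞)))
  simp only [Pi.mul_apply, mul_one, ENNReal.one_rpow, lintegral_const, one_mul] at h
  calc (∫⁻ x, f x ∂μ) ^ 2
      ≤ ((∫⁻ x, f x ^ (2 : ℝ) ∂μ) ^ (1 / 2 : ℝ) * (μ univ) ^ (1 / 2 : ℝ)) ^ 2 := by gcongr
    _ = _ := by
      rw [mul_pow, ← ENNReal.rpow_natCast, ← ENNReal.rpow_natCast, ← ENNReal.rpow_mul,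
        ← ENNReal.rpow_mul]
      norm_num [mul_comm]

variable {F : Type*} [NormedAddCommGroup F] [InnerProductSpace ℝ F]

section Line

variable [CompleteSpace F]

lemma continuous_gradient {η : F → ℝ} (hη : ContDiff ℝ 1 η) : Continuous (∇ η) := by
  unfold gradient
  exact (InnerProductSpace.toDual ℝ F).symm.continuous.comp (hη.continuous_fderiv one_ne_zero)

lemma hasDerivAt_along_line {η : F → ℝ} (hη : ContDiff ℝ 1 η) (x v : F) (t : ℝ) :
    HasDerivAt (fun t : ℝ => η (x + t • v)) ⟪∇ η (x + t • v), v⟫ t := by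
  have h1 : HasFDerivAt η (fderiv ℝ η (x + t • v)) (x + t • v) :=
    (hη.differentiable one_ne_zero _).hasFDerivAt
  have h2 : HasDerivAt (fun t : ℝ => x + t • v) v t := by
    simpa using ((hasDerivAt_id t).smul_const v).const_add x
  have := h1.comp_hasDerivAt t h2
  rwa [inner_gradient_left]

/-- The squared increment of a function along a segment is controlled by its gradient there. -/
lemma enorm_sub_sq_le_lintegral_line {η : F → ℝ} (hη : ContDiff ℝ 1 η) (x v : F) (a b : ℝ) :
    ‖η (x + b • v) - η (x + a • v)‖ₑ ^ 2 ≤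
      ENNReal.ofReal |b - a| * ‖v‖ₑ ^ 2 *
        ∫⁻ t in Ioo (min a b) (max a b), ‖∇ η (x + t • v)‖ₑ ^ 2 := by
  have hc : Continuous fun t : ℝ => ∇ η (x + t • v) :=
    (continuous_gradient hη).comp (by fun_prop)
  have hc' : Continuous fun t : ℝ => ⟪∇ η (x + t • v), v⟫ := hc.inner continuous_const
  have h1 := intervalIntegral.integral_eq_sub_of_hasDerivAt
    (fun t _ => hasDerivAt_along_line hη x v t) (hc'.intervalIntegrable a b)
  have h2 : ‖η (x + b • v) - η (x + a • v)‖ₑ ≤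
      ∫⁻ t in Ioo (min a b) (max a b), ‖∇ η (x + t • v)‖ₑ * ‖v‖ₑ := by
    rw [← h1, ← ofReal_norm, intervalIntegral.norm_intervalIntegral_eq,
      ofReal_norm]
    refine (enorm_integral_le_lintegral_enorm _).trans ?_
    rw [uIoc, ← Measure.restrict_congr_set Ioo_ae_eq_Ioc]
    refine lintegral_mono fun t => ?_
    rw [← ofReal_norm, ← ofReal_norm, ← ofReal_norm,
      ← ENNReal.ofReal_mul (norm_nonneg _)]
    exact ENNReal.ofReal_le_ofReal (norm_inner_le_norm _ _)
  have hm : Measurable fun t : ℝ => ‖∇ η (x + t • v)‖ₑ := hc.enorm.measurable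
  calc ‖η (x + b • v) - η (x + a • v)‖ₑ ^ 2
      ≤ (∫⁻ t in Ioo (min a b) (max a b), ‖∇ η (x + t • v)‖ₑ * ‖v‖ₑ) ^ 2 := by gcongr
    _ ≤ volume.restrict (Ioo (min a b) (max a b)) univ *
        ∫⁻ t in Ioo (min a b) (max a b), (‖∇ η (x + t • v)‖ₑ * ‖v‖ₑ) ^ 2 :=
      sq_lintegral_le _ (hm.mul_const _).aemeasurable
    _ = _ := by
      simp only [mul_pow]
      rw [lintegral_mul_const _ (hm.pow_const 2), Measure.restrict_apply_univ, Real.volume_Ioo,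
        max_sub_min_eq_abs']
      rw [abs_sub_comm]; ring

end Line

section Convex

variable [MeasurableSpace F] [BorelSpace F] [FiniteDimensional ℝ F]

lemma lintegral_comp_add_smul (μ : Measure F) [μ.IsAddHaarMeasure] {f : F → ℝ≥0∞}
    (hf : Measurable f) (c : F) {t : ℝ} (ht : t ≠ 0) :
    ∫⁻ y, f (c + t • y) ∂μ =
      ENNReal.ofReal |(t ^ Module.finrank ℝ F)⁻¹| * ∫⁻ y, f y ∂μ := by
  have h1 : ∫⁻ y, f (c + t • y) ∂μ = ∫⁻ y, f (c + y) ∂(Measure.map (t • ·) μ) := by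
    rw [lintegral_map (by fun_prop) (by fun_prop)]
  rw [h1, Measure.map_addHaar_smul μ ht, lintegral_smul_measure, smul_eq_mul,
    lintegral_add_left_eq_self f c]

/-- The Poincaré inequality on a bounded convex set. -/
theorem exists_poincare_of_convex (μ : Measure F) [μ.IsAddHaarMeasure] {W : Set F}
    (hW : MeasurableSet W) (hconv : Convex ℝ W) (hbdd : Bornology.IsBounded W) :
    ∃ C : ℝ≥0, ∀ η : F → ℝ, ContDiff ℝ 1 η → ∃ m : ℝ,
      ∫⁻ y in W, ‖η y - m‖ₑ ^ 2 ∂μ ≤ C * ∫⁻ y in W, ‖∇ η y‖ₑ ^ 2 ∂μ := by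
  classical
  obtain ⟨R, hR⟩ := hbdd.subset_closedBall 0
  set N := Module.finrank ℝ F
  have hfin : μ W ≠ ∞ := hbdd.measure_lt_top.ne
  set D : ℝ≥0 := 2 * R.toNNReal
  -- `D` bounds the diameter of `W`; `2 ^ N` is the worst Jacobian of a dilation by a factor at
  -- least 1/2.
  refine ⟨D ^ 2 * 2 ^ N, fun η hη => ?_⟩
  rcases eq_or_ne (μ W) 0 with h0 | h0
  · exact ⟨0, by simp [Measure.restrict_eq_zero.2 h0]⟩
  -- Extension by zero allows the integrals to be enlarged to the whole space, on which translations
  -- and dilations act.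
  set h : F → ℝ≥0∞ := W.indicator fun z => ‖∇ η z‖ₑ ^ 2 with hh
  have hgm : Measurable fun z => ‖∇ η z‖ₑ ^ 2 :=
    (continuous_gradient hη).measurable.enorm.pow_const 2
  have hm : Measurable h := hgm.indicator hW
  set E := ∫⁻ y in W, ‖∇ η y‖ₑ ^ 2 ∂μ with hE
  have hEh : ∫⁻ y, h y ∂μ = E := lintegral_indicator hW _
  have hpt : ∀ x ∈ W, ∀ y ∈ W, ‖η y - η x‖ₑ ^ 2 ≤
      (D : ℝ≥0∞) ^ 2 * ∫⁻ t in Ioo (0 : ℝ) 1, h (x + t • (y - x)) := by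
    intro x hx y hy
    have := enorm_sub_sq_le_lintegral_line hη x (y - x) 0 1
    simp only [one_smul, zero_smul, add_zero, add_sub_cancel, sub_zero, abs_one,
      ENNReal.ofReal_one, one_mul, zero_le_one, min_eq_left, max_eq_right] at this
    refine this.trans ?_
    gcongr ?_ ^ 2 * ?_
    · have h1 := hR hx
      have h2 := hR hy
      rw [mem_closedBall_zero_iff] at h1 h2
      rw [enorm_eq_nnnorm, ENNReal.coe_le_coe, ← NNReal.coe_le_coe, coe_nnnorm]
      calc ‖y - x‖ ≤ ‖y‖ + ‖x‖ := norm_sub_le _ _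
        _ ≤ (D : ℝ) := by
          simp only [D, NNReal.coe_mul, NNReal.coe_ofNat]
          linarith [Real.le_coe_toNNReal R]
    · refine setLIntegral_mono' measurableSet_Ioo fun t ht => ?_
      rw [hh, indicator_of_mem]
      exact hconv.add_smul_sub_mem hx hy ⟨ht.1.le, ht.2.le⟩
  have hscale : ∀ (c : F) (t : ℝ), 1 / 2 ≤ t →
      ∫⁻ y, h (c + t • y) ∂μ ≤ 2 ^ N * E := by
    intro c t ht
    have ht0 : 0 < t := by linarith
    rw [lintegral_comp_add_smul μ hm c ht0.ne', hEh]
    gcongr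
    rw [abs_of_pos (by positivity), ← inv_pow]
    calc ENNReal.ofReal (t⁻¹ ^ N) ≤ ENNReal.ofReal (2 ^ N) := by
          apply ENNReal.ofReal_le_ofReal
          gcongr
          rw [inv_le_comm₀ ht0 two_pos]; linarith
      _ = 2 ^ N := by rw [ENNReal.ofReal_pow two_pos.le]; simp
  have hmeas3 : Measurable fun p : (F × F) × ℝ => h (p.1.1 + p.2 • (p.1.2 - p.1.1)) :=
    hm.comp (by fun_prop)
  -- The point `x + t • (y - x)` is dilated by `t` in the variable `y` and by `1 - t` in `x`. One of
  -- the two factors is at least 1/2; integrating first in that variable costs at most `2 ^ N`,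
  -- which avoids the singularity at either end.
  have hslice : ∀ t ∈ Ioo (0 : ℝ) 1,
      ∫⁻ x in W, ∫⁻ y in W, h (x + t • (y - x)) ∂μ ∂μ ≤ μ W * (2 ^ N * E) := by
    intro t ht
    rcases le_total (1 / 2) t with h2 | h2
    · calc ∫⁻ x in W, ∫⁻ y in W, h (x + t • (y - x)) ∂μ ∂μ
          ≤ ∫⁻ x in W, 2 ^ N * E ∂μ := by
            refine lintegral_mono fun x => (setLIntegral_le_lintegral _ _).trans ?_
            refine le_trans (le_of_eq ?_) (hscale (x - t • x) t h2)
            congr 1; ext y; congr 1; module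
        _ = _ := by rw [setLIntegral_const, mul_comm]
    · have hsw : ∫⁻ x in W, ∫⁻ y in W, h (x + t • (y - x)) ∂μ ∂μ =
          ∫⁻ y in W, ∫⁻ x in W, h (x + t • (y - x)) ∂μ ∂μ :=
        lintegral_lintegral_swap (hm.comp (by fun_prop)).aemeasurable
      rw [hsw]
      calc ∫⁻ y in W, ∫⁻ x in W, h (x + t • (y - x)) ∂μ ∂μ
          ≤ ∫⁻ y in W, 2 ^ N * E ∂μ := by
            refine lintegral_mono fun y => (setLIntegral_le_lintegral _ _).trans ?_
            refine le_trans (le_of_eq ?_) (hscale (t • y) (1 - t) (by linarith))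
            congr 1; ext x; congr 1; module
        _ = _ := by rw [setLIntegral_const, mul_comm]
  have htotal : ∫⁻ x in W, ∫⁻ y in W, ‖η y - η x‖ₑ ^ 2 ∂μ ∂μ ≤
      (D : ℝ≥0∞) ^ 2 * (μ W * (2 ^ N * E)) := by
    calc ∫⁻ x in W, ∫⁻ y in W, ‖η y - η x‖ₑ ^ 2 ∂μ ∂μ
        ≤ ∫⁻ x in W, ∫⁻ y in W, (D : ℝ≥0∞) ^ 2 *
            (∫⁻ t in Ioo (0 : ℝ) 1, h (x + t • (y - x))) ∂μ ∂μ :=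
          setLIntegral_mono' hW fun x hx => setLIntegral_mono' hW fun y hy => hpt x hx y hy
      _ = (D : ℝ≥0∞) ^ 2 * ∫⁻ x in W, ∫⁻ y in W,
            (∫⁻ t in Ioo (0 : ℝ) 1, h (x + t • (y - x))) ∂μ ∂μ := by
          rw [← lintegral_const_mul']
          · refine lintegral_congr fun x => ?_
            rw [lintegral_const_mul' _ _ (by simp)]
          · simp
      _ = (D : ℝ≥0∞) ^ 2 * ∫⁻ t in Ioo (0 : ℝ) 1, ∫⁻ x in W, ∫⁻ y in W,
            h (x + t • (y - x)) ∂μ ∂μ := by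
          congr 1
          have : ∀ x, ∫⁻ y in W, (∫⁻ t in Ioo (0 : ℝ) 1, h (x + t • (y - x))) ∂μ =
              ∫⁻ t in Ioo (0 : ℝ) 1, ∫⁻ y in W, h (x + t • (y - x)) ∂μ := fun x =>
            lintegral_lintegral_swap (hm.comp (by fun_prop)).aemeasurable
          simp_rw [this]
          refine lintegral_lintegral_swap (Measurable.aemeasurable ?_)
          have : Measurable fun p : (F × ℝ) × F => h (p.1.1 + p.1.2 • (p.2 - p.1.1)) :=
            hm.comp (by fun_prop)
          exact this.lintegral_prod_right'
      _ ≤ (D : ℝ≥0∞) ^ 2 * ∫⁻ t in Ioo (0 : ℝ) 1, μ W * (2 ^ N * E) := by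
          exact mul_le_mul_right (setLIntegral_mono' measurableSet_Ioo hslice) _
      _ = _ := by simp
  have hηm : Measurable η := hη.continuous.measurable
  -- Some `x` has an inner integral not exceeding the average over `W`; the value `η x` serves as
  -- the constant.
  obtain ⟨x, -, hx⟩ := exists_le_setLAverage (μ := μ) (s := W) h0 hfin
    (f := fun x => ∫⁻ y in W, ‖η y - η x‖ₑ ^ 2 ∂μ)
    (Measurable.aemeasurable <| Measurable.lintegral_prod_right'
      (f := fun p : F × F => ‖η p.2 - η p.1‖ₑ ^ 2) (by fun_prop))
  refine ⟨η x, hx.trans ?_⟩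
  rw [setLAverage_eq]
  refine ENNReal.div_le_of_le_mul (htotal.trans (le_of_eq ?_))
  push_cast
  ring

end Convex

end FiltrationCombustion

end

/-! ### Coordinate splitting and cylinders around points of a smooth boundary. -/

noncomputable section

namespace FiltrationCombustion

variable {n : ℕ}

/-- The projection that forgets the `i`-th coordinate. -/
def dropCoord (i : Fin (n + 1)) (x : Space (n + 1)) : Space n :=
  WithLp.toLp 2 fun k => x (i.succAbove k)

/-- The point with `i`-th coordinate `t` and remaining coordinates `x`. -/
def insertCoord (i : Fin (n + 1)) (x : Space n) (t : ℝ) : Space (n + 1) :=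
  WithLp.toLp 2 (i.insertNth (α := fun _ => ℝ) t x)

@[simp] lemma dropCoord_apply (i : Fin (n + 1)) (x : Space (n + 1)) (k : Fin n) :
    dropCoord i x k = x (i.succAbove k) := rfl

@[simp] lemma insertCoord_apply_same (i : Fin (n + 1)) (x : Space n) (t : ℝ) :
    insertCoord i x t i = t := by simp [insertCoord]

@[simp] lemma insertCoord_apply_succAbove (i : Fin (n + 1)) (x : Space n) (t : ℝ) (k : Fin n) :
    insertCoord i x t (i.succAbove k) = x k := by simp [insertCoord]

@[simp] lemma dropCoord_insertCoord (i : Fin (n + 1)) (x : Space n) (t : ℝ) :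
    dropCoord i (insertCoord i x t) = x := by ext k; simp

lemma ext_succAbove (i : Fin (n + 1)) {x y : Space (n + 1)} (h : x i = y i)
    (h' : dropCoord i x = dropCoord i y) : x = y := by
  ext j
  rcases Fin.eq_self_or_eq_succAbove i j with rfl | ⟨k, rfl⟩
  · exact h
  · simpa using congrArg (fun z => z k) h'

lemma insertCoord_dropCoord (i : Fin (n + 1)) (x : Space (n + 1)) (t : ℝ) :
    insertCoord i (dropCoord i x) t = x + (t - x i) • EuclideanSpace.single i (1 : ℝ) := by
  refine ext_succAbove i (by simp) ?_
  ext k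
  simp [Fin.succAbove_ne]

lemma dropCoord_sub (i : Fin (n + 1)) (x y : Space (n + 1)) :
    dropCoord i (x - y) = dropCoord i x - dropCoord i y := by ext k; simp

lemma continuous_dropCoord (i : Fin (n + 1)) : Continuous (dropCoord i) := by
  unfold dropCoord; fun_prop

lemma norm_sq_eq_dropCoord (i : Fin (n + 1)) (x : Space (n + 1)) :
    ‖x‖ ^ 2 = x i ^ 2 + ‖dropCoord i x‖ ^ 2 := by
  rw [EuclideanSpace.norm_sq_eq, EuclideanSpace.norm_sq_eq, Fin.sum_univ_succAbove _ i]
  simp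

lemma inner_eq_dropCoord (i : Fin (n + 1)) (x y : Space (n + 1)) :
    ⟪x, y⟫ = x i * y i + ⟪dropCoord i x, dropCoord i y⟫ := by
  simp only [PiLp.inner_apply, Fin.sum_univ_succAbove _ i]
  simp [mul_comm]

lemma norm_dropCoord_le (i : Fin (n + 1)) (x : Space (n + 1)) : ‖dropCoord i x‖ ≤ ‖x‖ := by
  refine le_of_sq_le_sq ?_ (norm_nonneg _)
  rw [norm_sq_eq_dropCoord i x]; nlinarith [sq_nonneg (x i)]

lemma norm_le_dropCoord (i : Fin (n + 1)) (x : Space (n + 1)) :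
    ‖x‖ ≤ |x i| + ‖dropCoord i x‖ := by
  refine le_of_sq_le_sq ?_ (by positivity)
  rw [norm_sq_eq_dropCoord i x, add_sq, sq_abs]
  nlinarith [mul_nonneg (abs_nonneg (x i)) (norm_nonneg (dropCoord i x))]

lemma measurePreserving_insertCoord (i : Fin (n + 1)) :
    MeasurePreserving (fun q : Space n × ℝ => insertCoord i q.1 q.2)
      (volume.prod volume) volume := by
  have h1 : MeasurePreserving (Prod.map (WithLp.ofLp : Space n → Fin n → ℝ) (id : ℝ → ℝ))
      (volume.prod volume) (volume.prod volume) :=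
    (PiLp.volume_preserving_ofLp (Fin n)).prod (MeasurePreserving.id _)
  have h2 : MeasurePreserving (Prod.swap : (Fin n → ℝ) × ℝ → ℝ × (Fin n → ℝ))
    (volume.prod volume) (volume.prod volume) := Measure.measurePreserving_swap
  have h3 := (volume_preserving_piFinSuccAbove (fun _ : Fin (n + 1) => ℝ) i).symm
  have h4 := PiLp.volume_preserving_toLp (Fin (n + 1))
  exact h4.comp (h3.comp (h2.comp h1))

lemma lintegral_eq_insertCoord (i : Fin (n + 1)) {f : Space (n + 1) → ℝ≥0∞}
    (hf : Measurable f) :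
    ∫⁻ x, f x = ∫⁻ x', ∫⁻ t, f (insertCoord i x' t) := by
  rw [← (measurePreserving_insertCoord i).lintegral_comp hf, lintegral_prod]
  exact (hf.comp (measurePreserving_insertCoord i).measurable).aemeasurable

/-- The complement of a smooth open set contains, near each boundary point, a vertical cone with
vertex at any of its points. -/
lemma exists_exterior_cone {S : Set (Space (n + 1))} (hS : HasSmoothBoundary S)
    {p : Space (n + 1)} (hp : p ∈ frontier S) :
    ∃ (i : Fin (n + 1)) (s : ℝ), |s| = 1 ∧ ∃ L > 0, ∃ r > 0,
      ∀ x ∈ Metric.ball p r, ∀ y ∈ Metric.ball p r, x ∉ S →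
        L * ‖dropCoord i y - dropCoord i x‖ < s * (y i - x i) → y ∉ closure S := by
  obtain ⟨g, hg, ha, hgS⟩ := hS p hp
  set a := ∇ g p
  obtain ⟨i, hi⟩ : ∃ i, a i ≠ 0 := by
    by_contra! h
    exact ha (by ext j; simpa using h j)
  set c := |a i| with hc
  have hc0 : 0 < c := abs_pos.2 hi
  have hstrict : HasStrictFDerivAt g (fderiv ℝ g p) p :=
    (hg.contDiffAt).hasStrictFDerivAt (by simp)
  have hev := (hstrict.isLittleO.def (half_pos hc0))
  rw [nhds_prod_eq] at hev
  obtain ⟨r₁, hr₁, h₁⟩ := Metric.mem_nhds_iff.1 (by rw [← nhds_prod_eq] at hev; exact hev)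
  obtain ⟨r₂, hr₂, h₂⟩ := Metric.mem_nhds_iff.1 hgS
  set r := min r₁ r₂
  have hr : 0 < r := lt_min hr₁ hr₂
  -- With t = |y i - x i| and w the horizontal distance, strict differentiability with error c/2
  -- gives g y ≥ g x + c t - ‖a‖ w - (c/2)(t + w). This is positive once t > (2‖a‖/c + 1) w, which
  -- is the slope of the cone.
  refine ⟨i, a i / c, by rw [abs_div, abs_abs, div_self hc0.ne'], 2 * ‖a‖ / c + 1,
    by positivity, r, hr, fun x hx y hy hxS hcone => ?_⟩
  have hmem : ∀ z ∈ Metric.ball p r, (z ∈ S ↔ g z < 0) := fun z hz =>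
    h₂ (Metric.ball_subset_ball (min_le_right _ _) hz)
  have hgx : 0 ≤ g x := not_lt.1 fun h => hxS ((hmem x hx).2 h)
  have hpair : ‖g y - g x - fderiv ℝ g p (y - x)‖ ≤ c / 2 * ‖y - x‖ := by
    have : ((y, x) : Space (n + 1) × Space (n + 1)) ∈ Metric.ball (p, p) r₁ := by
      rw [← ball_prod_same]
      exact ⟨Metric.ball_subset_ball (min_le_left _ _) hy,
        Metric.ball_subset_ball (min_le_left _ _) hx⟩
    simpa using h₁ this
  rw [← inner_gradient_left, inner_eq_dropCoord i] at hpair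
  have hv := norm_le_dropCoord i (y - x)
  have hcs : |⟪dropCoord i a, dropCoord i (y - x)⟫| ≤ ‖a‖ * ‖dropCoord i (y - x)‖ :=
    (abs_real_inner_le_norm _ _).trans (by gcongr; exact norm_dropCoord_le i a)
  rw [← dropCoord_sub] at hcone
  set w := ‖dropCoord i (y - x)‖
  have hw : 0 ≤ w := norm_nonneg _
  have hpos : 0 < a i / c * (y i - x i) := lt_of_le_of_lt (by positivity) hcone
  have habs : |(y - x) i| = a i / c * (y i - x i) := by
    rw [← abs_of_pos hpos, abs_mul, abs_div, hc, abs_abs, div_self hc0.ne', one_mul]; simp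
  have hai : a i * (y - x) i = c * |(y - x) i| := by
    rw [habs]; field_simp; simp
  rw [← habs] at hcone
  rw [Real.norm_eq_abs, hai] at hpair
  have hgy : 0 < g y := by
    have e1 := (abs_le.1 hpair).1
    have e2 := (abs_le.1 hcs).1
    have e3 : c * ((2 * ‖a‖ / c + 1) * w) = 2 * ‖a‖ * w + c * w := by field_simp
    have e4 := mul_lt_mul_of_pos_left hcone hc0
    have e5 : c / 2 * ‖y - x‖ ≤ c / 2 * (|(y - x) i| + w) := by gcongr
    linarith
  -- The strict inequality `0 < g y` persists near `y`, so a whole neighbourhood misses `S`, which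
  -- gives the closure and not only `S`.
  rw [mem_closure_iff_nhds]
  push Not
  refine ⟨Metric.ball p r ∩ g ⁻¹' Ioi 0, ((Metric.isOpen_ball).inter
    (isOpen_Ioi.preimage hg.continuous)).mem_nhds ⟨hy, hgy⟩, ?_⟩
  rw [eq_empty_iff_forall_notMem]
  rintro z ⟨⟨hz, hz'⟩, hzS⟩
  exact lt_asymm hz' ((hmem z hz).1 hzS)

/-- The cylinder around `p` with axis in direction `i`, radius `ρ` and half-height `h`. -/
def cylinder (i : Fin (n + 1)) (p : Space (n + 1)) (ρ h : ℝ) : Set (Space (n + 1)) :=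
  {x | ‖dropCoord i x - dropCoord i p‖ < ρ ∧ |x i - p i| < h}

/-- The outer quarter of a cylinder on the side `s = ± 1`. -/
def cylinderCap (i : Fin (n + 1)) (p : Space (n + 1)) (ρ h s : ℝ) : Set (Space (n + 1)) :=
  {x | ‖dropCoord i x - dropCoord i p‖ < ρ ∧ s * (x i - p i) ∈ Ioo (h / 2) h}

lemma isOpen_cylinder (i : Fin (n + 1)) (p : Space (n + 1)) (ρ h : ℝ) :
    IsOpen (cylinder i p ρ h) := by
  have := continuous_dropCoord i
  have h1 : IsOpen {x | ‖dropCoord i x - dropCoord i p‖ < ρ} :=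
    isOpen_lt (by fun_prop) continuous_const
  have h2 : IsOpen {x : Space (n + 1) | |x i - p i| < h} :=
    isOpen_lt (by fun_prop) continuous_const
  exact h1.inter h2

lemma isOpen_cylinderCap (i : Fin (n + 1)) (p : Space (n + 1)) (ρ h s : ℝ) :
    IsOpen (cylinderCap i p ρ h s) := by
  have := continuous_dropCoord i
  have h1 : IsOpen {x | ‖dropCoord i x - dropCoord i p‖ < ρ} :=
    isOpen_lt (by fun_prop) continuous_const
  have h2 : IsOpen ((fun x : Space (n + 1) => s * (x i - p i)) ⁻¹' Ioo (h / 2) h) :=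
    isOpen_Ioo.preimage (by fun_prop)
  exact h1.inter h2

lemma convex_cylinderCap (i : Fin (n + 1)) (p : Space (n + 1)) (ρ h s : ℝ) :
    Convex ℝ (cylinderCap i p ρ h s) := by
  let D : Space (n + 1) →ₗ[ℝ] Space n :=
    { toFun := dropCoord i
      map_add' := fun x y => by ext; simp
      map_smul' := fun c x => by ext; simp }
  let c : Space (n + 1) →ₗ[ℝ] ℝ :=
    { toFun := fun x => s * x i
      map_add' := fun x y => by simp [mul_add]
      map_smul' := fun c x => by simp; ring }
  have h1 : Convex ℝ (D ⁻¹' Metric.ball (dropCoord i p) ρ) :=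
    (convex_ball _ _).linear_preimage D
  have h2 : Convex ℝ (c ⁻¹' Ioo (h / 2 + s * p i) (h + s * p i)) :=
    (convex_Ioo _ _).linear_preimage c
  convert h1.inter h2 using 1
  ext x
  simp only [cylinderCap, mem_ofPred_eq, mem_Ioo, mem_inter_iff, mem_preimage, Metric.mem_ball,
    dist_eq_norm, D, c, LinearMap.coe_mk, AddHom.coe_mk, mul_sub]
  constructor <;> rintro ⟨h1, h2, h3⟩ <;> refine ⟨h1, ?_, ?_⟩ <;> linarith

lemma cylinderCap_subset_cylinder (i : Fin (n + 1)) (p : Space (n + 1)) (ρ h : ℝ) {s : ℝ}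
    (hs : |s| = 1) : cylinderCap i p ρ h s ⊆ cylinder i p ρ h := by
  rintro x ⟨h1, h2, h3⟩
  refine ⟨h1, ?_⟩
  have : |x i - p i| = |s * (x i - p i)| := by rw [abs_mul, hs, one_mul]
  rw [this, abs_lt]
  constructor <;> linarith

lemma cylinder_subset_ball (i : Fin (n + 1)) (p : Space (n + 1)) {ρ h r : ℝ}
    (hr : ρ + h ≤ r) : cylinder i p ρ h ⊆ Metric.ball p r := by
  rintro x ⟨h1, h2⟩
  rw [Metric.mem_ball, dist_eq_norm]
  have := norm_le_dropCoord i (x - p)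
  rw [dropCoord_sub] at this
  simp only [PiLp.sub_apply] at this
  linarith

/-- A graph-like neighbourhood of a boundary point `p` of `S`: a cylinder in which the complement
of `S` is closed under moving vertically to the side `s`. -/
structure IsGraphCylinder (S : Set (Space (n + 1))) (i : Fin (n + 1)) (p : Space (n + 1))
    (ρ h s : ℝ) (K : ℝ≥0) : Prop where
  radius_pos : 0 < ρ
  height_pos : 0 < h
  sign : |s| = 1
  up : ∀ x ∈ cylinder i p ρ h, x ∉ S → ∀ t, |t - p i| < h → 0 < s * (t - x i) →
    insertCoord i (dropCoord i x) t ∉ closure S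
  cap : cylinderCap i p ρ h s ⊆ (closure S)ᶜ
  antilipschitz : ∀ x ∈ frontier S ∩ cylinder i p ρ h, ∀ y ∈ frontier S ∩ cylinder i p ρ h,
    ‖x - y‖ ≤ K * ‖dropCoord i x - dropCoord i y‖

/-- Everything follows from the exterior cone. The radius is at most `h / (2 * L)`, so that the cap,
at height above `h / 2`, lies in the cone with vertex `p`. Two boundary points of the cylinder never
lie in each other's cones, so the boundary has slope at most `L` over its projection, whence the
antilipschitz constant `L + 1`. -/
lemma exists_isGraphCylinder {S : Set (Space (n + 1))} (hSo : IsOpen S)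
    (hS : HasSmoothBoundary S) {p : Space (n + 1)} (hp : p ∈ frontier S)
    {U : Set (Space (n + 1))} (hU : U ∈ 𝓝 p) :
    ∃ i ρ h s K, IsGraphCylinder S i p ρ h s K ∧ cylinder i p ρ h ⊆ U := by
  obtain ⟨i, s, hs, L, hL, r₁, hr₁, hcone⟩ := exists_exterior_cone hS hp
  obtain ⟨r₂, hr₂, hrU⟩ := Metric.mem_nhds_iff.1 hU
  set r := min r₁ r₂
  have hr : 0 < r := lt_min hr₁ hr₂
  set h := r / 2 with hh
  set ρ := min (r / 2) (h / (2 * L)) with hρ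
  have hh0 : 0 < h := by positivity
  have hρ0 : 0 < ρ := by positivity
  have hNr : cylinder i p ρ h ⊆ Metric.ball p r :=
    cylinder_subset_ball i p (by linarith [min_le_left (r / 2) (h / (2 * L))])
  have hN1 : cylinder i p ρ h ⊆ Metric.ball p r₁ :=
    hNr.trans (Metric.ball_subset_ball (min_le_left _ _))
  have hnot : ∀ x ∈ frontier S, x ∉ S := fun x hx => by
    rw [hSo.frontier_eq] at hx; exact hx.2
  refine ⟨i, ρ, h, s, (L + 1).toNNReal, ⟨hρ0, hh0, hs, ?_, ?_, ?_⟩,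
    hNr.trans ((Metric.ball_subset_ball (min_le_right _ _)).trans hrU)⟩
  · intro x hx hxS t ht hst
    refine hcone x (hN1 hx) _ (hN1 ⟨by simpa using hx.1, by simpa using ht⟩) hxS ?_
    simpa using hst
  · intro x hx
    refine hcone p (Metric.mem_ball_self hr₁) x
      (hN1 (cylinderCap_subset_cylinder i p ρ h hs hx)) (hnot p hp) ?_
    calc L * ‖dropCoord i x - dropCoord i p‖ ≤ L * (h / (2 * L)) := by
          gcongr; exact hx.1.le.trans (min_le_right _ _)
      _ = h / 2 := by field_simp
      _ < _ := hx.2.1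
  · intro x hx y hy
    have key : ∀ x ∈ frontier S ∩ cylinder i p ρ h, ∀ y ∈ frontier S ∩ cylinder i p ρ h,
        s * (y i - x i) ≤ L * ‖dropCoord i y - dropCoord i x‖ := by
      intro x hx y hy
      by_contra! hlt
      exact hcone x (hN1 hx.2) y (hN1 hy.2) (hnot x hx.1) hlt (frontier_subset_closure hy.1)
    have h1 := key x hx y hy
    have h2 := key y hy x hx
    rw [norm_sub_rev (dropCoord i y)] at h1
    have h3 : |x i - y i| ≤ L * ‖dropCoord i x - dropCoord i y‖ := by
      rw [← one_mul |x i - y i|, ← hs, ← abs_mul, abs_le]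
      constructor <;> linarith
    have h4 := norm_le_dropCoord i (x - y)
    rw [dropCoord_sub] at h4
    simp only [PiLp.sub_apply] at h4
    rw [Real.coe_toNNReal _ (by positivity)]
    linarith

end FiltrationCombustion

end

/-! ### Poincaré and trace inequalities in a graph cylinder. -/

noncomputable section

namespace FiltrationCombustion

variable {n : ℕ}

lemma enorm_sub_sq_le_two_mul {G : Type*} [NormedAddCommGroup G] (a b c : G) :
    ‖a - c‖ₑ ^ 2 ≤ 2 * ‖a - b‖ₑ ^ 2 + 2 * ‖b - c‖ₑ ^ 2 := by
  simp only [← ofReal_norm, ← ENNReal.ofReal_pow (norm_nonneg _)]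
  rw [← ENNReal.ofReal_ofNat, ← ENNReal.ofReal_mul (by norm_num),
    ← ENNReal.ofReal_mul (by norm_num), ← ENNReal.ofReal_add (by positivity) (by positivity)]
  apply ENNReal.ofReal_le_ofReal
  have := norm_sub_le_norm_sub_add_norm_sub a b c
  nlinarith [sq_nonneg (‖a - b‖ - ‖b - c‖), norm_nonneg (a - c)]

lemma volume_cap_interval {s h q : ℝ} (hs : |s| = 1) :
    volume {τ : ℝ | s * (τ - q) ∈ Ioo (h / 2) h} = ENNReal.ofReal (h / 2) := by
  rcases eq_or_eq_neg_of_abs_eq hs with rfl | rfl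
  · have : {τ : ℝ | 1 * (τ - q) ∈ Ioo (h / 2) h} = Ioo (q + h / 2) (q + h) := by
      ext τ; simp only [mem_ofPred_eq, mem_Ioo, one_mul]
      constructor <;> rintro ⟨h1, h2⟩ <;> constructor <;> linarith
    rw [this, Real.volume_Ioo]; congr 1; ring
  · have : {τ : ℝ | -1 * (τ - q) ∈ Ioo (h / 2) h} = Ioo (q - h) (q - h / 2) := by
      ext τ; simp only [mem_ofPred_eq, mem_Ioo]
      constructor <;> rintro ⟨h1, h2⟩ <;> constructor <;> linarith
    rw [this, Real.volume_Ioo]; congr 1; ring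

namespace IsGraphCylinder

variable {S : Set (Space (n + 1))} {i : Fin (n + 1)} {p : Space (n + 1)} {ρ h s : ℝ} {K : ℝ≥0}

/-- The vertical segment from `x` to a point of the cap avoids `closure S`. If the cap point lies on
the side `s` of `x`, this is the field `up`. Otherwise `x` is beyond the chosen level `τ`, and the
points in between are themselves in the cap. -/
lemma insertCoord_mem (hN : IsGraphCylinder S i p ρ h s K) {x : Space (n + 1)}
    (hx : x ∈ cylinder i p ρ h) (hxS : x ∉ S) {τ u : ℝ}
    (hτ : s * (τ - p i) ∈ Ioo (h / 2) h)
    (hu : u ∈ Ioo (min (x i) τ) (max (x i) τ)) :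
    insertCoord i (dropCoord i x) u ∈ cylinder i p ρ h \ closure S := by
  have hxi := abs_lt.1 hx.2
  have hh := hN.height_pos
  obtain ⟨hτ1, hτ2⟩ := hτ
  obtain ⟨hu1, hu2⟩ := hu
  have hτp : |τ - p i| < h := by
    have : |τ - p i| = |s * (τ - p i)| := by rw [abs_mul, hN.sign, one_mul]
    rw [this, abs_lt]; constructor <;> linarith
  have hτp' := abs_lt.1 hτp
  have hup : |u - p i| < h := by
    rw [abs_lt]
    rcases le_total (x i) τ with hle | hle
    · rw [min_eq_left hle] at hu1; rw [max_eq_right hle] at hu2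
      constructor <;> linarith
    · rw [min_eq_right hle] at hu1; rw [max_eq_left hle] at hu2
      constructor <;> linarith
  have hmem : insertCoord i (dropCoord i x) u ∈ cylinder i p ρ h :=
    ⟨by simpa using hx.1, by simpa using hup⟩
  refine ⟨hmem, ?_⟩
  by_cases hpos : 0 < s * (u - x i)
  · exact hN.up x hx hxS u hup hpos
  · refine hN.cap ⟨by simpa using hx.1, ?_⟩
    have hup' := abs_lt.1 hup
    simp only [insertCoord_apply_same, mem_Ioo]
    rcases eq_or_eq_neg_of_abs_eq hN.sign with rfl | rfl
    · rcases le_total (x i) τ with hle | hle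
      · rw [min_eq_left hle] at hu1; exact absurd (by linarith) hpos
      · rw [min_eq_right hle] at hu1; constructor <;> linarith
    · rcases le_total (x i) τ with hle | hle
      · rw [max_eq_right hle] at hu2; constructor <;> linarith
      · rw [max_eq_left hle] at hu2; exact absurd (by linarith) hpos

/-- Pointwise control of a function on the vertical lines of a graph cylinder. -/
lemma enorm_sub_sq_le (hN : IsGraphCylinder S i p ρ h s K) {η : Space (n + 1) → ℝ}
    (hη : ContDiff ℝ 1 η) (m : ℝ) {x : Space (n + 1)} (hx : x ∈ cylinder i p ρ h) (hxS : x ∉ S) :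
    ‖η x - m‖ₑ ^ 2 ≤ ENNReal.ofReal (4 * h + 4 / h) *
      ∫⁻ u, ((cylinder i p ρ h \ closure S).indicator (fun z => ‖∇ η z‖ₑ ^ 2) +
        (cylinderCap i p ρ h s).indicator (fun z => ‖η z - m‖ₑ ^ 2))
          (insertCoord i (dropCoord i x) u) := by
  have hh := hN.height_pos
  set x' := dropCoord i x
  have hins : Measurable fun u => insertCoord i x' u :=
    (measurePreserving_insertCoord i).measurable.comp (by fun_prop : Measurable fun u => (x', u))
  set W := cylinder i p ρ h \ closure S
  have hW : MeasurableSet W :=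
    (isOpen_cylinder i p ρ h).measurableSet.diff isClosed_closure.measurableSet
  have hgm : Measurable fun z => ‖∇ η z‖ₑ ^ 2 :=
    (continuous_gradient hη).measurable.enorm.pow_const 2
  have hηm : Measurable η := hη.continuous.measurable
  set A : ℝ → ℝ≥0∞ := fun u => W.indicator (fun z => ‖∇ η z‖ₑ ^ 2) (insertCoord i x' u)
  set B : ℝ → ℝ≥0∞ := fun u =>
    (cylinderCap i p ρ h s).indicator (fun z => ‖η z - m‖ₑ ^ 2) (insertCoord i x' u)
  have hA : Measurable A := (hgm.indicator hW).comp hins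
  have hB : Measurable B :=
    (Measurable.indicator (by fun_prop) (isOpen_cylinderCap i p ρ h s).measurableSet).comp hins
  set T := {τ : ℝ | s * (τ - p i) ∈ Ioo (h / 2) h}
  have hT : MeasurableSet T :=
    (isOpen_Ioo.preimage (by fun_prop : Continuous fun τ : ℝ => s * (τ - p i))).measurableSet
  -- Comparison with the cap point at level `τ` on the same vertical line: the segment has length at
  -- most `2 * h`, and its gradient integral is part of that over the whole line.
  have hpt : ∀ τ ∈ T, ‖η x - m‖ₑ ^ 2 ≤
      2 * B τ + 2 * (ENNReal.ofReal (2 * h) * ∫⁻ u, A u) := by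
    intro τ hτ
    have h1 := enorm_sub_sq_le_lintegral_line hη x (EuclideanSpace.single i (1 : ℝ)) 0 (τ - x i)
    have hxi := abs_lt.1 hx.2
    have hτp : |τ - p i| < h := by
      have : |τ - p i| = |s * (τ - p i)| := by rw [abs_mul, hN.sign, one_mul]
      rw [this, abs_lt]; constructor <;> linarith [hτ.1, hτ.2]
    have hτp' := abs_lt.1 hτp
    have h2 : ∫⁻ t in Ioo (min 0 (τ - x i)) (max 0 (τ - x i)),
        ‖∇ η (x + t • EuclideanSpace.single i (1 : ℝ))‖ₑ ^ 2 ≤ ∫⁻ u, A u := by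
      rw [← lintegral_add_right_eq_self A (x i), ← lintegral_indicator measurableSet_Ioo]
      refine lintegral_mono fun t => ?_
      by_cases ht : t ∈ Ioo (min 0 (τ - x i)) (max 0 (τ - x i))
      swap
      · rw [indicator_of_notMem ht]; exact zero_le
      rw [indicator_of_mem ht]
      have hmem : insertCoord i x' (t + x i) ∈ W := by
        refine hN.insertCoord_mem hx hxS hτ ⟨?_, ?_⟩
        · have := ht.1
          rw [← sub_self (x i), min_sub_sub_right] at this; linarith
        · have := ht.2
          rw [← sub_self (x i), max_sub_sub_right] at this; linarith
      simp only [A, indicator_of_mem hmem]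
      rw [insertCoord_dropCoord]; simp
    have h3 : insertCoord i x' τ ∈ cylinderCap i p ρ h s :=
      ⟨by simpa [x'] using hx.1, by rw [insertCoord_apply_same]; exact hτ⟩
    have h4 : B τ = ‖η (insertCoord i x' τ) - m‖ₑ ^ 2 := by simp only [B, indicator_of_mem h3]
    rw [zero_smul, add_zero, ← insertCoord_dropCoord, sub_zero,
      ← ofReal_norm (EuclideanSpace.single _ _),
      PiLp.norm_single, norm_one, ENNReal.ofReal_one, one_pow, mul_one] at h1
    refine (enorm_sub_sq_le_two_mul _ (η (insertCoord i x' τ)) _).trans ?_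
    rw [h4, add_comm]
    gcongr 2 * _ + 2 * ?_
    rw [← enorm_neg, neg_sub]
    refine h1.trans ?_
    gcongr
    rw [abs_le]; constructor <;> linarith
  -- Integration over the levels of the cap, a set of length `h / 2`. Division by that length
  -- produces the coefficients `4 * h` (gradient) and `4 / h` (cap).
  have hint : ENNReal.ofReal (h / 2) * ‖η x - m‖ₑ ^ 2 ≤
      2 * (∫⁻ u, B u) + ENNReal.ofReal (2 * h * h) * ∫⁻ u, A u := by
    calc ENNReal.ofReal (h / 2) * ‖η x - m‖ₑ ^ 2 = ∫⁻ τ in T, ‖η x - m‖ₑ ^ 2 := by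
          rw [setLIntegral_const, volume_cap_interval hN.sign, mul_comm]
      _ ≤ ∫⁻ τ in T, (2 * B τ + 2 * (ENNReal.ofReal (2 * h) * ∫⁻ u, A u)) :=
          setLIntegral_mono' hT hpt
      _ = 2 * (∫⁻ τ in T, B τ) +
            2 * (ENNReal.ofReal (2 * h) * ∫⁻ u, A u) * ENNReal.ofReal (h / 2) := by
          rw [lintegral_add_left (hB.const_mul 2), lintegral_const_mul _ hB, setLIntegral_const,
            volume_cap_interval hN.sign]
      _ ≤ _ := by
          gcongr ?_ + ?_
          · gcongr; exact Measure.restrict_le_self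
          · refine le_of_eq ?_
            rw [← ENNReal.ofReal_ofNat, ← mul_assoc, ← ENNReal.ofReal_mul (by norm_num),
              mul_right_comm, ← ENNReal.ofReal_mul (by positivity)]
            congr 2; ring
  have hsum : ∫⁻ u, (W.indicator (fun z => ‖∇ η z‖ₑ ^ 2) +
        (cylinderCap i p ρ h s).indicator (fun z => ‖η z - m‖ₑ ^ 2)) (insertCoord i x' u) =
      (∫⁻ u, A u) + ∫⁻ u, B u := by
    rw [← lintegral_add_left hA]; rfl
  rw [hsum]
  have hc0 : ENNReal.ofReal (h / 2) ≠ 0 := by simp [hh]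
  rw [← ENNReal.mul_le_mul_iff_right hc0 ENNReal.ofReal_ne_top]
  refine hint.trans ?_
  rw [← mul_assoc, ← ENNReal.ofReal_mul (by positivity), mul_add, add_comm]
  have e : h / 2 * (4 * h + 4 / h) = 2 * h * h + 2 := by field_simp; ring
  rw [e]
  gcongr
  · linarith
  · rw [← ENNReal.ofReal_ofNat]
    exact ENNReal.ofReal_le_ofReal (by nlinarith)

lemma isBounded_cylinder (i : Fin (n + 1)) (p : Space (n + 1)) (ρ h : ℝ) :
    Bornology.IsBounded (cylinder i p ρ h) :=
  Metric.isBounded_ball.subset (cylinder_subset_ball i p le_rfl)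

lemma cylinderCap_subset (hN : IsGraphCylinder S i p ρ h s K) :
    cylinderCap i p ρ h s ⊆ cylinder i p ρ h \ closure S := fun _ hx =>
  ⟨cylinderCap_subset_cylinder i p ρ h hN.sign hx, hN.cap hx⟩

/-- The Poincaré inequality on the part of a graph cylinder outside `S`. -/
theorem exists_poincare (hN : IsGraphCylinder S i p ρ h s K) :
    ∃ C : ℝ≥0, ∀ η : Space (n + 1) → ℝ, ContDiff ℝ 1 η → ∃ m : ℝ,
      ∫⁻ y in cylinder i p ρ h \ closure S, ‖η y - m‖ₑ ^ 2 ≤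
        C * ∫⁻ y in cylinder i p ρ h \ closure S, ‖∇ η y‖ₑ ^ 2 := by
  -- The constant `m` is taken from the convex cap; the vertical estimate carries it to the rest of
  -- the cylinder.
  obtain ⟨C₀, hC₀⟩ := exists_poincare_of_convex (volume : Measure (Space (n + 1)))
    (isOpen_cylinderCap i p ρ h s).measurableSet (convex_cylinderCap i p ρ h s)
    ((isBounded_cylinder i p ρ h).subset (cylinderCap_subset_cylinder i p ρ h hN.sign))
  set C₁ : ℝ≥0 := (4 * h + 4 / h).toNNReal
  refine ⟨(2 * h).toNNReal * C₁ * (1 + C₀), fun η hη => ?_⟩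
  obtain ⟨m, hm⟩ := hC₀ η hη
  refine ⟨m, ?_⟩
  set W := cylinder i p ρ h \ closure S
  set R := cylinderCap i p ρ h s
  have hW : MeasurableSet W :=
    (isOpen_cylinder i p ρ h).measurableSet.diff isClosed_closure.measurableSet
  have hR : MeasurableSet R := (isOpen_cylinderCap i p ρ h s).measurableSet
  have hgm : Measurable fun z => ‖∇ η z‖ₑ ^ 2 :=
    (continuous_gradient hη).measurable.enorm.pow_const 2
  have hηm : Measurable η := hη.continuous.measurable
  have hηm' : Measurable fun z => ‖η z - m‖ₑ ^ 2 := by fun_prop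
  set G : Space (n + 1) → ℝ≥0∞ := W.indicator (fun z => ‖∇ η z‖ₑ ^ 2) +
    R.indicator (fun z => ‖η z - m‖ₑ ^ 2) with hG
  have hGm : Measurable G := (hgm.indicator hW).add (hηm'.indicator hR)
  have hGi : ∫⁻ x, G x ≤ (1 + C₀) * ∫⁻ y in W, ‖∇ η y‖ₑ ^ 2 := by
    simp only [hG, Pi.add_apply]
    rw [lintegral_add_left (hgm.indicator hW), lintegral_indicator hW, lintegral_indicator hR,
      add_mul, one_mul]
    gcongr
    refine hm.trans ?_
    gcongr
    exact hN.cylinderCap_subset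
  calc ∫⁻ y in W, ‖η y - m‖ₑ ^ 2
      = ∫⁻ x', ∫⁻ t, W.indicator (fun z => ‖η z - m‖ₑ ^ 2) (insertCoord i x' t) := by
        rw [← lintegral_indicator hW, lintegral_eq_insertCoord i (hηm'.indicator hW)]
    _ ≤ ∫⁻ x', ∫⁻ t, (Ioo (p i - h) (p i + h)).indicator
          (fun _ => C₁ * ∫⁻ u, G (insertCoord i x' u)) t := by
        refine lintegral_mono fun x' => lintegral_mono fun t => ?_
        -- The bound depends on `z` only through its projection and whether its height lies in the
        -- interval, so after integration in the vertical variable it contributes the factor `2 *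
        -- h`.
        refine indicator_le' (f := fun z => ‖η z - m‖ₑ ^ 2)
          (g := fun z => (Ioo (p i - h) (p i + h)).indicator
            (fun _ => C₁ * ∫⁻ u, G (insertCoord i (dropCoord i z) u)) (z i))
          (fun z hz => ?_) (fun _ _ => zero_le) (insertCoord i x' t) |>.trans (by simp)
        have h1 : z i ∈ Ioo (p i - h) (p i + h) := by
          have := abs_lt.1 hz.1.2
          constructor <;> linarith
        rw [indicator_of_mem h1]
        exact hN.enorm_sub_sq_le hη m hz.1 fun h => hz.2 (subset_closure h)
    _ = ∫⁻ x', ENNReal.ofReal (2 * h) * C₁ * ∫⁻ u, G (insertCoord i x' u) := by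
        refine lintegral_congr fun x' => ?_
        rw [lintegral_indicator measurableSet_Ioo, setLIntegral_const, Real.volume_Ioo]
        ring_nf
    _ = ENNReal.ofReal (2 * h) * C₁ * ∫⁻ x, G x := by
        rw [lintegral_const_mul', lintegral_eq_insertCoord i hGm]
        exact ENNReal.mul_ne_top ENNReal.ofReal_ne_top ENNReal.coe_ne_top
    _ ≤ ENNReal.ofReal (2 * h) * C₁ * ((1 + C₀) * ∫⁻ y in W, ‖∇ η y‖ₑ ^ 2) := by gcongr
    _ = _ := by
        push_cast
        rw [← mul_assoc]; rfl

/-- The projection of the boundary measure of a graph cylinder is dominated by Lebesgue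
measure. -/
lemma setLIntegral_frontier_comp_le (hN : IsGraphCylinder S i p ρ h s K) {f : Space n → ℝ≥0∞}
    (hf : Measurable f) :
    ∫⁻ x in frontier S ∩ cylinder i p ρ h, f (dropCoord i x)
        ∂(Measure.euclideanHausdorffMeasure n) ≤
      K ^ n * ∫⁻ x' in Metric.ball (dropCoord i p) ρ, f x' := by
  set A := frontier S ∩ cylinder i p ρ h with hA
  have hD : Measurable (dropCoord i) := (continuous_dropCoord i).measurable
  have hmap : Measure.map (dropCoord i) ((Measure.euclideanHausdorffMeasure n).restrict A) ≤
      (K : ℝ≥0∞) ^ n • volume.restrict (Metric.ball (dropCoord i p) ρ) := by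
    refine Measure.le_iff.2 fun B hB => ?_
    rw [Measure.map_apply hD hB, Measure.restrict_apply (hD hB), Measure.smul_apply, smul_eq_mul,
      Measure.restrict_apply hB]
    set A' := dropCoord i ⁻¹' B ∩ A
    have hanti : AntilipschitzWith K (A'.domRestrict (dropCoord i)) := by
      refine AntilipschitzWith.of_le_mul_dist fun x y => ?_
      rw [dist_eq_norm, Subtype.dist_eq, dist_eq_norm]
      exact hN.antilipschitz x x.2.2 y y.2.2
    have hinj : InjOn (dropCoord i) A' := injOn_iff_injective.2 hanti.injective
    -- The inverse of the projection is `K`-Lipschitz and maps the shadow of `A'` back onto `A'`, so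
    -- the `n`-dimensional measure grows by at most `K ^ n`.
    set g := Function.invFunOn (dropCoord i) A'
    have hlip : LipschitzOnWith K g (dropCoord i '' A') := by
      rw [lipschitzOnWith_iff_restrict]
      exact hanti.to_rightInvOn'
        (fun y hy => Function.invFunOn_mem hy) (fun y hy => Function.invFunOn_eq hy)
    have himg : g '' (dropCoord i '' A') = A' := hinj.leftInvOn_invFunOn.image_image
    have h1 := hlip.hausdorffMeasure_image_le (Nat.cast_nonneg n)
    rw [himg, ENNReal.rpow_natCast] at h1
    calc Measure.euclideanHausdorffMeasure n A'
        ≤ K ^ n * Measure.euclideanHausdorffMeasure n (dropCoord i '' A') := by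
          rw [Measure.euclideanHausdorffMeasure_def, Measure.euclideanHausdorffMeasure_def,
            Measure.smul_apply, Measure.smul_apply, ENNReal.smul_def, ENNReal.smul_def,
            smul_eq_mul, smul_eq_mul, mul_left_comm]
          gcongr
      _ ≤ K ^ n * volume (B ∩ Metric.ball (dropCoord i p) ρ) := by
          rw [EuclideanSpace.euclideanHausdorffMeasure_eq_volume]
          gcongr
          rintro _ ⟨x, hx, rfl⟩
          exact ⟨hx.1, by rw [Metric.mem_ball, dist_eq_norm]; exact hx.2.2.1⟩
  calc ∫⁻ x in A, f (dropCoord i x) ∂(Measure.euclideanHausdorffMeasure n)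
      = ∫⁻ x', f x' ∂(Measure.map (dropCoord i)
          ((Measure.euclideanHausdorffMeasure n).restrict A)) := (lintegral_map hf hD).symm
    _ ≤ _ := lintegral_mono' hmap le_rfl
    _ = _ := by rw [lintegral_smul_measure, smul_eq_mul]

lemma euclideanHausdorffMeasure_frontier_lt_top (hN : IsGraphCylinder S i p ρ h s K) :
    Measure.euclideanHausdorffMeasure n (frontier S ∩ cylinder i p ρ h) < ∞ := by
  have := hN.setLIntegral_frontier_comp_le (f := fun _ => 1) measurable_const
  rw [setLIntegral_one, setLIntegral_one] at this
  refine this.trans_lt (ENNReal.mul_lt_top ?_ measure_ball_lt_top)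
  exact ENNReal.pow_lt_top ENNReal.coe_lt_top

/-- The trace inequality in a graph cylinder. -/
theorem exists_trace (hSo : IsOpen S) (hN : IsGraphCylinder S i p ρ h s K) :
    ∃ C : ℝ≥0, ∀ η : Space (n + 1) → ℝ, ContDiff ℝ 1 η →
      ∫⁻ y in frontier S ∩ cylinder i p ρ h, ‖η y‖ₑ ^ 2 ∂(Measure.euclideanHausdorffMeasure n) ≤
        C * ∫⁻ y in cylinder i p ρ h \ closure S, (‖η y‖ₑ ^ 2 + ‖∇ η y‖ₑ ^ 2) := by
  set C₁ : ℝ≥0 := (4 * h + 4 / h).toNNReal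
  refine ⟨K ^ n * C₁, fun η hη => ?_⟩
  set W := cylinder i p ρ h \ closure S
  have hW : MeasurableSet W :=
    (isOpen_cylinder i p ρ h).measurableSet.diff isClosed_closure.measurableSet
  have hgm : Measurable fun z => ‖∇ η z‖ₑ ^ 2 :=
    (continuous_gradient hη).measurable.enorm.pow_const 2
  have hηm : Measurable η := hη.continuous.measurable
  set G : Space (n + 1) → ℝ≥0∞ := W.indicator (fun z => ‖η z‖ₑ ^ 2 + ‖∇ η z‖ₑ ^ 2) with hG
  have hGm : Measurable G := Measurable.indicator ((by fun_prop : Measurable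
    fun z => ‖η z‖ₑ ^ 2).add hgm) hW
  have hGint : Measurable fun x' => ∫⁻ u, G (insertCoord i x' u) :=
    (hGm.comp (measurePreserving_insertCoord i).measurable).lintegral_prod_right'
  have hAm : MeasurableSet (frontier S ∩ cylinder i p ρ h) :=
    isClosed_frontier.measurableSet.inter (isOpen_cylinder i p ρ h).measurableSet
  calc ∫⁻ y in frontier S ∩ cylinder i p ρ h, ‖η y‖ₑ ^ 2 ∂(Measure.euclideanHausdorffMeasure n)
      ≤ ∫⁻ y in frontier S ∩ cylinder i p ρ h, (C₁ * ∫⁻ u, G (insertCoord i (dropCoord i y) u))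
          ∂(Measure.euclideanHausdorffMeasure n) := by
        refine setLIntegral_mono' hAm fun y hy => ?_
        have hyS : y ∉ S := by
          have := hy.1; rw [hSo.frontier_eq] at this; exact this.2
        -- With `m = 0` the cap term is part of the integral of `‖η‖ₑ ^ 2`, since the cap lies in
        -- `W`. The resulting bound depends on `y` only through its projection.
        have := hN.enorm_sub_sq_le hη 0 hy.2 hyS
        rw [sub_zero] at this
        refine this.trans ?_
        change (C₁ : ℝ≥0∞) * _ ≤ _
        gcongr C₁ * ?_
        refine lintegral_mono fun u => ?_
        simp only [hG, Pi.add_apply, sub_zero]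
        set z := insertCoord i (dropCoord i y) u
        by_cases hz : z ∈ W
        · rw [indicator_of_mem hz, indicator_of_mem hz, add_comm]
          gcongr
          exact indicator_le_self _ (fun z => ‖η z‖ₑ ^ 2) z
        · rw [indicator_of_notMem hz, indicator_of_notMem hz,
            indicator_of_notMem fun h => hz (hN.cylinderCap_subset h), add_zero]
    _ ≤ K ^ n * ∫⁻ x' in Metric.ball (dropCoord i p) ρ,
          C₁ * ∫⁻ u, G (insertCoord i x' u) :=
        hN.setLIntegral_frontier_comp_le (hGint.const_mul _)
    _ ≤ K ^ n * ∫⁻ x', C₁ * ∫⁻ u, G (insertCoord i x' u) := by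
        gcongr; exact Measure.restrict_le_self
    _ = K ^ n * (C₁ * ∫⁻ x, G x) := by
        rw [lintegral_const_mul _ hGint, lintegral_eq_insertCoord i hGm]
    _ = _ := by
        rw [hG, lintegral_indicator hW, ← mul_assoc]; push_cast; rfl

end IsGraphCylinder

end FiltrationCombustion

end

/-! ### Global Poincaré and trace inequalities; the surface measure of the interface. -/

noncomputable section

namespace FiltrationCombustion

section Cell

variable {d : ℕ}

lemma isOpen_unitCell : IsOpen (unitCell d) := by
  have : unitCell d = ⋂ i, (fun y : Space d => y i) ⁻¹' Ioo 0 1 := by ext; simp [unitCell]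
  rw [this]
  exact isOpen_iInter_of_finite fun i => isOpen_Ioo.preimage (by fun_prop)

lemma convex_unitCell : Convex ℝ (unitCell d) := by
  intro x hx y hy a b ha hb hab i
  simpa using (convex_Ioo (0 : ℝ) 1) (hx i) (hy i) ha hb hab

lemma isBounded_unitCell : Bornology.IsBounded (unitCell d) := by
  refine (Metric.isBounded_closedBall (x := (0 : Space d)) (r := √d)).subset fun x hx => ?_
  rw [mem_closedBall_zero_iff, EuclideanSpace.norm_eq]
  gcongr
  calc ∑ i, ‖x i‖ ^ 2 ≤ ∑ i : Fin d, (1 : ℝ) := by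
        gcongr with i
        rw [Real.norm_eq_abs, sq_abs]
        nlinarith [(hx i).1, (hx i).2]
    _ = d := by simp

lemma isOpen_gasCell (Ys : Set (Space d)) : IsOpen (gasCell Ys) :=
  isOpen_unitCell.sdiff isClosed_closure

lemma gasCell_subset_unitCell (Ys : Set (Space d)) : gasCell Ys ⊆ unitCell d := sdiff_subset

end Cell

section Poincare

variable {F : Type*} [NormedAddCommGroup F] [InnerProductSpace ℝ F] [MeasurableSpace F]
  [BorelSpace F] [FiniteDimensional ℝ F]

/-- On `W`, smooth functions deviate from a constant by at most a multiple of the Dirichlet energy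
on `V`. -/
def HasPoincare (V W : Set F) : Prop :=
  ∃ C : ℝ≥0, ∀ η : F → ℝ, ContDiff ℝ 1 η → ∃ m : ℝ,
    ∫⁻ y in W, ‖η y - m‖ₑ ^ 2 ≤ C * ∫⁻ y in V, ‖∇ η y‖ₑ ^ 2

lemma HasPoincare.mono {V V' W : Set F} (h : HasPoincare V W) (hV : V ⊆ V') :
    HasPoincare V' W := by
  obtain ⟨C, hC⟩ := h
  refine ⟨C, fun η hη => ?_⟩
  obtain ⟨m, hm⟩ := hC η hη
  exact ⟨m, hm.trans (by gcongr)⟩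

/-- On the overlap both constants approximate the same function, and the overlap has positive finite
measure; hence the difference of the constants is controlled by the energy, and the first constant
also serves on `W₂`. -/
lemma HasPoincare.union {V W₁ W₂ : Set F} (h₁ : HasPoincare V W₁) (h₂ : HasPoincare V W₂)
    (h0 : volume (W₁ ∩ W₂) ≠ 0) (hfin : volume W₂ ≠ ∞) : HasPoincare V (W₁ ∪ W₂) := by
  obtain ⟨C₁, hC₁⟩ := h₁
  obtain ⟨C₂, hC₂⟩ := h₂
  have hfin' : volume (W₁ ∩ W₂) ≠ ∞ := measure_ne_top_of_subset inter_subset_right hfin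
  set v := (volume (W₁ ∩ W₂)).toNNReal
  have hv : (v : ℝ≥0∞) = volume (W₁ ∩ W₂) := ENNReal.coe_toNNReal hfin'
  set w := (volume W₂).toNNReal
  have hw : (w : ℝ≥0∞) = volume W₂ := ENNReal.coe_toNNReal hfin
  have hv0 : v ≠ 0 := by
    intro h; rw [h] at hv; exact h0 hv.symm
  refine ⟨C₁ + (2 * C₂ + 2 * ((2 * C₁ + 2 * C₂) / v) * w), fun η hη => ?_⟩
  obtain ⟨m₁, hm₁⟩ := hC₁ η hη
  obtain ⟨m₂, hm₂⟩ := hC₂ η hη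
  have hηm : Measurable η := hη.continuous.measurable
  set E := ∫⁻ y in V, ‖∇ η y‖ₑ ^ 2
  have hmm : ‖m₂ - m₁‖ₑ ^ 2 ≤ (((2 * C₁ + 2 * C₂) / v : ℝ≥0) : ℝ≥0∞) * E := by
    have h : ‖m₂ - m₁‖ₑ ^ 2 * v ≤ (2 * C₁ + 2 * C₂) * E := by
      calc ‖m₂ - m₁‖ₑ ^ 2 * v = ∫⁻ _ in W₁ ∩ W₂, ‖m₂ - m₁‖ₑ ^ 2 := by
            rw [setLIntegral_const, hv]
        _ ≤ ∫⁻ y in W₁ ∩ W₂, (2 * ‖η y - m₂‖ₑ ^ 2 + 2 * ‖η y - m₁‖ₑ ^ 2) := by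
            refine lintegral_mono fun y => ?_
            have := enorm_sub_sq_le_two_mul m₂ (η y) m₁
            rwa [← enorm_neg (m₂ - η y), neg_sub] at this
        _ = 2 * (∫⁻ y in W₁ ∩ W₂, ‖η y - m₂‖ₑ ^ 2) + 2 * ∫⁻ y in W₁ ∩ W₂, ‖η y - m₁‖ₑ ^ 2 := by
            rw [lintegral_add_left (by fun_prop), lintegral_const_mul _ (by fun_prop),
              lintegral_const_mul _ (by fun_prop)]
        _ ≤ 2 * (C₂ * E) + 2 * (C₁ * E) := by
            gcongr 2 * ?_ + 2 * ?_
            · exact (lintegral_mono_set inter_subset_right).trans hm₂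
            · exact (lintegral_mono_set inter_subset_left).trans hm₁
        _ = _ := by ring
    rw [ENNReal.coe_div hv0, ENNReal.div_eq_inv_mul, mul_assoc, ← ENNReal.div_eq_inv_mul,
      ENNReal.le_div_iff_mul_le (by simp [hv0]) (by simp)]
    exact_mod_cast h
  refine ⟨m₁, (lintegral_union_le _ _ _).trans ?_⟩
  push_cast
  rw [add_mul]
  gcongr
  calc ∫⁻ y in W₂, ‖η y - m₁‖ₑ ^ 2
      ≤ ∫⁻ y in W₂, (2 * ‖η y - m₂‖ₑ ^ 2 + 2 * ‖m₂ - m₁‖ₑ ^ 2) :=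
        lintegral_mono fun y => enorm_sub_sq_le_two_mul _ _ _
    _ = 2 * (∫⁻ y in W₂, ‖η y - m₂‖ₑ ^ 2) + 2 * ‖m₂ - m₁‖ₑ ^ 2 * w := by
        rw [lintegral_add_left (by fun_prop), lintegral_const_mul _ (by fun_prop),
          setLIntegral_const, hw]
    _ ≤ 2 * (C₂ * E) + 2 * ((((2 * C₁ + 2 * C₂) / v : ℝ≥0) : ℝ≥0∞) * E) * w := by gcongr
    _ = _ := by ring

/-- A property of open sets that passes to unions of two intersecting sets holds for a connected
set that has a finite open cover by sets with the property. -/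
lemma IsPreconnected.induction_on_finite_cover {X ι : Type*} [TopologicalSpace X]
    {P : Set X → Prop} {V : Set X} (hV : IsPreconnected V) (hV0 : V.Nonempty) (t : Finset ι)
    {W : ι → Set X} (hW : ∀ k ∈ t, IsOpen (W k)) (hcover : ⋃ k ∈ t, W k = V)
    (hP : ∀ k ∈ t, P (W k))
    (hunion : ∀ A B, IsOpen A → IsOpen B → A ⊆ V → B ⊆ V → (A ∩ B).Nonempty → P A → P B →
      P (A ∪ B)) : P V := by
  classical
  -- A subfamily of maximal cardinality among those with nonempty union having `P`. If any of the
  -- remaining sets is nonempty, connectedness makes one of them meet this union, and adding it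
  -- contradicts maximality.
  set 𝓕 := t.powerset.filter fun s => (⋃ k ∈ s, W k).Nonempty ∧ P (⋃ k ∈ s, W k) with h𝓕
  have hsub : ∀ k ∈ t, W k ⊆ V := fun k hk => hcover ▸ subset_biUnion_of_mem (u := W) hk
  have hne : 𝓕.Nonempty := by
    obtain ⟨x, hx⟩ := hV0
    rw [← hcover] at hx
    obtain ⟨k, hk, hxk⟩ := mem_iUnion₂.1 hx
    exact ⟨{k}, by simp [h𝓕, hk, hP k hk, show (W k).Nonempty from ⟨x, hxk⟩]⟩
  obtain ⟨s, hs, hmax⟩ := Finset.exists_max_image 𝓕 Finset.card hne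
  simp only [h𝓕, Finset.mem_filter, Finset.mem_powerset] at hs hmax
  obtain ⟨hst, hsne, hPs⟩ := hs
  set A := ⋃ k ∈ s, W k
  set B := ⋃ k ∈ t \ s, W k
  have hA : IsOpen A := isOpen_biUnion fun k hk => hW k (hst hk)
  have hB : IsOpen B := isOpen_biUnion fun k hk => hW k (Finset.mem_sdiff.1 hk).1
  have hAV : A ⊆ V := iUnion₂_subset fun k hk => hsub k (hst hk)
  have hBV : B ⊆ V := iUnion₂_subset fun k hk => hsub k (Finset.mem_sdiff.1 hk).1
  have hAB : V ⊆ A ∪ B := by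
    rw [← hcover]
    refine iUnion₂_subset fun k hk => ?_
    by_cases hks : k ∈ s
    · exact (subset_biUnion_of_mem (u := W) hks).trans subset_union_left
    · exact (subset_biUnion_of_mem (u := W) (Finset.mem_sdiff.2 ⟨hk, hks⟩)).trans
        subset_union_right
  rcases B.eq_empty_or_nonempty with hB0 | hBne
  · have : V = A := Subset.antisymm (by simpa [hB0] using hAB) hAV
    rwa [this]
  · obtain ⟨x, -, hxA, hxB⟩ := hV A B hA hB hAB
      (by rwa [inter_eq_self_of_subset_right hAV]) (by rwa [inter_eq_self_of_subset_right hBV])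
    obtain ⟨k, hk, hxk⟩ := mem_iUnion₂.1 hxB
    obtain ⟨hkt, hks⟩ := Finset.mem_sdiff.1 hk
    have hins : ⋃ j ∈ insert k s, W j = A ∪ W k := by
      rw [Finset.set_biUnion_insert, union_comm]
    have := hmax (insert k s) ⟨Finset.insert_subset hkt hst, by
      rw [hins]; exact hsne.mono subset_union_left, by
      rw [hins]; exact hunion _ _ hA (hW k hkt) hAV (hsub k hkt) ⟨x, hxA, hxk⟩ hPs (hP k hkt)⟩
    rw [Finset.card_insert_of_notMem hks] at this
    omega

/-- Compactness of `closure V` leaves finitely many neighbourhoods, which are glued by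
`HasPoincare.union`; open sets that meet overlap in positive measure. The local hypothesis is needed
at boundary points of `V` as well. -/
lemma IsPreconnected.hasPoincare {V : Set F} (hV : IsPreconnected V) (hV0 : V.Nonempty)
    (hVo : IsOpen V) (hVb : Bornology.IsBounded V)
    (hloc : ∀ x, ∃ N, IsOpen N ∧ x ∈ N ∧ HasPoincare V (N ∩ V)) : HasPoincare V V := by
  choose N hNo hxN hN using hloc
  obtain ⟨t, -, ht⟩ := hVb.isCompact_closure.elim_nhds_subcover N fun x _ =>
    (hNo x).mem_nhds (hxN x)
  refine IsPreconnected.induction_on_finite_cover hV hV0 t (W := fun x => N x ∩ V)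
    (fun x _ => (hNo x).inter hVo) ?_ (fun x _ => hN x) ?_
  · rw [← iUnion₂_inter, inter_eq_right]
    exact subset_closure.trans ht
  · intro A B hA hB _ hBV hne hPA hPB
    exact hPA.union hPB ((hA.inter hB).measure_pos volume hne).ne'
      (hVb.subset hBV).measure_lt_top.ne

end Poincare

variable {n : ℕ} {Ys : Set (Space (n + 1))}

lemma hasPoincare_unitCell : HasPoincare (unitCell (n + 1)) (unitCell (n + 1)) :=
  exists_poincare_of_convex _ isOpen_unitCell.measurableSet convex_unitCell isBounded_unitCell

lemma IsSolidPart.frontier_subset (h : IsSolidPart Ys) : frontier Ys ⊆ unitCell (n + 1) :=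
  frontier_subset_closure.trans h.closure_subset

lemma IsSolidPart.isCompact_frontier (h : IsSolidPart Ys) : IsCompact (frontier Ys) :=
  Metric.isCompact_of_isClosed_isBounded isClosed_frontier
    (isBounded_unitCell.subset h.frontier_subset)

/-- The cylinder is kept inside the unit cell, so that its part outside `closure Ys` consists of
gas. -/
lemma IsSolidPart.exists_isGraphCylinder (h : IsSolidPart Ys) {p : Space (n + 1)}
    (hp : p ∈ frontier Ys) : ∃ i ρ k s K, IsGraphCylinder Ys i p ρ k s K ∧
      cylinder i p ρ k \ closure Ys = cylinder i p ρ k ∩ gasCell Ys := by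
  obtain ⟨i, ρ, k, s, K, hN, hsub⟩ := FiltrationCombustion.exists_isGraphCylinder h.isOpen h.smooth
    hp (isOpen_unitCell.mem_nhds (h.frontier_subset hp))
  refine ⟨i, ρ, k, s, K, hN, ?_⟩
  ext x
  exact ⟨fun hx => ⟨hx.1, hsub hx.1, hx.2⟩, fun hx => ⟨hx.1, hx.2.2⟩⟩

/-- The Poincaré inequality in the gas part of the cell. -/
theorem IsSolidPart.hasPoincare_gasCell (h : IsSolidPart Ys) :
    HasPoincare (gasCell Ys) (gasCell Ys) := by
  refine IsPreconnected.hasPoincare h.connected.isPreconnected h.connected.nonempty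
    (isOpen_gasCell Ys) (isBounded_unitCell.subset (gasCell_subset_unitCell Ys)) fun x => ?_
  by_cases hx : x ∈ closure Ys
  · by_cases hxY : x ∈ Ys
    · refine ⟨Ys, h.isOpen, hxY, 0, fun η _ => ⟨0, ?_⟩⟩
      have : Ys ∩ gasCell Ys = ∅ := by
        ext y; simp only [mem_inter_iff, mem_empty_iff_false, iff_false]
        exact fun hy => hy.2.2 (subset_closure hy.1)
      simp [this]
    · have hxf : x ∈ frontier Ys := by rw [h.isOpen.frontier_eq]; exact ⟨hx, hxY⟩
      obtain ⟨i, ρ, k, s, K, hN, heq⟩ := h.exists_isGraphCylinder hxf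
      refine ⟨cylinder i x ρ k, isOpen_cylinder i x ρ k, ⟨by simpa using hN.radius_pos,
        by simpa using hN.height_pos⟩, ?_⟩
      rw [← heq]
      refine HasPoincare.mono hN.exists_poincare ?_
      rw [heq]; exact inter_subset_right
  -- Away from the solid a ball meets the gas in its intersection with the cube, which is convex;
  -- this also covers the faces and corners of the cell.
  · obtain ⟨r, hr, hball⟩ := Metric.mem_nhds_iff.1 (isClosed_closure.isOpen_compl.mem_nhds hx)
    refine ⟨Metric.ball x r, Metric.isOpen_ball, Metric.mem_ball_self hr, ?_⟩
    have : Metric.ball x r ∩ gasCell Ys = Metric.ball x r ∩ unitCell (n + 1) := by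
      ext y
      exact ⟨fun hy => ⟨hy.1, hy.2.1⟩, fun hy => ⟨hy.1, hy.2, hball hy.1⟩⟩
    have hP : HasPoincare (Metric.ball x r ∩ gasCell Ys) (Metric.ball x r ∩ gasCell Ys) := by
      rw [this]
      exact exists_poincare_of_convex _
        (Metric.isOpen_ball.inter isOpen_unitCell).measurableSet
        ((convex_ball _ _).inter convex_unitCell) (Metric.isBounded_ball.subset inter_subset_left)
    exact hP.mono inter_subset_right

/-- The trace inequality on the interface. -/
theorem IsSolidPart.exists_trace (h : IsSolidPart Ys) :
    ∃ C : ℝ≥0, ∀ η : Space (n + 1) → ℝ, ContDiff ℝ 1 η →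
      ∫⁻ y, ‖η y‖ₑ ^ 2 ∂(surface Ys) ≤
        C * ∫⁻ y in gasCell Ys, (‖η y‖ₑ ^ 2 + ‖∇ η y‖ₑ ^ 2) := by
  -- Replacing the second copy of the frontier by an arbitrary set `A` gives a property that is
  -- monotone and stable under unions, so compactness reduces it to one cylinder.
  suffices H : ∃ C : ℝ≥0, ∀ η : Space (n + 1) → ℝ, ContDiff ℝ 1 η →
      ∫⁻ y in frontier Ys ∩ frontier Ys, ‖η y‖ₑ ^ 2 ∂(Measure.euclideanHausdorffMeasure n) ≤
        C * ∫⁻ y in gasCell Ys, (‖η y‖ₑ ^ 2 + ‖∇ η y‖ₑ ^ 2) by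
    rw [inter_self] at H
    exact H
  refine h.isCompact_frontier.induction_on (p := fun A => ∃ C : ℝ≥0,
    ∀ η : Space (n + 1) → ℝ, ContDiff ℝ 1 η →
      ∫⁻ y in frontier Ys ∩ A, ‖η y‖ₑ ^ 2 ∂(Measure.euclideanHausdorffMeasure n) ≤
        C * ∫⁻ y in gasCell Ys, (‖η y‖ₑ ^ 2 + ‖∇ η y‖ₑ ^ 2)) ⟨0, by simp⟩ ?_ ?_ ?_
  · rintro A B hAB ⟨C, hC⟩
    exact ⟨C, fun η hη => (lintegral_mono_set (inter_subset_inter_right _ hAB)).trans (hC η hη)⟩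
  · rintro A B ⟨C₁, hC₁⟩ ⟨C₂, hC₂⟩
    refine ⟨C₁ + C₂, fun η hη => ?_⟩
    rw [inter_union_distrib_left, ENNReal.coe_add, add_mul]
    exact (lintegral_union_le _ _ _).trans (add_le_add (hC₁ η hη) (hC₂ η hη))
  · intro p hp
    obtain ⟨i, ρ, k, s, K, hN, heq⟩ := h.exists_isGraphCylinder hp
    obtain ⟨C, hC⟩ := hN.exists_trace h.isOpen
    refine ⟨cylinder i p ρ k, mem_nhdsWithin_of_mem_nhds ((isOpen_cylinder i p ρ k).mem_nhds
      ⟨by simpa using hN.radius_pos, by simpa using hN.height_pos⟩), C, fun η hη => ?_⟩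
    refine (hC η hη).trans ?_
    gcongr
    rw [heq]; exact inter_subset_right

/-- Compactness again: in each graph cylinder the frontier is a Lipschitz image of a subset of an
`n`-ball. -/
lemma IsSolidPart.isFiniteMeasure_surface (h : IsSolidPart Ys) :
    IsFiniteMeasure (surface Ys) := by
  refine ⟨?_⟩
  rw [surface, Measure.restrict_apply_univ]
  suffices H : Measure.euclideanHausdorffMeasure n (frontier Ys ∩ frontier Ys) < ∞ by
    rw [inter_self] at H
    exact H
  refine h.isCompact_frontier.induction_on
    (p := fun A => Measure.euclideanHausdorffMeasure n (frontier Ys ∩ A) < ∞) (by simp) ?_ ?_ ?_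
  · intro A B hAB hB
    exact (measure_mono (inter_subset_inter_right _ hAB)).trans_lt hB
  · intro A B hA hB
    rw [inter_union_distrib_left]
    exact measure_union_lt_top hA hB
  · intro p hp
    obtain ⟨i, ρ, k, s, K, hN, -⟩ := h.exists_isGraphCylinder hp
    exact ⟨cylinder i p ρ k, mem_nhdsWithin_of_mem_nhds ((isOpen_cylinder i p ρ k).mem_nhds
      ⟨by simpa using hN.radius_pos, by simpa using hN.height_pos⟩),
      hN.euclideanHausdorffMeasure_frontier_lt_top⟩

/-- A set of finite `n`-dimensional Hausdorff measure is null in dimension `n + 1`. -/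
lemma IsSolidPart.volume_frontier (h : IsSolidPart Ys) : volume (frontier Ys) = 0 := by
  have hfin := h.isFiniteMeasure_surface.measure_univ_lt_top
  rw [surface, Measure.restrict_apply_univ] at hfin
  rw [← EuclideanSpace.euclideanHausdorffMeasure_eq_volume]
  exact (Measure.euclideanHausdorffMeasure_zero_or_top (Nat.lt_succ_self n) _).resolve_right
    hfin.ne

/-- Every vertical line through a small ball in `Ys` must leave the bounded set `Ys`, hence crosses
the frontier. The projection of the frontier therefore contains an `n`-ball, and projections do not
increase Hausdorff measure. -/
lemma IsSolidPart.surface_ne_zero (h : IsSolidPart Ys) : surface Ys univ ≠ 0 := by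
  rw [surface, Measure.restrict_apply_univ, Nat.add_sub_cancel]
  intro h0
  obtain ⟨x, hx⟩ := h.nonempty
  obtain ⟨r, hr, hball⟩ := Metric.mem_nhds_iff.1 (h.isOpen.mem_nhds hx)
  have hsub : Metric.ball (dropCoord 0 x) r ⊆ dropCoord 0 '' frontier Ys := by
    intro y hy
    have hyY : insertCoord 0 y (x 0) ∈ Ys := by
      apply hball
      rw [Metric.mem_ball, dist_eq_norm] at hy ⊢
      refine (norm_le_dropCoord 0 _).trans_lt ?_
      rw [dropCoord_sub]; simpa using hy
    have hline : Continuous fun t : ℝ => insertCoord 0 y t := by unfold insertCoord; fun_prop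
    obtain ⟨t, ht⟩ := (nonempty_frontier_iff (s := (fun t : ℝ => insertCoord 0 y t) ⁻¹' Ys)).2
      ⟨⟨x 0, hyY⟩, fun huniv => by
        -- A point whose coordinate equals 2 is outside the unit cell.
        have h2 : (2 : ℝ) ∈ (fun t : ℝ => insertCoord 0 y t) ⁻¹' Ys := huniv ▸ mem_univ _
        have := (h.closure_subset (subset_closure h2) 0).2
        norm_num at this⟩
    have hz := hline.frontier_preimage_subset _ ht
    exact ⟨_, hz, dropCoord_insertCoord 0 y t⟩
  have hlip : LipschitzWith 1 (dropCoord (0 : Fin (n + 1))) :=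
    LipschitzWith.of_dist_le_mul fun a b => by
      rw [dist_eq_norm, dist_eq_norm, ← dropCoord_sub, NNReal.coe_one, one_mul]
      exact norm_dropCoord_le 0 _
  have h1 := hlip.hausdorffMeasure_image_le (Nat.cast_nonneg n) (frontier Ys)
  have h2 : Measure.euclideanHausdorffMeasure n (dropCoord 0 '' frontier Ys) ≤
      Measure.euclideanHausdorffMeasure n (frontier Ys) := by
    rw [Measure.euclideanHausdorffMeasure_def, Measure.euclideanHausdorffMeasure_def,
      Measure.smul_apply, Measure.smul_apply]
    gcongr
    simpa using h1
  rw [h0, EuclideanSpace.euclideanHausdorffMeasure_eq_volume] at h2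
  exact (Metric.measure_ball_pos volume (dropCoord 0 x) hr).ne'
    (le_antisymm ((measure_mono hsub).trans h2) zero_le)

end FiltrationCombustion

end

/-! ### Abstract solvability of two forms coupled by a reaction on the trace space. -/

noncomputable section

namespace FiltrationCombustion

/-- The inner product of a real inner product space as a continuous bilinear form. -/
def innerBilin (H : Type*) [NormedAddCommGroup H] [InnerProductSpace ℝ H] : H →L[ℝ] H →L[ℝ] ℝ :=
  innerSL ℝ

@[simp] lemma innerBilin_apply {H : Type*} [NormedAddCommGroup H] [InnerProductSpace ℝ H]
    (x y : H) : innerBilin H x y = ⟪x, y⟫ := rfl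

section Coupled

variable {V₁ V₂ H : Type*} [NormedAddCommGroup V₁] [InnerProductSpace ℝ V₁]
  [NormedAddCommGroup V₂] [InnerProductSpace ℝ V₂]
  [NormedAddCommGroup H] [InnerProductSpace ℝ H]

/-- Two continuous bilinear forms with one-dimensional kernels (spanned by `e₁` and `e₂`) that will
be coupled by a rank-one reaction term living on the trace space `H`. -/
structure CoupledForms (a₁ : V₁ →L[ℝ] V₁ →L[ℝ] ℝ) (a₂ : V₂ →L[ℝ] V₂ →L[ℝ] ℝ) (m : V₁ →L[ℝ] ℝ)
    (T₁ : V₁ →L[ℝ] H) (T₂ : V₂ →L[ℝ] H) (e₁ : V₁) (e₂ : V₂) (c : ℝ) : Prop where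
  pos : 0 < c
  coercive₁ : ∀ u, c * ‖u‖ ^ 2 ≤ a₁ u u + m u ^ 2
  coercive₂ : ∀ w, c * ‖w‖ ^ 2 ≤ a₂ w w + ‖T₂ w‖ ^ 2
  nonneg₂ : ∀ w, 0 ≤ a₂ w w
  trace_eq : T₁ e₁ = T₂ e₂
  mean_ne : m e₁ ≠ 0
  left₁ : ∀ u, a₁ e₁ u = 0
  right₁ : ∀ u, a₁ u e₁ = 0
  left₂ : ∀ u, a₂ e₂ u = 0
  right₂ : ∀ u, a₂ u e₂ = 0

namespace CoupledForms

variable {a₁ : V₁ →L[ℝ] V₁ →L[ℝ] ℝ} {a₂ : V₂ →L[ℝ] V₂ →L[ℝ] ℝ} {m : V₁ →L[ℝ] ℝ}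
  {T₁ : V₁ →L[ℝ] H} {T₂ : V₂ →L[ℝ] H} {e₁ : V₁} {e₂ : V₂} {c : ℝ}

/-- A suitable positive combination of the two equations is coercive. -/
lemma exists_weight (h : CoupledForms a₁ a₂ m T₁ T₂ e₁ e₂ c) {Q A α β : ℝ} (hQ : 0 < Q)
    (hA : 0 < A) (hα : 0 ≤ α) (hβ : 0 < β) :
    ∃ s > 0, ∃ k > 0, ∀ u w, k * (‖u‖ ^ 2 + ‖w‖ ^ 2) ≤
      s * (a₁ u u + Q * A * ⟪α • T₁ u + β • T₂ w, T₁ u⟫ + m u ^ 2) +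
        (a₂ w w + A * ⟪α • T₁ u + β • T₂ w, T₂ w⟫) := by
  have hc := h.pos
  set M := ‖T₁‖
  have hM : 0 ≤ M := norm_nonneg _
  -- Small enough for the surplus reaction term, after Young's inequality, to cost at most half of
  -- the coercivity `δ * c * ‖u‖ ^ 2`. The summand 1 keeps the denominator positive when `M = 0`.
  set δ := c / (A * β * Q ^ 2 * M ^ 2 + 1) with hδ
  have hδ0 : 0 < δ := by positivity
  have hδ1 : A * β * Q ^ 2 * M ^ 2 * δ ≤ c := by
    rw [hδ, mul_div_assoc', div_le_iff₀ (by positivity)]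
    nlinarith
  -- The first summand makes the reaction terms combine to `A / β * ‖r‖ ^ 2`; `δ` secures a positive
  -- weight on the first form when `α = 0`.
  set s := α / (β * Q) + δ with hs
  have hs0 : 0 < s := by positivity
  -- `c₁` and `c₂` bound `‖u‖ ^ 2` and `‖r‖ ^ 2` by the combined form. The second summand of `C`
  -- bounds `‖w‖ ^ 2`, with `T₂ w` recovered from `r` and `T₁ u`.
  set c₁ := 2 / (δ * c)
  set c₂ := 2 * β / A
  set C := c₁ + (1 + 2 / β ^ 2 * c₂ + 2 * α ^ 2 * M ^ 2 / β ^ 2 * c₁) / c with hC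
  have hC0 : 0 < C := by positivity
  refine ⟨s, hs0, 1 / C, by positivity, fun u w => ?_⟩
  set r := α • T₁ u + β • T₂ w with hr
  set Z := s * (a₁ u u + Q * A * ⟪r, T₁ u⟫ + m u ^ 2) + (a₂ w w + A * ⟪r, T₂ w⟫) with hZ
  have hTu : ‖T₁ u‖ ^ 2 ≤ M ^ 2 * ‖u‖ ^ 2 := by
    rw [← mul_pow]; gcongr; exact T₁.le_opNorm u
  have hcross : s * (Q * A * ⟪r, T₁ u⟫) + A * ⟪r, T₂ w⟫ =
      A / β * ‖r‖ ^ 2 + A * δ * Q * ⟪r, T₁ u⟫ := by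
    have : ‖r‖ ^ 2 = α * ⟪r, T₁ u⟫ + β * ⟪r, T₂ w⟫ := by
      rw [← real_inner_self_eq_norm_sq, ← real_inner_smul_right, ← real_inner_smul_right,
        ← inner_add_right]
    rw [this, hs]; field_simp; ring
  have hri : A * δ * Q * ⟪r, T₁ u⟫ ≥
      -(A / (2 * β) * ‖r‖ ^ 2 + A * β * δ ^ 2 * Q ^ 2 / 2 * ‖T₁ u‖ ^ 2) := by
    have h0 := neg_le_of_abs_le (abs_real_inner_le_norm r (T₁ u))
    have h1 : A * δ * Q * ⟪r, T₁ u⟫ ≥ A * δ * Q * -(‖r‖ * ‖T₁ u‖) := by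
      gcongr
    have h2 : A / (2 * β) * ‖r‖ ^ 2 + A * β * δ ^ 2 * Q ^ 2 / 2 * ‖T₁ u‖ ^ 2 -
        A * δ * Q * (‖r‖ * ‖T₁ u‖) = A / (2 * β) * (‖r‖ - β * δ * Q * ‖T₁ u‖) ^ 2 := by
      field_simp; ring
    have h3 : 0 ≤ A / (2 * β) * (‖r‖ - β * δ * Q * ‖T₁ u‖) ^ 2 := by positivity
    linarith
  have hlow : δ * c / 2 * ‖u‖ ^ 2 + a₂ w w + A / (2 * β) * ‖r‖ ^ 2 ≤ Z := by
    have h1 : s * (c * ‖u‖ ^ 2) ≤ s * (a₁ u u + m u ^ 2) := by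
      gcongr; exact h.coercive₁ u
    have h2 : δ * (c * ‖u‖ ^ 2) ≤ s * (c * ‖u‖ ^ 2) := by
      gcongr; rw [hs]; linarith [show 0 ≤ α / (β * Q) by positivity]
    have h3 : A * β * δ ^ 2 * Q ^ 2 / 2 * ‖T₁ u‖ ^ 2 ≤ δ * c / 2 * ‖u‖ ^ 2 := by
      calc A * β * δ ^ 2 * Q ^ 2 / 2 * ‖T₁ u‖ ^ 2
          ≤ A * β * δ ^ 2 * Q ^ 2 / 2 * (M ^ 2 * ‖u‖ ^ 2) := by gcongr
        _ = (A * β * Q ^ 2 * M ^ 2 * δ) * (δ / 2 * ‖u‖ ^ 2) := by ring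
        _ ≤ c * (δ / 2 * ‖u‖ ^ 2) := by gcongr
        _ = _ := by ring
    have h4 : A / β * ‖r‖ ^ 2 = A / (2 * β) * ‖r‖ ^ 2 + A / (2 * β) * ‖r‖ ^ 2 := by
      field_simp; norm_num
    have h5 : Z = s * (a₁ u u + m u ^ 2) + a₂ w w +
        (s * (Q * A * ⟪r, T₁ u⟫) + A * ⟪r, T₂ w⟫) := by rw [hZ]; ring
    rw [h5, hcross]
    linarith
  have hnn := h.nonneg₂ w
  have hu0 : 0 ≤ δ * c / 2 * ‖u‖ ^ 2 := by positivity
  have hr0 : 0 ≤ A / (2 * β) * ‖r‖ ^ 2 := by positivity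
  have hu : ‖u‖ ^ 2 ≤ c₁ * Z := by
    have : ‖u‖ ^ 2 = c₁ * (δ * c / 2 * ‖u‖ ^ 2) := by simp only [c₁]; field_simp
    rw [this]
    have : 0 ≤ c₁ := by positivity
    gcongr; linarith
  have hrZ : ‖r‖ ^ 2 ≤ c₂ * Z := by
    have : ‖r‖ ^ 2 = c₂ * (A / (2 * β) * ‖r‖ ^ 2) := by simp only [c₂]; field_simp
    rw [this]
    have : 0 ≤ c₂ := by positivity
    gcongr; linarith
  have hT2 : ‖T₂ w‖ ^ 2 ≤ 2 / β ^ 2 * ‖r‖ ^ 2 + 2 * α ^ 2 * M ^ 2 / β ^ 2 * ‖u‖ ^ 2 := by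
    have h1 : β * ‖T₂ w‖ ≤ ‖r‖ + α * ‖T₁ u‖ := by
      have : β • T₂ w = r - α • T₁ u := by rw [hr]; abel
      calc β * ‖T₂ w‖ = ‖β • T₂ w‖ := by rw [norm_smul, Real.norm_of_nonneg hβ.le]
        _ ≤ ‖r‖ + ‖α • T₁ u‖ := by rw [this]; exact norm_sub_le _ _
        _ = _ := by rw [norm_smul, Real.norm_of_nonneg hα]
    have h2 : (β * ‖T₂ w‖) ^ 2 ≤ 2 * ‖r‖ ^ 2 + 2 * α ^ 2 * (M ^ 2 * ‖u‖ ^ 2) := by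
      calc (β * ‖T₂ w‖) ^ 2 ≤ (‖r‖ + α * ‖T₁ u‖) ^ 2 := by gcongr
        _ ≤ 2 * ‖r‖ ^ 2 + 2 * α ^ 2 * ‖T₁ u‖ ^ 2 := by
          nlinarith [sq_nonneg (‖r‖ - α * ‖T₁ u‖)]
        _ ≤ _ := by gcongr
    have h3 : 2 / β ^ 2 * ‖r‖ ^ 2 + 2 * α ^ 2 * M ^ 2 / β ^ 2 * ‖u‖ ^ 2 =
        (2 * ‖r‖ ^ 2 + 2 * α ^ 2 * (M ^ 2 * ‖u‖ ^ 2)) / β ^ 2 := by field_simp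
    rw [h3, le_div_iff₀ (by positivity)]
    linarith [mul_pow β ‖T₂ w‖ 2]
  have hw : ‖w‖ ^ 2 ≤ (1 + 2 / β ^ 2 * c₂ + 2 * α ^ 2 * M ^ 2 / β ^ 2 * c₁) / c * Z := by
    rw [div_mul_eq_mul_div, le_div_iff₀ hc]
    have h1 := h.coercive₂ w
    have h2 : 2 / β ^ 2 * ‖r‖ ^ 2 ≤ 2 / β ^ 2 * (c₂ * Z) := by gcongr
    have h3 : 2 * α ^ 2 * M ^ 2 / β ^ 2 * ‖u‖ ^ 2 ≤ 2 * α ^ 2 * M ^ 2 / β ^ 2 * (c₁ * Z) := by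
      gcongr
    have h4 : a₂ w w ≤ Z := by linarith
    linarith
  rw [one_div, inv_mul_le_iff₀ hC0, hC, add_mul]
  linarith

/-- Existence for the coupled problem under the compatibility conditions. -/
theorem exists_solution [CompleteSpace V₁] [CompleteSpace V₂]
    (h : CoupledForms a₁ a₂ m T₁ T₂ e₁ e₂ c) {Q A α β : ℝ} (hQ : 0 < Q)
    (hA : 0 < A) (hα : 0 ≤ α) (hβ : 0 < β) {ℓ₁ : V₁ →L[ℝ] ℝ} {ℓ₂ : V₂ →L[ℝ] ℝ}
    (hℓ₁ : ℓ₁ e₁ = 0) (hℓ₂ : ℓ₂ e₂ = 0) :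
    ∃ u w, (∀ φ, a₁ u φ + Q * A * ⟪α • T₁ u + β • T₂ w, T₁ φ⟫ = ℓ₁ φ) ∧
      ∀ ψ, a₂ w ψ + A * ⟪α • T₁ u + β • T₂ w, T₂ ψ⟫ = ℓ₂ ψ := by
  obtain ⟨s, hs, k, hk, hcoer⟩ := h.exists_weight hQ hA hα hβ
  let p₁ := WithLp.fstL 2 ℝ V₁ V₂
  let p₂ := WithLp.sndL 2 ℝ V₁ V₂
  let r : WithLp 2 (V₁ × V₂) →L[ℝ] H := α • (T₁ ∘L p₁) + β • (T₂ ∘L p₂)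
  -- The rank-one term in `m` removes the kernel. The weight `s` multiplies the whole first
  -- equation, on both sides, so the two equations separate again by testing with one component at a
  -- time.
  let B : WithLp 2 (V₁ × V₂) →L[ℝ] WithLp 2 (V₁ × V₂) →L[ℝ] ℝ :=
    s • (a₁.bilinearComp p₁ p₁ + (Q * A) • (innerBilin H).bilinearComp r (T₁ ∘L p₁) +
      (ContinuousLinearMap.mul ℝ ℝ).bilinearComp (m ∘L p₁) (m ∘L p₁)) +
    (a₂.bilinearComp p₂ p₂ + A • (innerBilin H).bilinearComp r (T₂ ∘L p₂))
  have hB : ∀ z y, B z y = s * (a₁ z.fst y.fst +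
      Q * A * ⟪α • T₁ z.fst + β • T₂ z.snd, T₁ y.fst⟫ + m z.fst * m y.fst) +
      (a₂ z.snd y.snd + A * ⟪α • T₁ z.fst + β • T₂ z.snd, T₂ y.snd⟫) := fun z y => by
    simp [B, r, p₁, p₂, mul_add, inner_add_left, real_inner_smul_left]
  have hBc : IsCoercive B := by
    refine ⟨k, hk, fun z => ?_⟩
    rw [hB, mul_assoc, ← sq, WithLp.prod_norm_sq_eq_of_L2, ← sq (m z.fst)]
    exact hcoer _ _
  let L : WithLp 2 (V₁ × V₂) →L[ℝ] ℝ := s • (ℓ₁ ∘L p₁) + ℓ₂ ∘L p₂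
  let z := hBc.continuousLinearEquivOfBilin.symm ((InnerProductSpace.toDual ℝ _).symm L)
  have hz : ∀ y, B z y = L y := fun y => by
    rw [← hBc.continuousLinearEquivOfBilin_apply]
    simp [z]
  have hz₂ : ∀ ψ, a₂ z.snd ψ + A * ⟪α • T₁ z.fst + β • T₂ z.snd, T₂ ψ⟫ = ℓ₂ ψ := fun ψ => by
    have := hz (WithLp.toLp 2 (0, ψ))
    rw [hB] at this
    simpa [L, p₁, p₂] using this
  have hz₁ : ∀ φ, a₁ z.fst φ + Q * A * ⟪α • T₁ z.fst + β • T₂ z.snd, T₁ φ⟫ +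
      m z.fst * m φ = ℓ₁ φ := fun φ => by
    have := hz (WithLp.toLp 2 (φ, 0))
    rw [hB] at this
    simpa [L, p₁, p₂, hs.ne', ← mul_add] using this
  -- Testing with `e₂` shows that the reaction is orthogonal to `T₂ e₂ = T₁ e₁`; testing with `e₁`
  -- then leaves only `m z.fst * m e₁ = 0`.
  have hmean : m z.fst = 0 := by
    have h1 := hz₁ e₁
    have h2 := hz₂ e₂
    rw [hℓ₂, h.right₂, zero_add, mul_eq_zero, or_iff_right hA.ne'] at h2
    rw [hℓ₁, h.right₁, h.trace_eq, h2, mul_zero, zero_add, zero_add, mul_eq_zero] at h1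
    exact h1.resolve_right h.mean_ne
  exact ⟨z.fst, z.snd, fun φ => by simpa [hmean] using hz₁ φ, hz₂⟩

/-- Solutions of the homogeneous coupled problem lie in an explicit line. -/
theorem eq_of_homogeneous (h : CoupledForms a₁ a₂ m T₁ T₂ e₁ e₂ c) {Q A α β : ℝ} (hQ : 0 < Q)
    (hA : 0 < A) (hα : 0 ≤ α) (hβ : 0 < β) {u : V₁} {w : V₂}
    (h₁ : ∀ φ, a₁ u φ + Q * A * ⟪α • T₁ u + β • T₂ w, T₁ φ⟫ = 0)
    (h₂ : ∀ ψ, a₂ w ψ + A * ⟪α • T₁ u + β • T₂ w, T₂ ψ⟫ = 0) :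
    ∃ κ : ℝ, u = (κ * β) • e₁ ∧ w = -(κ * α) • e₂ := by
  obtain ⟨s, hs, k, hk, hcoer⟩ := h.exists_weight hQ hA hα hβ
  -- This multiple of the kernel element makes `m u' = 0`. The shift leaves the reaction unchanged
  -- because `T₁ e₁ = T₂ e₂`.
  set κ := m u / (m e₁ * β)
  set u' := u - (κ * β) • e₁
  set w' := w + (κ * α) • e₂
  have hr : α • T₁ u' + β • T₂ w' = α • T₁ u + β • T₂ w := by
    simp only [u', w', map_sub, map_add, map_smul, h.trace_eq]
    module
  have hm : m u' = 0 := by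
    have := h.mean_ne
    simp only [u', κ, map_sub, map_smul, smul_eq_mul]
    field_simp; simp
  have h₁' : a₁ u' u' + Q * A * ⟪α • T₁ u' + β • T₂ w', T₁ u'⟫ = 0 := by
    rw [hr, ← h₁ u']
    simp [u', h.left₁]
  have h₂' : a₂ w' w' + A * ⟪α • T₁ u' + β • T₂ w', T₂ w'⟫ = 0 := by
    rw [hr, ← h₂ w']
    simp [w', h.left₂]
  have h0 := hcoer u' w'
  rw [h₁', h₂', hm] at h0
  have hsum : ‖u'‖ ^ 2 + ‖w'‖ ^ 2 ≤ 0 := by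
    by_contra! hpos
    nlinarith [mul_pos hk hpos]
  have hu : u' = 0 := norm_eq_zero.1 (by nlinarith [sq_nonneg ‖w'‖, norm_nonneg u'])
  have hw : w' = 0 := norm_eq_zero.1 (by nlinarith [sq_nonneg ‖u'‖, norm_nonneg w'])
  refine ⟨κ, sub_eq_zero.1 hu, ?_⟩
  rw [neg_smul]; exact eq_neg_of_add_eq_zero_left hw

/-- Two solutions with the same right-hand side differ by an element of the kernel. -/
theorem sub_eq_of_solutions (h : CoupledForms a₁ a₂ m T₁ T₂ e₁ e₂ c) {Q A α β : ℝ} (hQ : 0 < Q)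
    (hA : 0 < A) (hα : 0 ≤ α) (hβ : 0 < β) {ℓ₁ : V₁ →L[ℝ] ℝ} {ℓ₂ : V₂ →L[ℝ] ℝ} {u u' : V₁}
    {w w' : V₂} (h₁ : ∀ φ, a₁ u φ + Q * A * ⟪α • T₁ u + β • T₂ w, T₁ φ⟫ = ℓ₁ φ)
    (h₂ : ∀ ψ, a₂ w ψ + A * ⟪α • T₁ u + β • T₂ w, T₂ ψ⟫ = ℓ₂ ψ)
    (h₁' : ∀ φ, a₁ u' φ + Q * A * ⟪α • T₁ u' + β • T₂ w', T₁ φ⟫ = ℓ₁ φ)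
    (h₂' : ∀ ψ, a₂ w' ψ + A * ⟪α • T₁ u' + β • T₂ w', T₂ ψ⟫ = ℓ₂ ψ) :
    ∃ κ : ℝ, u' - u = (κ * β) • e₁ ∧ w' - w = -(κ * α) • e₂ := by
  refine h.eq_of_homogeneous hQ hA hα hβ (fun φ => ?_) fun ψ => ?_
  · have := h₁ φ
    have := h₁' φ
    simp only [map_sub, sub_apply, smul_sub, inner_add_left, inner_sub_left] at *
    linarith
  · have := h₂ ψ
    have := h₂' ψ
    simp only [map_sub, sub_apply, smul_sub, inner_add_left, inner_sub_left] at *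
    linarith

end CoupledForms

end Coupled

end FiltrationCombustion

end

/-! ### Sobolev spaces as closures of smooth periodic triples. -/

noncomputable section

namespace FiltrationCombustion

section LpTools

variable {α E : Type*} [MeasurableSpace α] [NormedAddCommGroup E] [InnerProductSpace ℝ E]
  {μ ν : Measure α}

lemma inner_Lp_eq_integral {f g : Lp E 2 μ} {F G : α → E} (hf : f =ᵐ[μ] F) (hg : g =ᵐ[μ] G) :
    ⟪f, g⟫ = ∫ x, ⟪F x, G x⟫ ∂μ := by
  rw [L2.inner_def]
  refine integral_congr_ae ?_
  filter_upwards [hf, hg] with x h1 h2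
  rw [h1, h2]

lemma enorm_Lp_sq {E : Type*} [NormedAddCommGroup E] {f : Lp E 2 μ} {F : α → E} (hf : f =ᵐ[μ] F) :
    ‖f‖ₑ ^ 2 = ∫⁻ x, ‖F x‖ₑ ^ 2 ∂μ := by
  rw [Lp.enorm_def, eLpNorm_congr_ae hf]
  have := eLpNorm_nnreal_pow_eq_lintegral (f := F) (μ := μ) (p := 2) (by norm_num)
  simpa using this

/-- The inclusion of `L²(μ)` in `L²(ν)` for `ν ≤ μ`. -/
def LpRestrict (E : Type*) [NormedAddCommGroup E] [InnerProductSpace ℝ E] {μ ν : Measure α}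
    (h : ν ≤ μ) : Lp E 2 μ →L[ℝ] Lp E 2 ν :=
  LinearMap.mkContinuous
    { toFun := fun f => ((Lp.memLp f).mono_measure h).toLp f
      map_add' := fun f g => by
        ext1
        filter_upwards [MemLp.coeFn_toLp ((Lp.memLp (f + g)).mono_measure h),
          MemLp.coeFn_toLp ((Lp.memLp f).mono_measure h),
          MemLp.coeFn_toLp ((Lp.memLp g).mono_measure h),
          Lp.coeFn_add (((Lp.memLp f).mono_measure h).toLp f)
            (((Lp.memLp g).mono_measure h).toLp g),
          h.absolutelyContinuous.ae_le (Lp.coeFn_add f g)] with x h1 h2 h3 h4 h5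
        rw [h1, h4, h5, Pi.add_apply, Pi.add_apply, h2, h3]
      map_smul' := fun c f => by
        ext1
        filter_upwards [MemLp.coeFn_toLp ((Lp.memLp (c • f)).mono_measure h),
          MemLp.coeFn_toLp ((Lp.memLp f).mono_measure h),
          Lp.coeFn_smul c (((Lp.memLp f).mono_measure h).toLp f),
          h.absolutelyContinuous.ae_le (Lp.coeFn_smul c f)] with x h1 h2 h4 h5
        rw [RingHom.id_apply, h1, h4, h5, Pi.smul_apply, Pi.smul_apply, h2] }
    1 fun f => by
      rw [one_mul]
      change ‖((Lp.memLp f).mono_measure h).toLp f‖ ≤ ‖f‖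
      rw [Lp.norm_toLp, Lp.norm_def]
      exact ENNReal.toReal_mono (Lp.eLpNorm_ne_top f) (eLpNorm_mono_measure _ h)

lemma coeFn_LpRestrict (h : ν ≤ μ) (f : Lp E 2 μ) : LpRestrict E h f =ᵐ[ν] f :=
  MemLp.coeFn_toLp ((Lp.memLp f).mono_measure h)

lemma LpRestrict_ae_eq (h : ν ≤ μ) {f : Lp E 2 μ} {F : α → E} (hf : f =ᵐ[μ] F) :
    LpRestrict E h f =ᵐ[ν] F :=
  (coeFn_LpRestrict h f).trans (h.absolutelyContinuous.ae_le hf)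

end LpTools

variable {d : ℕ}

/-- Smooth periodic functions. -/
def IsSmoothPeriodic (η : Space d → ℝ) : Prop := ContDiff ℝ (⊤ : ℕ∞) η ∧ IsCellPeriodic η

namespace IsSmoothPeriodic

variable {η θ : Space d → ℝ}

lemma contDiff_one (h : IsSmoothPeriodic η) : ContDiff ℝ 1 η := h.1.of_le (by simp)

lemma differentiable (h : IsSmoothPeriodic η) : Differentiable ℝ η :=
  h.contDiff_one.differentiable one_ne_zero

lemma continuous_grad (h : IsSmoothPeriodic η) : Continuous (∇ η) :=
  continuous_gradient h.contDiff_one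

protected lemma const (a : ℝ) : IsSmoothPeriodic fun _ : Space d => a :=
  ⟨contDiff_const, fun _ _ => rfl⟩

protected lemma add (h : IsSmoothPeriodic η) (h' : IsSmoothPeriodic θ) :
    IsSmoothPeriodic (η + θ) := ⟨h.1.add h'.1, fun i => (h.2 i).add (h'.2 i)⟩

protected lemma mul (h : IsSmoothPeriodic η) (h' : IsSmoothPeriodic θ) :
    IsSmoothPeriodic (η * θ) := ⟨h.1.mul h'.1, fun i => (h.2 i).mul (h'.2 i)⟩

protected lemma const_smul (c : ℝ) (h : IsSmoothPeriodic η) : IsSmoothPeriodic (c • η) :=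
  ⟨h.1.const_smul c, fun i => (h.2 i).smul c⟩

end IsSmoothPeriodic

lemma gradient_add_apply {η θ : Space d → ℝ} {x : Space d} (h : DifferentiableAt ℝ η x)
    (h' : DifferentiableAt ℝ θ x) : ∇ (η + θ) x = ∇ η x + ∇ θ x := by
  simp [gradient, fderiv_add h h']

lemma gradient_const_smul_apply {η : Space d → ℝ} {x : Space d} (c : ℝ)
    (h : DifferentiableAt ℝ η x) : ∇ (c • η) x = c • ∇ η x := by
  simp [gradient, fderiv_const_smul h]

lemma gradient_mul_apply {η θ : Space d → ℝ} {x : Space d} (h : DifferentiableAt ℝ η x)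
    (h' : DifferentiableAt ℝ θ x) : ∇ (η * θ) x = η x • ∇ θ x + θ x • ∇ η x := by
  simp [gradient, fderiv_mul h h']

lemma Continuous.memLp_of_cell {E : Type*} [NormedAddCommGroup E]
    {μ : Measure (Space d)} [IsFiniteMeasure μ] (hμ : ∀ᵐ x ∂μ, x ∈ unitCell d) {f : Space d → E}
    (hf : Continuous f) (p : ℝ≥0∞) : MemLp f p μ := by
  obtain ⟨C, hC⟩ := isBounded_unitCell.isCompact_closure.exists_bound_of_continuousOn
    (hf.continuousOn (s := closure (unitCell d)))
  exact MemLp.of_bound hf.aestronglyMeasurable C (hμ.mono fun x hx => hC x (subset_closure hx))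

/-- Triples of a function, a gradient and a trace, square integrable. -/
abbrev Triple (μ σ : Measure (Space d)) : Type :=
  WithLp 2 (Lp ℝ 2 μ × WithLp 2 (Lp (Space d) 2 μ × Lp ℝ 2 σ))

section Sobolev

variable (μ σ : Measure (Space d))

/-- The value component. -/
def valL : Triple μ σ →L[ℝ] Lp ℝ 2 μ := WithLp.fstL 2 ℝ _ _

/-- The gradient component. -/
def gradL : Triple μ σ →L[ℝ] Lp (Space d) 2 μ := WithLp.fstL 2 ℝ _ _ ∘L WithLp.sndL 2 ℝ _ _

/-- The trace component. -/
def traceL : Triple μ σ →L[ℝ] Lp ℝ 2 σ := WithLp.sndL 2 ℝ _ _ ∘L WithLp.sndL 2 ℝ _ _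

variable {μ σ}

/-- The triple `z` is represented by the functions `u`, `Du`, `τ`. -/
structure Represents (z : Triple μ σ) (u : Space d → ℝ) (Du : Space d → Space d)
    (τ : Space d → ℝ) : Prop where
  val : valL μ σ z =ᵐ[μ] u
  grad : gradL μ σ z =ᵐ[μ] Du
  trace : traceL μ σ z =ᵐ[σ] τ

lemma Triple.norm_sq_eq (z : Triple μ σ) :
    ‖z‖ ^ 2 = ‖valL μ σ z‖ ^ 2 + (‖gradL μ σ z‖ ^ 2 + ‖traceL μ σ z‖ ^ 2) := by
  rw [WithLp.prod_norm_sq_eq_of_L2, WithLp.prod_norm_sq_eq_of_L2]; rfl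

/-- The triple of given square integrable functions. -/
def Triple.mk {u : Space d → ℝ} {Du : Space d → Space d} {τ : Space d → ℝ} (hu : MemLp u 2 μ)
    (hDu : MemLp Du 2 μ) (hτ : MemLp τ 2 σ) : Triple μ σ :=
  WithLp.toLp 2 (hu.toLp u, WithLp.toLp 2 (hDu.toLp Du, hτ.toLp τ))

lemma Triple.represents_mk {u : Space d → ℝ} {Du : Space d → Space d} {τ : Space d → ℝ}
    (hu : MemLp u 2 μ) (hDu : MemLp Du 2 μ) (hτ : MemLp τ 2 σ) :
    Represents (Triple.mk hu hDu hτ) u Du τ :=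
  ⟨hu.coeFn_toLp, hDu.coeFn_toLp, hτ.coeFn_toLp⟩

namespace Represents

variable {z z' : Triple μ σ} {u u' τ τ' : Space d → ℝ} {Du Du' : Space d → Space d}

lemma add (h : Represents z u Du τ) (h' : Represents z' u' Du' τ') :
    Represents (z + z') (u + u') (Du + Du') (τ + τ') where
  val := by rw [map_add]; exact (Lp.coeFn_add _ _).trans (h.val.add h'.val)
  grad := by rw [map_add]; exact (Lp.coeFn_add _ _).trans (h.grad.add h'.grad)
  trace := by rw [map_add]; exact (Lp.coeFn_add _ _).trans (h.trace.add h'.trace)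

lemma const_smul (c : ℝ) (h : Represents z u Du τ) :
    Represents (c • z) (c • u) (c • Du) (c • τ) where
  val := by rw [map_smul]; exact (Lp.coeFn_smul _ _).trans (h.val.const_smul c)
  grad := by rw [map_smul]; exact (Lp.coeFn_smul _ _).trans (h.grad.const_smul c)
  trace := by rw [map_smul]; exact (Lp.coeFn_smul _ _).trans (h.trace.const_smul c)

lemma memLp_val (h : Represents z u Du τ) : MemLp u 2 μ := (memLp_congr_ae h.val).1 (Lp.memLp _)

lemma memLp_grad (h : Represents z u Du τ) : MemLp Du 2 μ :=
  (memLp_congr_ae h.grad).1 (Lp.memLp _)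

lemma memLp_trace (h : Represents z u Du τ) : MemLp τ 2 σ :=
  (memLp_congr_ae h.trace).1 (Lp.memLp _)

lemma congr (h : Represents z u Du τ) (h₁ : u =ᵐ[μ] u') (h₂ : Du =ᵐ[μ] Du') (h₃ : τ =ᵐ[σ] τ') :
    Represents z u' Du' τ' := ⟨h.val.trans h₁, h.grad.trans h₂, h.trace.trans h₃⟩

lemma eLpNorm_sub (h : Represents z u Du τ) (h' : Represents z' u' Du' τ') :
    eLpNorm (u - u') 2 μ = ‖valL μ σ (z - z')‖ₑ ∧
    eLpNorm (Du - Du') 2 μ = ‖gradL μ σ (z - z')‖ₑ ∧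
    eLpNorm (τ - τ') 2 σ = ‖traceL μ σ (z - z')‖ₑ := by
  refine ⟨?_, ?_, ?_⟩
  · rw [map_sub, Lp.enorm_def]
    exact eLpNorm_congr_ae ((Lp.coeFn_sub _ _).trans (h.val.sub h'.val)).symm
  · rw [map_sub, Lp.enorm_def]
    exact eLpNorm_congr_ae ((Lp.coeFn_sub _ _).trans (h.grad.sub h'.grad)).symm
  · rw [map_sub, Lp.enorm_def]
    exact eLpNorm_congr_ae ((Lp.coeFn_sub _ _).trans (h.trace.sub h'.trace)).symm

end Represents

variable (μ σ)

/-- The triples `(η, ∇η, η)` of smooth periodic functions. -/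
def smoothTriples : Submodule ℝ (Triple μ σ) where
  carrier := {z | ∃ η, IsSmoothPeriodic η ∧ Represents z η (∇ η) η}
  add_mem' := by
    rintro z z' ⟨η, hη, hz⟩ ⟨θ, hθ, hz'⟩
    refine ⟨η + θ, hη.add hθ, (hz.add hz').congr .rfl (.of_forall fun x => ?_) .rfl⟩
    exact (gradient_add_apply (hη.differentiable x) (hθ.differentiable x)).symm
  zero_mem' := by
    refine ⟨0, .const 0, ⟨?_, ?_, ?_⟩⟩
    · rw [map_zero]; exact Lp.coeFn_zero _ _ _
    · rw [map_zero]
      refine (Lp.coeFn_zero _ _ _).trans (.of_forall fun x => ?_)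
      exact (gradient_fun_const x (0 : ℝ)).symm
    · rw [map_zero]; exact Lp.coeFn_zero _ _ _
  smul_mem' := by
    rintro c z ⟨η, hη, hz⟩
    refine ⟨c • η, hη.const_smul c, (hz.const_smul c).congr .rfl (.of_forall fun x => ?_) .rfl⟩
    exact (gradient_const_smul_apply c (hη.differentiable x)).symm

/-- The periodic Sobolev space with traces: the closure of the smooth periodic functions. -/
def sobolev : Submodule ℝ (Triple μ σ) := (smoothTriples μ σ).topologicalClosure

instance : CompleteSpace (sobolev μ σ) :=
  (Submodule.isClosed_topologicalClosure _).completeSpace_coe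

variable {μ σ}

lemma smoothTriples_le_sobolev : smoothTriples μ σ ≤ sobolev μ σ :=
  Submodule.le_topologicalClosure _

/-- Closed inequalities extend from smooth functions to the Sobolev space. -/
lemma sobolev_le_of_smooth {f g : Triple μ σ → ℝ} (hf : Continuous f) (hg : Continuous g)
    (h : ∀ z η, IsSmoothPeriodic η → Represents z η (∇ η) η → f z ≤ g z) {z : Triple μ σ}
    (hz : z ∈ sobolev μ σ) : f z ≤ g z := by
  have : closure (smoothTriples μ σ : Set (Triple μ σ)) ⊆ {z | f z ≤ g z} :=
    closure_minimal (fun z ⟨η, hη, hr⟩ => h z η hη hr) (isClosed_le hf hg)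
  exact this hz

lemma sobolev_eq_of_smooth {f g : Triple μ σ → ℝ} (hf : Continuous f) (hg : Continuous g)
    (h : ∀ z η, IsSmoothPeriodic η → Represents z η (∇ η) η → f z = g z) {z : Triple μ σ}
    (hz : z ∈ sobolev μ σ) : f z = g z :=
  le_antisymm (sobolev_le_of_smooth hf hg (fun z η hη hr => (h z η hη hr).le) hz)
    (sobolev_le_of_smooth hg hf (fun z η hη hr => (h z η hη hr).ge) hz)

variable [IsFiniteMeasure μ] [IsFiniteMeasure σ]

/-- The triple of a smooth periodic function. -/
lemma IsSmoothPeriodic.exists_represents (hμ : ∀ᵐ x ∂μ, x ∈ unitCell d)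
    (hσ : ∀ᵐ x ∂σ, x ∈ unitCell d) {η : Space d → ℝ} (hη : IsSmoothPeriodic η) :
    ∃ z : Triple μ σ, Represents z η (∇ η) η :=
  ⟨_, Triple.represents_mk (Continuous.memLp_of_cell hμ hη.1.continuous 2)
    (Continuous.memLp_of_cell hμ hη.continuous_grad 2)
    (Continuous.memLp_of_cell hσ hη.1.continuous 2)⟩

/-- Membership in the Sobolev space means approximability by smooth periodic functions. -/
lemma Represents.mem_sobolev_iff (hμ : ∀ᵐ x ∂μ, x ∈ unitCell d)
    (hσ : ∀ᵐ x ∂σ, x ∈ unitCell d) {z : Triple μ σ} {u τ : Space d → ℝ} {Du : Space d → Space d}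
    (hz : Represents z u Du τ) :
    z ∈ sobolev μ σ ↔ ∃ η : ℕ → Space d → ℝ,
      (∀ n, ContDiff ℝ (⊤ : ℕ∞) (η n) ∧ IsCellPeriodic (η n)) ∧
      Tendsto (fun n => eLpNorm (η n - u) 2 μ) atTop (𝓝 0) ∧
      Tendsto (fun n => eLpNorm (∇ (η n) - Du) 2 μ) atTop (𝓝 0) ∧
      Tendsto (fun n => eLpNorm (η n - τ) 2 σ) atTop (𝓝 0) := by
  constructor
  · intro h
    obtain ⟨y, hy, hlim⟩ := mem_closure_iff_seq_limit.1 h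
    choose η hη hr using hy
    have h0 : Tendsto (fun n => y n - z) atTop (𝓝 0) := by
      simpa using hlim.sub_const z
    refine ⟨η, hη, ?_, ?_, ?_⟩
    · simp_rw [fun n => ((hr n).eLpNorm_sub hz).1]
      simpa [Function.comp_def] using ((valL μ σ).continuous.enorm.tendsto 0).comp h0
    · simp_rw [fun n => ((hr n).eLpNorm_sub hz).2.1]
      simpa [Function.comp_def] using ((gradL μ σ).continuous.enorm.tendsto 0).comp h0
    · simp_rw [fun n => ((hr n).eLpNorm_sub hz).2.2]
      simpa [Function.comp_def] using ((traceL μ σ).continuous.enorm.tendsto 0).comp h0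
  · rintro ⟨η, hη, h1, h2, h3⟩
    choose y hy using fun n => IsSmoothPeriodic.exists_represents hμ hσ (hη n)
    refine mem_closure_iff_seq_limit.2 ⟨y, fun n => ⟨η n, hη n, hy n⟩, ?_⟩
    simp_rw [fun n => ((hy n).eLpNorm_sub hz).1] at h1
    simp_rw [fun n => ((hy n).eLpNorm_sub hz).2.1] at h2
    simp_rw [fun n => ((hy n).eLpNorm_sub hz).2.2] at h3
    -- The squared norm of a triple is the sum of the squared component norms, so the three
    -- convergences are added in this form.
    have conv : ∀ {X : Type _} [NormedAddCommGroup X] {a : ℕ → X},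
        Tendsto (fun n => ‖a n‖ₑ) atTop (𝓝 0) → Tendsto (fun n => ‖a n‖ ^ 2) atTop (𝓝 0) := by
      intro X _ a ha
      have := (ENNReal.tendsto_toReal ENNReal.zero_ne_top).comp ha
      simpa using this.pow 2
    have hsq : Tendsto (fun n => ‖y n - z‖ ^ 2) atTop (𝓝 0) := by
      simp_rw [Triple.norm_sq_eq]
      simpa using (conv h1).add ((conv h2).add (conv h3))
    rw [tendsto_iff_norm_sub_tendsto_zero]
    simpa using hsq.sqrt

end Sobolev

end FiltrationCombustion

end

/-! ### Periodicity, passage from one cell to compact sets, and weak gradients. -/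

noncomputable section

namespace FiltrationCombustion

variable {d : ℕ}

/-- The integer vector `k` as a point of the space. -/
def latticeVec (k : Fin d → ℤ) : Space d := WithLp.toLp 2 fun i => (k i : ℝ)

@[simp] lemma latticeVec_apply (k : Fin d → ℤ) (i : Fin d) : latticeVec k i = k i := rfl

lemma latticeVec_eq_sum (k : Fin d → ℤ) :
    latticeVec k = ∑ i, k i • EuclideanSpace.single i (1 : ℝ) := by
  ext j
  simp [Finset.sum_apply, Pi.single_apply]

lemma IsCellPeriodic.periodic_latticeVec {β : Type*} {u : Space d → β} (hu : IsCellPeriodic u)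
    (k : Fin d → ℤ) : Function.Periodic u (latticeVec k) := by
  rw [latticeVec_eq_sum]
  refine Finset.sum_induction _ (Function.Periodic u) (fun a b ha hb => ha.add_period hb)
    (fun x => by simp) fun i _ => (hu i).zsmul (k i)

/-- The representative of a point in the half-open unit cell. -/
def cellFract (x : Space d) : Space d := WithLp.toLp 2 fun i => Int.fract (x i)

lemma cellFract_periodic : IsCellPeriodic (cellFract : Space d → Space d) := by
  intro i x
  ext j
  by_cases h : j = i
  · subst h; simp [cellFract]
  · simp [cellFract, h]

lemma cellFract_of_mem {x : Space d} (hx : x ∈ unitCell d) : cellFract x = x := by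
  ext j
  exact Int.fract_eq_self.2 ⟨(hx j).1.le, (hx j).2⟩

/-- The faces of the lattice cubes are null, so the open translates of the cell cover almost
everything. -/
lemma ae_coord_ne_int : ∀ᵐ x : Space d, ∀ (i : Fin d) (m : ℤ), x i ≠ m := by
  rw [ae_all_iff]; intro i
  rw [ae_all_iff]; intro m
  exact (PiLp.volume_preserving_ofLp (Fin d)).quasiMeasurePreserving.ae
    (Measure.ae_eval_ne (μ := fun _ : Fin d => (volume : Measure ℝ)) i (m : ℝ))

/-- The set `U` is invariant under integer translations. -/
def IsPeriodicSet (U : Set (Space d)) : Prop := ∀ k x, x + latticeVec k ∈ U ↔ x ∈ U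

lemma isPeriodicSet_univ : IsPeriodicSet (univ : Set (Space d)) := fun _ _ => Iff.rfl

variable {U : Set (Space d)}

/-- A bounded set meets only finitely many translates of the cell. This carries measurability and
integral bounds from one cell to the support of a test function, which may extend over many cells.
-/
lemma exists_restrict_le_sum_translates (hU : IsPeriodicSet U)
    {K : Set (Space d)} (hK : IsCompact K) :
    ∃ S : Finset (Fin d → ℤ), volume.restrict (U ∩ K) ≤
      ∑ k ∈ S, Measure.map (· + latticeVec k) (cellVolume U) := by
  classical
  obtain ⟨R, hR⟩ := hK.isBounded.subset_closedBall 0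
  obtain ⟨N, hN⟩ := exists_nat_gt R
  refine ⟨Fintype.piFinset fun _ => Finset.Icc (-(N : ℤ) - 1) N, Measure.le_iff.2 fun B hB => ?_⟩
  rw [Measure.restrict_apply hB, Measure.coe_finsetSum, Finset.sum_apply]
  set S := Fintype.piFinset fun _ : Fin d => Finset.Icc (-(N : ℤ) - 1) N
  have hterm : ∀ k, Measure.map (· + latticeVec k) (cellVolume U) B =
      volume ((· - latticeVec k) ⁻¹' ((· + latticeVec k) ⁻¹' B ∩ (U ∩ unitCell d))) := fun k => by
    rw [Measure.map_apply (measurable_add_const _) hB, cellVolume,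
      Measure.restrict_apply (measurable_add_const _ hB)]
    simp_rw [sub_eq_add_neg]
    rw [measure_preimage_add_right]
  simp_rw [hterm]
  refine le_trans (measure_mono_ae ?_) (measure_biUnion_finset_le S _)
  filter_upwards [ae_coord_ne_int (d := d)] with x hx hxB
  obtain ⟨hxB, hxU, hxK⟩ := hxB
  have hnorm : ∀ i, |x i| ≤ R := fun i => by
    have := hR hxK
    rw [mem_closedBall_zero_iff] at this
    exact (PiLp.norm_apply_le x i).trans this
  set k : Fin d → ℤ := fun i => ⌊x i⌋
  have hkS : k ∈ S := by
    refine Fintype.mem_piFinset.2 fun i => Finset.mem_Icc.2 ?_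
    obtain ⟨h1, h2⟩ := abs_le.1 (hnorm i)
    refine ⟨Int.le_floor.2 ?_, Int.floor_le_iff.2 ?_⟩
    · push_cast; linarith
    · push_cast; linarith
  refine mem_iUnion₂.2 ⟨k, hkS, ?_, ?_, ?_⟩
  · simpa using hxB
  · have := hU k (x - latticeVec k)
    rw [sub_add_cancel] at this
    exact this.1 hxU
  · intro i
    have h1 : (x - latticeVec k) i = Int.fract (x i) := rfl
    rw [h1]
    refine ⟨lt_of_le_of_ne (Int.fract_nonneg _) fun h => hx i ⌊x i⌋ ?_, Int.fract_lt_one _⟩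
    have := Int.fract_add_floor (x i)
    linarith

/-- `N` counts the translates and does not depend on `f`, so the bound can be used along sequences.
-/
lemma IsCellPeriodic.exists_setLIntegral_le (hU : IsPeriodicSet U) {K : Set (Space d)}
    (hK : IsCompact K) : ∃ N : ℕ, ∀ f : Space d → ℝ≥0∞, IsCellPeriodic f →
      ∫⁻ x in U ∩ K, f x ≤ N * ∫⁻ x, f x ∂(cellVolume U) := by
  obtain ⟨S, hS⟩ := exists_restrict_le_sum_translates hU hK
  refine ⟨S.card, fun f hf => (lintegral_mono' hS le_rfl).trans (le_of_eq ?_)⟩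
  rw [lintegral_finsetSum_measure]
  have : ∀ k ∈ S, ∫⁻ x, f x ∂(Measure.map (· + latticeVec k) (cellVolume U)) =
      ∫⁻ x, f x ∂(cellVolume U) := fun k _ => by
    have := lintegral_map_equiv (μ := cellVolume U) f (MeasurableEquiv.addRight (latticeVec k))
    refine this.trans (lintegral_congr fun x => hf.periodic_latticeVec k x)
  rw [Finset.sum_congr rfl this, Finset.sum_const, nsmul_eq_mul]

lemma IsCellPeriodic.aestronglyMeasurable {E : Type*} [TopologicalSpace E]
    [TopologicalSpace.PseudoMetrizableSpace E] (hU : IsPeriodicSet U) {K : Set (Space d)}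
    (hK : IsCompact K) {u : Space d → E} (hu : IsCellPeriodic u)
    (hm : AEStronglyMeasurable u (cellVolume U)) :
    AEStronglyMeasurable u (volume.restrict (U ∩ K)) := by
  obtain ⟨S, hS⟩ := exists_restrict_le_sum_translates hU hK
  refine AEStronglyMeasurable.mono_measure ?_ hS
  refine Finset.sum_induction _ (fun ν : Measure (Space d) => AEStronglyMeasurable u ν)
    (fun _ _ h h' => h.add_measure h') (aestronglyMeasurable_zero_measure u) fun k _ => ?_
  refine (MeasurableEquiv.addRight
    (latticeVec k)).measurableEmbedding.aestronglyMeasurable_map_iff.2 ?_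
  exact hm.congr (.of_forall fun x => (hu.periodic_latticeVec k x).symm)

instance : IsFiniteMeasure (cellVolume U) :=
  ⟨by
    rw [cellVolume, Measure.restrict_apply_univ]
    exact (measure_mono inter_subset_right).trans_lt isBounded_unitCell.measure_lt_top⟩

lemma ae_cellVolume_mem (hU : MeasurableSet U) : ∀ᵐ x ∂(cellVolume U), x ∈ unitCell d := by
  have : MeasurableSet (U ∩ unitCell d) := hU.inter isOpen_unitCell.measurableSet
  exact (ae_restrict_mem this).mono fun x hx => hx.2

lemma lintegral_enorm_le_eLpNorm_two {α E : Type*} [MeasurableSpace α] [NormedAddCommGroup E]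
    {μ : Measure α} {f : α → E} (hf : AEStronglyMeasurable f μ) :
    ∫⁻ x, ‖f x‖ₑ ∂μ ≤ eLpNorm f 2 μ * μ univ ^ (1 / 2 : ℝ) := by
  rw [← eLpNorm_one_eq_lintegral_enorm]
  refine (eLpNorm_le_eLpNorm_mul_rpow_measure_univ (p := 1) (q := 2) (by norm_num) hf).trans
    (le_of_eq ?_)
  norm_num

section Pairing

variable {E G H : Type*} [NormedAddCommGroup E] [NormedSpace ℝ E] [NormedAddCommGroup G]
  [NormedSpace ℝ G] [NormedAddCommGroup H] [NormedSpace ℝ H] (L : E →L[ℝ] G →L[ℝ] H)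

/-- Periodic `L²` functions are integrable against compactly supported weights. -/
lemma IsCellPeriodic.integrableOn_pairing (hU : IsPeriodicSet U) (hUm : MeasurableSet U)
    {v : Space d → E} (hv : IsCellPeriodic v) (hv2 : MemLp v 2 (cellVolume U))
    {w : Space d → G} (hw : Continuous w) (hws : HasCompactSupport w) :
    IntegrableOn (fun x => L (v x) (w x)) U := by
  obtain ⟨C, hC⟩ := hws.exists_bound_of_continuous hw
  have hm := hv.aestronglyMeasurable hU hws.isCompact hv2.1
  obtain ⟨N, hN⟩ := IsCellPeriodic.exists_setLIntegral_le hU hws.isCompact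
  have hvi : IntegrableOn v (U ∩ tsupport w) := by
    refine ⟨hm, (hN (fun x => ‖v x‖ₑ) fun i x => by simp only [hv i x]).trans_lt ?_⟩
    refine ENNReal.mul_lt_top (ENNReal.natCast_lt_top N)
      ((lintegral_enorm_le_eLpNorm_two hv2.1).trans_lt ?_)
    exact ENNReal.mul_lt_top hv2.2 (ENNReal.rpow_lt_top_of_nonneg (by norm_num)
      (measure_ne_top _ _))
  have hi : IntegrableOn (fun x => L (v x) (w x)) (U ∩ tsupport w) := by
    refine Integrable.mono' (hvi.norm.const_mul (‖L‖ * C)) ?_ (.of_forall fun x => ?_)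
    · exact L.aestronglyMeasurable_comp₂ hm hw.aestronglyMeasurable
    · calc ‖L (v x) (w x)‖ ≤ ‖L‖ * ‖v x‖ * ‖w x‖ := L.le_opNorm₂ _ _
        _ ≤ ‖L‖ * ‖v x‖ * C := by gcongr; exact hC x
        _ = ‖L‖ * C * ‖v x‖ := by ring
  refine hi.of_forall_sdiff_eq_zero hUm fun x hx => ?_
  rw [image_eq_zero_of_notMem_tsupport fun h => hx.2 ⟨hx.1, h⟩, map_zero]

/-- Convergence of pairings of periodic functions with a compactly supported weight. -/
lemma tendsto_setIntegral_pairing (hU : IsPeriodicSet U) (hUm : MeasurableSet U)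
    {v : Space d → E} (hv : IsCellPeriodic v) (hv2 : MemLp v 2 (cellVolume U))
    {vn : ℕ → Space d → E} (hvn : ∀ n, IsCellPeriodic (vn n))
    (hvn2 : ∀ n, MemLp (vn n) 2 (cellVolume U))
    (hlim : Tendsto (fun n => eLpNorm (vn n - v) 2 (cellVolume U)) atTop (𝓝 0))
    {w : Space d → G} (hw : Continuous w) (hws : HasCompactSupport w) :
    Tendsto (fun n => ∫ x in U, L (vn n x) (w x)) atTop (𝓝 (∫ x in U, L (v x) (w x))) := by
  refine tendsto_integral_of_L1 _
    (hv.integrableOn_pairing L hU hUm hv2 hw hws).aestronglyMeasurable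
    (.of_forall fun n => (hvn n).integrableOn_pairing L hU hUm (hvn2 n) hw hws) ?_
  obtain ⟨C, hC⟩ := hws.exists_bound_of_continuous hw
  obtain ⟨N, hN⟩ := IsCellPeriodic.exists_setLIntegral_le hU hws.isCompact
  set c : ℝ≥0∞ := ENNReal.ofReal (‖L‖ * C)
  set M := cellVolume U univ ^ (1 / 2 : ℝ)
  have hM : M ≠ ∞ := (ENNReal.rpow_lt_top_of_nonneg (by norm_num) (measure_ne_top _ _)).ne
  have hzero : Tendsto (fun n => c * (N * (eLpNorm (vn n - v) 2 (cellVolume U) * M))) atTop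
      (𝓝 0) := by
    have h1 := ENNReal.Tendsto.mul_const hlim (Or.inr hM)
    have h2 := ENNReal.Tendsto.const_mul h1 (Or.inr (ENNReal.natCast_ne_top N))
    have h3 := ENNReal.Tendsto.const_mul h2 (Or.inr (ENNReal.ofReal_ne_top (r := ‖L‖ * C)))
    simpa using h3
  refine tendsto_of_tendsto_of_tendsto_of_le_of_le tendsto_const_nhds hzero (fun _ => zero_le)
    fun n => ?_
  have hdm : AEStronglyMeasurable (vn n - v) (cellVolume U) := (hvn2 n).1.sub hv2.1
  calc ∫⁻ x in U, ‖L (vn n x) (w x) - L (v x) (w x)‖ₑ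
      = ∫⁻ x in U, (tsupport w).indicator
          (fun x => ‖L (vn n x) (w x) - L (v x) (w x)‖ₑ) x := by
        refine lintegral_congr fun x => ?_
        by_cases hx : x ∈ tsupport w
        · rw [indicator_of_mem hx]
        · rw [indicator_of_notMem hx, image_eq_zero_of_notMem_tsupport hx]; simp
    _ = ∫⁻ x in U ∩ tsupport w, ‖L (vn n x) (w x) - L (v x) (w x)‖ₑ := by
        rw [lintegral_indicator (isClosed_tsupport w).measurableSet,
          Measure.restrict_restrict (isClosed_tsupport w).measurableSet, inter_comm]
    _ ≤ ∫⁻ x in U ∩ tsupport w, c * ‖(vn n - v) x‖ₑ := by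
        refine lintegral_mono fun x => ?_
        rw [← ofReal_norm, ← ofReal_norm, ← ENNReal.ofReal_mul']
        · refine ENNReal.ofReal_le_ofReal ?_
          calc ‖L (vn n x) (w x) - L (v x) (w x)‖ = ‖L ((vn n - v) x) (w x)‖ := by simp
            _ ≤ ‖L‖ * ‖(vn n - v) x‖ * ‖w x‖ := L.le_opNorm₂ _ _
            _ ≤ ‖L‖ * ‖(vn n - v) x‖ * C := by gcongr; exact hC x
            _ = ‖L‖ * C * ‖(vn n - v) x‖ := by ring
        · exact norm_nonneg _
    _ = c * ∫⁻ x in U ∩ tsupport w, ‖(vn n - v) x‖ₑ :=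
        lintegral_const_mul' _ _ ENNReal.ofReal_ne_top
    _ ≤ c * (N * ∫⁻ x, ‖(vn n - v) x‖ₑ ∂(cellVolume U)) := by
        gcongr
        exact hN (fun x => ‖(vn n - v) x‖ₑ) fun i x => by
          simp only [Pi.sub_apply, hvn n i x, hv i x]
    _ ≤ c * (N * (eLpNorm (vn n - v) 2 (cellVolume U) * M)) := by
        gcongr
        exact lintegral_enorm_le_eLpNorm_two hdm

end Pairing

lemma IsSmoothPeriodic.periodic_grad {η : Space d → ℝ} (h : IsSmoothPeriodic η) :
    IsCellPeriodic (∇ η) := by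
  intro i x
  have : (fun y => η (y + EuclideanSpace.single i (1 : ℝ))) = η := funext (h.2 i)
  rw [gradient, ← fderiv_comp_add_right, this, gradient]

/-- Integration by parts for smooth functions. -/
lemma integral_smul_gradient_eq_neg {η ζ : Space d → ℝ} (hη : ContDiff ℝ (⊤ : ℕ∞) η)
    (hζ : ContDiff ℝ (⊤ : ℕ∞) ζ) (hζs : HasCompactSupport ζ) :
    ∫ x, η x • ∇ ζ x = - ∫ x, ζ x • ∇ η x := by
  have hη1 : ContDiff ℝ 1 η := hη.of_le (by simp)
  have hζ1 : ContDiff ℝ 1 ζ := hζ.of_le (by simp)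
  have hgs : HasCompactSupport (∇ ζ) := hζs.fderiv (𝕜 := ℝ) |>.comp_left (map_zero _)
  have hi1 : Integrable fun x => η x • ∇ ζ x :=
    (hη.continuous.smul (continuous_gradient hζ1)).integrable_of_hasCompactSupport
      (hgs.smul_left)
  have hi2 : Integrable fun x => ζ x • ∇ η x :=
    (hζ.continuous.smul (continuous_gradient hη1)).integrable_of_hasCompactSupport
      (hζs.smul_right)
  have hi3 : Integrable fun x => η x * ζ x :=
    (hη.continuous.mul hζ.continuous).integrable_of_hasCompactSupport hζs.mul_left
  -- Pairing with a fixed vector reduces the vector identity to integration by parts for one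
  -- directional derivative.
  refine ext_inner_right ℝ fun v => ?_
  rw [inner_neg_left, ← real_inner_comm, real_inner_comm v (∫ x, ζ x • ∇ η x),
    ← integral_inner hi1, ← integral_inner hi2]
  have e1 : ∀ x, ⟪v, η x • ∇ ζ x⟫ = η x * fderiv ℝ ζ x v := fun x => by
    rw [real_inner_smul_right, real_inner_comm, inner_gradient_left]
  have e2 : ∀ x, ⟪v, ζ x • ∇ η x⟫ = fderiv ℝ η x v * ζ x := fun x => by
    rw [real_inner_smul_right, real_inner_comm, inner_gradient_left, mul_comm]
  simp_rw [e1, e2]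
  refine integral_mul_fderiv_eq_neg_fderiv_mul_of_integrable ?_ ?_ hi3
    (fun x _ => hη1.differentiable one_ne_zero x) (fun x _ => hζ1.differentiable one_ne_zero x)
  · simp_rw [← e2]; exact hi2.const_inner v
  · simp_rw [← e1]; exact hi1.const_inner v

/-- Periodic functions that are `H¹`-limits of smooth periodic functions belong to `H¹_#`. -/
theorem memH1Per_of_tendsto (hU : IsPeriodicSet U) (hUm : MeasurableSet U) {u : Space d → ℝ}
    {Du : Space d → Space d} (hu : IsCellPeriodic u) (hDu : IsCellPeriodic Du)
    (hu2 : MemLp u 2 (cellVolume U)) (hDu2 : MemLp Du 2 (cellVolume U)) {η : ℕ → Space d → ℝ}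
    (hη : ∀ n, ContDiff ℝ (⊤ : ℕ∞) (η n) ∧ IsCellPeriodic (η n))
    (h1 : Tendsto (fun n => eLpNorm (η n - u) 2 (cellVolume U)) atTop (𝓝 0))
    (h2 : Tendsto (fun n => eLpNorm (∇ (η n) - Du) 2 (cellVolume U)) atTop (𝓝 0)) :
    MemH1Per U u Du := by
  refine ⟨hu, hDu, hu2, hDu2, fun ζ hζ hζs hζU => ?_⟩
  have hηp : ∀ n, IsSmoothPeriodic (η n) := hη
  have hgs : HasCompactSupport (∇ ζ) := hζs.fderiv (𝕜 := ℝ) |>.comp_left (map_zero _)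
  have hgc : Continuous (∇ ζ) := continuous_gradient (hζ.of_le (by simp))
  have hcell := ae_cellVolume_mem hUm
  -- Both sides of the weak identity pass to the limit by the same statement: scalar multiplication
  -- pairs `η n` with `∇ ζ`, its flip pairs `∇ (η n)` with `ζ`.
  have t1 := tendsto_setIntegral_pairing (ContinuousLinearMap.lsmul ℝ ℝ) hU hUm hu hu2
    (fun n => (hη n).2) (fun n => Continuous.memLp_of_cell hcell (hη n).1.continuous 2) h1 hgc hgs
  have t2 := tendsto_setIntegral_pairing (ContinuousLinearMap.lsmul ℝ ℝ).flip hU hUm hDu hDu2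
    (fun n => (hηp n).periodic_grad)
    (fun n => Continuous.memLp_of_cell hcell (hηp n).continuous_grad 2) h2 hζ.continuous hζs
  simp only [ContinuousLinearMap.lsmul_apply, ContinuousLinearMap.flip_apply] at t1 t2
  refine tendsto_nhds_unique t1 (t2.neg.congr fun n => ?_)
  have hz : ∀ x ∉ U, ζ x = 0 := fun x hx =>
    image_eq_zero_of_notMem_tsupport fun h => hx (hζU h)
  have hz' : ∀ x ∉ U, ∇ ζ x = 0 := fun x hx => by
    have hx' : x ∉ tsupport ζ := fun h => hx (hζU h)
    have : fderiv ℝ ζ x = 0 := image_eq_zero_of_notMem_tsupport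
      fun h => hx' (tsupport_fderiv_subset ℝ h)
    simp [gradient, this]
  -- The support of `ζ` lies in `U`, so the integrals over `U` are integrals over the whole space
  -- and no boundary term appears.
  rw [setIntegral_eq_integral_of_forall_compl_eq_zero fun x hx => by rw [hz x hx, zero_smul],
    setIntegral_eq_integral_of_forall_compl_eq_zero fun x hx => by rw [hz' x hx, smul_zero],
    integral_smul_gradient_eq_neg (hη n).1 hζ hζs]

section Realization

variable {σ : Measure (Space d)} [IsFiniteMeasure σ]

/-- With the converse `exists_hasTrace_of_sobolev`, this identifies the functions of the weak
formulation with the elements of the closed space `sobolev`. -/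
lemma exists_represents_of_hasTrace (hUm : MeasurableSet U) (hσ : ∀ᵐ x ∂σ, x ∈ unitCell d)
    {u τ : Space d → ℝ} {Du : Space d → Space d} (hu : MemH1Per U u Du)
    (hτ : HasTrace U σ u Du τ) :
    ∃ z : sobolev (cellVolume U) σ, Represents (z : Triple (cellVolume U) σ) u Du τ := by
  have hr := Triple.represents_mk hu.memLp hu.memLp_grad hτ.1
  exact ⟨⟨_, (hr.mem_sobolev_iff (ae_cellVolume_mem hUm) hσ).2 hτ.2⟩, hr⟩

/-- Every element of the Sobolev space is realized by periodic functions. -/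
lemma exists_hasTrace_of_sobolev (hU : IsPeriodicSet U) (hUm : MeasurableSet U)
    (hσ : ∀ᵐ x ∂σ, x ∈ unitCell d) (z : sobolev (cellVolume U) σ) :
    ∃ u Du τ, MemH1Per U u Du ∧ HasTrace U σ u Du τ ∧
      Represents (z : Triple (cellVolume U) σ) u Du τ := by
  have hcell := ae_cellVolume_mem hUm
  set f := valL (cellVolume U) σ z
  set g := gradL (cellVolume U) σ z
  -- Composition with `cellFract` makes the representatives periodic without changing them on the
  -- cell. The trace needs no such change: only its values on Γ matter.
  have hr : Represents (z : Triple (cellVolume U) σ) (fun x => f (cellFract x))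
      (fun x => g (cellFract x)) (traceL (cellVolume U) σ z) :=
    ⟨hcell.mono fun x hx => by simp only [cellFract_of_mem hx]; rfl,
      hcell.mono fun x hx => by simp only [cellFract_of_mem hx]; rfl, .rfl⟩
  have happ := (hr.mem_sobolev_iff hcell hσ).1 z.2
  obtain ⟨η, hη, h1, h2, h3⟩ := happ
  refine ⟨_, _, _, memH1Per_of_tendsto hU hUm ?_ ?_ hr.memLp_val hr.memLp_grad hη h1 h2,
    ⟨hr.memLp_trace, η, hη, h1, h2, h3⟩, hr⟩
  · exact fun i x => by simp only [cellFract_periodic i x]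
  · exact fun i x => by simp only [cellFract_periodic i x]

end Realization

end FiltrationCombustion

end

/-! ### Continuous forms on triples and the norm estimates behind coercivity. -/

noncomputable section

namespace FiltrationCombustion

variable {d : ℕ}

section Forms

variable {μ ν σ : Measure (Space d)}

/-- The bilinear form `(u, φ) ↦ ∫ (b · ∇u) φ dν`. -/
def convForm (σ : Measure (Space d)) (h : ν ≤ μ) {b : Space d → Space d} (hb : MemLp b ⊤ ν) :
    Triple μ σ →L[ℝ] Triple μ σ →L[ℝ] ℝ :=
  (innerBilin (Lp ℝ 2 ν)).bilinearComp
    ((innerBilin (Space d)).holderL ν ⊤ 2 2 (hb.toLp b) ∘L LpRestrict (Space d) h ∘L gradL μ σ)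
    (LpRestrict ℝ h ∘L valL μ σ)

/-- The bilinear form `(u, φ) ↦ ∫ ∇u · ∇φ dν`. -/
def gradForm (σ : Measure (Space d)) (h : ν ≤ μ) : Triple μ σ →L[ℝ] Triple μ σ →L[ℝ] ℝ :=
  (innerBilin (Lp (Space d) 2 ν)).bilinearComp (LpRestrict (Space d) h ∘L gradL μ σ)
    (LpRestrict (Space d) h ∘L gradL μ σ)

/-- The functional `φ ↦ ∫ f φ dν`. -/
def sourceForm (σ : Measure (Space d)) (h : ν ≤ μ) {f : Space d → ℝ} (hf : MemLp f 2 ν) :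
    Triple μ σ →L[ℝ] ℝ :=
  innerBilin (Lp ℝ 2 ν) (hf.toLp f) ∘L LpRestrict ℝ h ∘L valL μ σ

/-- The functional `φ ↦ ∫ v · ∇φ dν`. -/
def fluxForm (σ : Measure (Space d)) (h : ν ≤ μ) [IsFiniteMeasure ν] (v : Space d) :
    Triple μ σ →L[ℝ] ℝ :=
  innerBilin (Lp (Space d) 2 ν) ((memLp_const v).toLp _) ∘L LpRestrict (Space d) h ∘L gradL μ σ

variable {z y : Triple μ σ} {u τ φ τφ : Space d → ℝ} {Du Dφ : Space d → Space d}

lemma convForm_eq (h : ν ≤ μ) {b : Space d → Space d} (hb : MemLp b ⊤ ν)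
    (hz : Represents z u Du τ) (hy : Represents y φ Dφ τφ) :
    convForm σ h hb z y = ∫ x, ⟪b x, Du x⟫ * φ x ∂ν := by
  have h1 : (innerBilin (Space d)).holder 2 (hb.toLp b) (LpRestrict (Space d) h (gradL μ σ z))
      =ᵐ[ν] fun x => ⟪b x, Du x⟫ := by
    filter_upwards [(innerBilin (Space d)).coeFn_holder (r := 2) (hb.toLp b)
      (LpRestrict (Space d) h (gradL μ σ z)), hb.coeFn_toLp, LpRestrict_ae_eq h hz.grad]
      with x h1 h2 h3
    rw [h1, h2, h3, innerBilin_apply]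
  refine (inner_Lp_eq_integral h1 (LpRestrict_ae_eq h hy.val)).trans ?_
  simp [mul_comm]

lemma gradForm_self (h : ν ≤ μ) (z : Triple μ σ) :
    gradForm σ h z z = ‖LpRestrict (Space d) h (gradL μ σ z)‖ ^ 2 :=
  real_inner_self_eq_norm_sq (LpRestrict (Space d) h (gradL μ σ z))

lemma sourceForm_eq (h : ν ≤ μ) {f : Space d → ℝ} (hf : MemLp f 2 ν)
    (hy : Represents y φ Dφ τφ) : sourceForm σ h hf y = ∫ x, f x * φ x ∂ν := by
  refine (inner_Lp_eq_integral hf.coeFn_toLp (LpRestrict_ae_eq h hy.val)).trans ?_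
  simp [mul_comm]

/-- The flux `Du + v` is affine in the unknown; its constant part is separated so that it can be
moved to the right-hand side. -/
lemma gradForm_add_fluxForm [IsFiniteMeasure ν] (h : ν ≤ μ) (v : Space d)
    (hz : Represents z u Du τ) (hy : Represents y φ Dφ τφ) :
    gradForm σ h z y + fluxForm σ h v y = ∫ x, ⟪Du x + v, Dφ x⟫ ∂ν := by
  have h1 : (LpRestrict (Space d) h (gradL μ σ z) + (memLp_const (μ := ν) (p := 2) v).toLp _ :
      Lp (Space d) 2 ν) =ᵐ[ν] fun x => Du x + v := by
    filter_upwards [Lp.coeFn_add (LpRestrict (Space d) h (gradL μ σ z))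
      ((memLp_const (μ := ν) (p := 2) v).toLp _), LpRestrict_ae_eq h hz.grad,
      (memLp_const (μ := ν) (p := 2) v).coeFn_toLp] with x h1 h2 h3
    rw [h1, Pi.add_apply, h2, h3]
  rw [← inner_Lp_eq_integral h1 (LpRestrict_ae_eq h hy.grad), inner_add_left]
  rfl

/-- Temperature, concentration and test function may live on different volume measures; only the
surface measure `σ` is common to them. -/
lemma inner_traceL_eq {ρ : Measure (Space d)} {w : Triple ρ σ} {u' τ' : Space d → ℝ}
    {Du' : Space d → Space d} {κ : Measure (Space d)} {y : Triple κ σ} (α β : ℝ)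
    (hz : Represents z u Du τ) (hw : Represents w u' Du' τ') (hy : Represents y φ Dφ τφ) :
    ⟪α • traceL μ σ z + β • traceL ρ σ w, traceL κ σ y⟫ =
      ∫ x, (α * τ x + β * τ' x) * τφ x ∂σ := by
  have h1 : (α • traceL μ σ z + β • traceL ρ σ w : Lp ℝ 2 σ) =ᵐ[σ]
      fun x => α * τ x + β * τ' x := by
    filter_upwards [Lp.coeFn_add (α • traceL μ σ z) (β • traceL ρ σ w),
      Lp.coeFn_smul α (traceL μ σ z), Lp.coeFn_smul β (traceL ρ σ w), hz.trace, hw.trace]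
      with x h1 h2 h3 h4 h5
    rw [h1, Pi.add_apply, h2, h3, Pi.smul_apply, Pi.smul_apply, h4, h5, smul_eq_mul, smul_eq_mul]
  refine (inner_Lp_eq_integral h1 hy.trace).trans ?_
  simp [mul_comm]

lemma Represents.gradL_eq_zero {a : ℝ} (hz : Represents z (fun _ => a) (∇ fun _ => a) τ) :
    gradL μ σ z = 0 := by
  refine Lp.ext (hz.grad.trans (.trans (.of_forall fun x => ?_) (Lp.coeFn_zero _ _ _).symm))
  exact gradient_fun_const x a

end Forms

section Estimates

variable {μ σ : Measure (Space d)}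

lemma norm_sq_le_of_enorm_sq_le {X Y : Type*} [NormedAddCommGroup X] [NormedAddCommGroup Y]
    {x : X} {y : Y} {C : ℝ≥0} (h : ‖x‖ₑ ^ 2 ≤ C * ‖y‖ₑ ^ 2) : ‖x‖ ^ 2 ≤ C * ‖y‖ ^ 2 := by
  rw [enorm_eq_nnnorm, enorm_eq_nnnorm] at h
  exact_mod_cast h

lemma norm_sq_le_of_enorm_sq_le_add {X Y Z : Type*} [NormedAddCommGroup X] [NormedAddCommGroup Y]
    [NormedAddCommGroup Z] {x : X} {y : Y} {z : Z} {C : ℝ≥0}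
    (h : ‖x‖ₑ ^ 2 ≤ C * (‖y‖ₑ ^ 2 + ‖z‖ₑ ^ 2)) : ‖x‖ ^ 2 ≤ C * (‖y‖ ^ 2 + ‖z‖ ^ 2) := by
  simp only [enorm_eq_nnnorm] at h
  exact_mod_cast h

lemma norm_sq_le_two_mul {X : Type*} [NormedAddCommGroup X] (x y : X) :
    ‖x‖ ^ 2 ≤ 2 * ‖x - y‖ ^ 2 + 2 * ‖y‖ ^ 2 := by
  have h := norm_add_le (x - y) y
  rw [sub_add_cancel] at h
  nlinarith [sq_nonneg (‖x - y‖ - ‖y‖), norm_nonneg x, norm_nonneg y, norm_nonneg (x - y)]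

/-- The Poincaré inequality for smooth triples. -/
lemma HasPoincare.exists_triple {W : Set (Space d)} (hW : HasPoincare W W)
    (hμ : μ = volume.restrict W) {e : Triple μ σ}
    (he : Represents e (fun _ => 1) (∇ fun _ : Space d => (1 : ℝ)) fun _ => 1) :
    ∃ C : ℝ≥0, ∀ (z : Triple μ σ) η, IsSmoothPeriodic η → Represents z η (∇ η) η →
      ∃ m : ℝ, ‖valL μ σ (z - m • e)‖ ^ 2 ≤ C * ‖gradL μ σ z‖ ^ 2 := by
  obtain ⟨C, hC⟩ := hW
  refine ⟨C, fun z η hη hz => ?_⟩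
  obtain ⟨m, hm⟩ := hC η hη.contDiff_one
  refine ⟨m, norm_sq_le_of_enorm_sq_le ?_⟩
  have hval : valL μ σ (z - m • e) =ᵐ[μ] fun x => η x - m := by
    rw [map_sub, map_smul]
    filter_upwards [Lp.coeFn_sub (valL μ σ z) (m • valL μ σ e), Lp.coeFn_smul m (valL μ σ e),
      hz.val, he.val] with x h1 h2 h3 h4
    rw [h1, Pi.sub_apply, h2, Pi.smul_apply, h3, h4, smul_eq_mul, mul_one]
  rw [enorm_Lp_sq hval, enorm_Lp_sq hz.grad, hμ]
  exact hm

/-- The trace inequality for smooth triples. -/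
lemma exists_trace_triple {n : ℕ} {Ys : Set (Space (n + 1))} (hY : IsSolidPart Ys)
    {μ : Measure (Space (n + 1))} (hμ : volume.restrict (gasCell Ys) ≤ μ) :
    ∃ C : ℝ≥0, ∀ (z : Triple μ (surface Ys)) η, IsSmoothPeriodic η → Represents z η (∇ η) η →
      ‖traceL μ (surface Ys) z‖ ^ 2 ≤
        C * (‖valL μ (surface Ys) z‖ ^ 2 + ‖gradL μ (surface Ys) z‖ ^ 2) := by
  obtain ⟨C, hC⟩ := hY.exists_trace
  refine ⟨C, fun z η hη hz => norm_sq_le_of_enorm_sq_le_add ?_⟩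
  rw [enorm_Lp_sq hz.trace, enorm_Lp_sq hz.val, enorm_Lp_sq hz.grad]
  refine (hC η hη.contDiff_one).trans ?_
  have hm : Measurable fun y => ‖η y‖ₑ ^ 2 := (hη.1.continuous.measurable.enorm).pow_const 2
  rw [lintegral_add_left hm]
  gcongr

variable {e : Triple μ σ}

lemma smooth_sub_const {z : Triple μ σ} {η : Space d → ℝ} (hη : IsSmoothPeriodic η)
    (hz : Represents z η (∇ η) η)
    (he : Represents e (fun _ => 1) (∇ fun _ : Space d => (1 : ℝ)) fun _ => 1) (m : ℝ) :
    ∃ θ, IsSmoothPeriodic θ ∧ Represents (z - m • e) θ (∇ θ) θ := by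
  have h1 : z ∈ smoothTriples μ σ := ⟨η, hη, hz⟩
  have h2 : e ∈ smoothTriples μ σ := ⟨_, .const 1, he⟩
  exact Submodule.sub_mem _ h1 (Submodule.smul_mem _ m h2)

/-- The norm of a smooth triple is controlled by its gradient and its mean. -/
lemma exists_norm_sq_le_grad_add_mean
    (he0 : valL μ σ e ≠ 0)
    (hP : ∃ C : ℝ≥0, ∀ (z : Triple μ σ) η, IsSmoothPeriodic η → Represents z η (∇ η) η →
      ∃ m : ℝ, ‖valL μ σ (z - m • e)‖ ^ 2 ≤ C * ‖gradL μ σ z‖ ^ 2)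
    (hT : ∃ C : ℝ≥0, ∀ (z : Triple μ σ) η, IsSmoothPeriodic η → Represents z η (∇ η) η →
      ‖traceL μ σ z‖ ^ 2 ≤ C * (‖valL μ σ z‖ ^ 2 + ‖gradL μ σ z‖ ^ 2)) :
    ∃ K > 0, ∀ (z : Triple μ σ) η, IsSmoothPeriodic η → Represents z η (∇ η) η →
      ‖z‖ ^ 2 ≤ K * (‖gradL μ σ z‖ ^ 2 + ⟪valL μ σ e, valL μ σ z⟫ ^ 2) := by
  obtain ⟨C, hC⟩ := hP
  obtain ⟨D, hD⟩ := hT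
  set N := ‖valL μ σ e‖ ^ 2
  have hN : 0 < N := by have := norm_pos_iff.2 he0; positivity
  -- The value part satisfies ‖x‖² ≤ 2‖x - mE‖² + 2m²N ≤ 6Cg + (4/N)p. The trace inequality then
  -- costs the factor `1 + D`.
  refine ⟨(1 + D) * (6 * C + 4 / N + 1), by positivity, fun z η hη hz => ?_⟩
  obtain ⟨m, hm⟩ := hC z η hη hz
  have htr := hD z η hη hz
  rw [Triple.norm_sq_eq]
  rw [map_sub, map_smul] at hm
  set x := valL μ σ z
  set E := valL μ σ e
  set g := ‖gradL μ σ z‖ ^ 2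
  have hg : 0 ≤ g := by positivity
  set p := ⟪E, x⟫ ^ 2
  have hp : 0 ≤ p := sq_nonneg _
  -- The Poincaré constant `m` is arbitrary; pairing with the constant function expresses it by the
  -- mean up to an error that Poincaré controls.
  have hmN : m * N = ⟪E, x⟫ - ⟪E, x - m • E⟫ := by
    rw [inner_sub_right, real_inner_smul_right, real_inner_self_eq_norm_sq]; ring
  have hin : ⟪E, x - m • E⟫ ^ 2 ≤ N * ‖x - m • E‖ ^ 2 := by
    rw [← sq_abs, ← mul_pow]
    gcongr
    exact abs_real_inner_le_norm _ _
  have hm2 : m ^ 2 * N ≤ 2 * p / N + 2 * ‖x - m • E‖ ^ 2 := by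
    have h1 : (m * N) ^ 2 ≤ 2 * p + 2 * (N * ‖x - m • E‖ ^ 2) := by
      rw [hmN]; nlinarith [sq_nonneg (⟪E, x⟫ + ⟪E, x - m • E⟫)]
    have h2 : m ^ 2 * N = (m * N) ^ 2 / N := by field_simp
    have h3 : 2 * p / N + 2 * ‖x - m • E‖ ^ 2 = (2 * p + 2 * (N * ‖x - m • E‖ ^ 2)) / N := by
      field_simp
    rw [h2, h3]; gcongr
  have hx : ‖x‖ ^ 2 ≤ 6 * (C * g) + 4 / N * p := by
    have h1 := norm_sq_le_two_mul x (m • E)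
    have h2 : ‖m • E‖ ^ 2 = m ^ 2 * N := by rw [norm_smul, mul_pow, Real.norm_eq_abs, sq_abs]
    rw [h2] at h1
    have h3 : 4 / N * p = 2 * (2 * p / N) := by ring
    linarith
  have hD0 : (0 : ℝ) ≤ D := D.2
  calc ‖x‖ ^ 2 + (g + ‖traceL μ σ z‖ ^ 2)
      ≤ (1 + D) * (‖x‖ ^ 2 + g) := by linarith
    _ ≤ (1 + D) * (6 * (C * g) + 4 / N * p + g) := by gcongr
    _ ≤ _ := by
      rw [mul_assoc]
      gcongr
      have h1 : 0 ≤ 4 / N * g := by positivity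
      have h2 : 0 ≤ 6 * (C : ℝ) * p := by positivity
      nlinarith

/-- The norm of a smooth triple is controlled by its gradient and its trace. -/
lemma exists_norm_sq_le_grad_add_trace
    (he : Represents e (fun _ => 1) (∇ fun _ : Space d => (1 : ℝ)) fun _ => 1)
    (he0 : traceL μ σ e ≠ 0)
    (hP : ∃ C : ℝ≥0, ∀ (z : Triple μ σ) η, IsSmoothPeriodic η → Represents z η (∇ η) η →
      ∃ m : ℝ, ‖valL μ σ (z - m • e)‖ ^ 2 ≤ C * ‖gradL μ σ z‖ ^ 2)
    (hT : ∃ C : ℝ≥0, ∀ (z : Triple μ σ) η, IsSmoothPeriodic η → Represents z η (∇ η) η →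
      ‖traceL μ σ z‖ ^ 2 ≤ C * (‖valL μ σ z‖ ^ 2 + ‖gradL μ σ z‖ ^ 2)) :
    ∃ K > 0, ∀ (z : Triple μ σ) η, IsSmoothPeriodic η → Represents z η (∇ η) η →
      ‖z‖ ^ 2 ≤ K * (‖gradL μ σ z‖ ^ 2 + ‖traceL μ σ z‖ ^ 2) := by
  obtain ⟨C, hC⟩ := hP
  obtain ⟨D, hD⟩ := hT
  set N := ‖traceL μ σ e‖ ^ 2
  have hN : 0 < N := by have := norm_pos_iff.2 he0; positivity
  set M := ‖valL μ σ e‖ ^ 2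
  have hM : 0 ≤ M := sq_nonneg _
  refine ⟨2 * C + 2 * M * (2 * (D * (C + 1)) + 2) / N + 1, by positivity, fun z η hη hz => ?_⟩
  obtain ⟨m, hm⟩ := hC z η hη hz
  -- The trace inequality is applied to `z - m • e`, which has the same gradient. Its trace is thus
  -- bounded by the energy, and `m` is recovered from the trace of `z`.
  obtain ⟨θ, hθ, hzθ⟩ := smooth_sub_const hη hz he m
  have htr := hD _ θ hθ hzθ
  have hge : gradL μ σ (z - m • e) = gradL μ σ z := by
    rw [map_sub, map_smul, he.gradL_eq_zero, smul_zero, sub_zero]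
  rw [hge] at htr
  rw [Triple.norm_sq_eq]
  set g := ‖gradL μ σ z‖ ^ 2
  have hg : 0 ≤ g := by positivity
  set t := ‖traceL μ σ z‖ ^ 2
  have ht : 0 ≤ t := sq_nonneg _
  have hD0 : (0 : ℝ) ≤ D := D.2
  have hC0 : (0 : ℝ) ≤ C := C.2
  have htr' : ‖traceL μ σ (z - m • e)‖ ^ 2 ≤ D * (C + 1) * g := by
    calc _ ≤ (D : ℝ) * (‖valL μ σ (z - m • e)‖ ^ 2 + g) := htr
      _ ≤ D * (C * g + g) := by gcongr
      _ = _ := by ring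
  have hmN : m ^ 2 * N ≤ 2 * (D * (C + 1) * g) + 2 * t := by
    have h1 := norm_sq_le_two_mul (m • traceL μ σ e) (traceL μ σ z)
    rw [norm_smul, mul_pow, Real.norm_eq_abs, sq_abs, norm_sub_rev, ← map_smul, ← map_sub] at h1
    linarith
  have hm2 : m ^ 2 ≤ (2 * (D * (C + 1)) + 2) / N * (g + t) := by
    have : m ^ 2 ≤ (2 * (D * (C + 1) * g) + 2 * t) / N := by rwa [le_div_iff₀ hN]
    refine this.trans ?_
    rw [div_mul_eq_mul_div]
    gcongr
    have : 0 ≤ (D : ℝ) * (C + 1) * t := by positivity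
    nlinarith
  have hx : ‖valL μ σ z‖ ^ 2 ≤ 2 * (C * g) + 2 * (m ^ 2 * M) := by
    have h1 := norm_sq_le_two_mul (valL μ σ z) (m • valL μ σ e)
    rw [norm_smul, mul_pow, Real.norm_eq_abs, sq_abs, ← map_smul, ← map_sub] at h1
    linarith
  have h3 : 2 * (m ^ 2 * M) ≤ 2 * M * (2 * (D * (C + 1)) + 2) / N * (g + t) := by
    calc 2 * (m ^ 2 * M) ≤ 2 * ((2 * (D * (C + 1)) + 2) / N * (g + t) * M) := by gcongr
      _ = _ := by ring
  have h4 : 2 * (C * g) ≤ 2 * (C : ℝ) * (g + t) := by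
    have : 0 ≤ (C : ℝ) * t := by positivity
    linarith
  linarith

end Estimates

end FiltrationCombustion

end

/-! ### The periodic gas domain, skew-symmetry of transport, and the weak equations as forms. -/

noncomputable section

namespace FiltrationCombustion

section PeriodicGas

variable {d : ℕ} {Ys : Set (Space d)}

lemma isPeriodicSet_periodicGas : IsPeriodicSet (periodicGas Ys) := by
  intro k x
  have hadd : ∀ m m' : Fin d → ℤ, latticeVec (m + m') = latticeVec m + latticeVec m' :=
    fun m m' => by ext; simp
  constructor
  · intro h m
    have := h (m - k)
    change x + latticeVec k + latticeVec (m - k) ∉ _ at this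
    rwa [add_assoc, ← hadd, add_sub_cancel] at this
  · intro h m
    have := h (k + m)
    change x + latticeVec (k + m) ∉ _ at this
    rwa [hadd, ← add_assoc] at this

lemma measurableSet_periodicGas : MeasurableSet (periodicGas Ys) := by
  have : periodicGas Ys = ⋂ k : Fin d → ℤ, (· + latticeVec k) ⁻¹' (closure Ys)ᶜ := by
    ext x; simp [periodicGas, latticeVec]
  rw [this]
  exact .iInter fun k => measurable_add_const _ isClosed_closure.measurableSet.compl

/-- Two points of the open unit cell that differ by an integer vector are equal, so only the zero
translate of the solid is seen in the cell. -/
lemma periodicGas_inter_unitCell (h : closure Ys ⊆ unitCell d) :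
    periodicGas Ys ∩ unitCell d = gasCell Ys := by
  ext x
  constructor
  · rintro ⟨hx, hxc⟩
    refine ⟨hxc, ?_⟩
    have := hx 0
    change x + latticeVec 0 ∉ _ at this
    rwa [show latticeVec (0 : Fin d → ℤ) = 0 by ext; simp, add_zero] at this
  · rintro ⟨hxc, hx⟩
    refine ⟨fun k hk => hx ?_, hxc⟩
    change x + latticeVec k ∈ _ at hk
    have hk0 : latticeVec k = 0 := by
      ext i
      have h1 := h hk i
      have h2 := hxc i
      simp only [PiLp.add_apply, latticeVec_apply, mem_Ioo] at h1
      have h3 : (k i : ℝ) < 1 := by linarith [h2.1]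
      have h4 : (-1 : ℝ) < k i := by linarith [h2.2]
      have h5 : k i < 1 := by exact_mod_cast h3
      have h6 : -1 < k i := by exact_mod_cast h4
      have : k i = 0 := by omega
      simp [this]
    rwa [hk0, add_zero] at hk

lemma cellVolume_univ : cellVolume (univ : Set (Space d)) = volume.restrict (unitCell d) := by
  rw [cellVolume, univ_inter]

lemma cellVolume_periodicGas (h : closure Ys ⊆ unitCell d) :
    cellVolume (periodicGas Ys) = volume.restrict (gasCell Ys) := by
  rw [cellVolume, periodicGas_inter_unitCell h]

lemma restrict_gasCell_le : volume.restrict (gasCell Ys) ≤ cellVolume (univ : Set (Space d)) := by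
  rw [cellVolume_univ]
  exact Measure.restrict_mono (gasCell_subset_unitCell Ys) le_rfl

lemma restrict_solid_le (h : closure Ys ⊆ unitCell d) :
    volume.restrict Ys ≤ cellVolume (univ : Set (Space d)) := by
  rw [cellVolume_univ]
  exact Measure.restrict_mono (subset_closure.trans h) le_rfl

instance : IsFiniteMeasure (volume.restrict (gasCell Ys)) :=
  ⟨by
    rw [Measure.restrict_apply_univ]
    exact (measure_mono (gasCell_subset_unitCell Ys)).trans_lt isBounded_unitCell.measure_lt_top⟩

lemma isFiniteMeasure_restrict_solid (h : closure Ys ⊆ unitCell d) :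
    IsFiniteMeasure (volume.restrict Ys) :=
  ⟨by
    rw [Measure.restrict_apply_univ]
    exact (measure_mono (subset_closure.trans h)).trans_lt isBounded_unitCell.measure_lt_top⟩

lemma ae_surface_mem (h : closure Ys ⊆ unitCell d) : ∀ᵐ x ∂(surface Ys), x ∈ unitCell d :=
  (ae_restrict_mem isClosed_frontier.measurableSet).mono fun _ hx =>
    h (frontier_subset_closure hx)

end PeriodicGas

section Transport

variable {d : ℕ} {Ys : Set (Space d)} {b : Space d → Space d} {μ σ : Measure (Space d)}

/-- Transport by a divergence-free field is skew-symmetric. -/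
lemma IsVelocity.convForm_self (hb : IsVelocity Ys b) (h : volume.restrict (gasCell Ys) ≤ μ)
    {z : Triple μ σ} (hz : z ∈ sobolev μ σ) : convForm σ h hb.bounded z z = 0 := by
  refine sobolev_eq_of_smooth (f := fun z => convForm σ h hb.bounded z z) (g := fun _ => 0)
    ((convForm σ h hb.bounded).continuous.clm_apply continuous_id) continuous_const
    (fun z η hη hr => ?_) hz
  -- Since 2 η b·∇η = b·∇(η²), the weak divergence condition tested with η² is the claim.
  have h0 := hb.divFree (η * η) (hη.mul hη).1 (hη.mul hη).2
  have h1 : ∀ y, ⟪b y, ∇ (η * η) y⟫ = 2 * (⟪b y, ∇ η y⟫ * η y) := fun y => by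
    rw [gradient_mul_apply (hη.differentiable y) (hη.differentiable y), inner_add_right,
      real_inner_smul_right]
    ring
  simp_rw [h1] at h0
  rw [integral_const_mul] at h0
  rw [convForm_eq h hb.bounded hr hr]
  linarith

/-- For smooth functions this is the weak divergence condition itself; it carries both div b = 0 and
b·n = 0. -/
lemma IsVelocity.convForm_const_right (hb : IsVelocity Ys b)
    (h : volume.restrict (gasCell Ys) ≤ μ) {e : Triple μ σ}
    (he : Represents e (fun _ => 1) (∇ fun _ : Space d => (1 : ℝ)) fun _ => 1)
    {z : Triple μ σ} (hz : z ∈ sobolev μ σ) : convForm σ h hb.bounded z e = 0 := by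
  refine sobolev_eq_of_smooth (f := fun z => convForm σ h hb.bounded z e) (g := fun _ => 0)
    ((convForm σ h hb.bounded).continuous.clm_apply continuous_const) continuous_const
    (fun z η hη hr => ?_) hz
  rw [convForm_eq h hb.bounded hr he]
  simpa using hb.divFree η hη.1 hη.2

lemma convForm_of_gradL_eq_zero {ν : Measure (Space d)} (h : ν ≤ μ) (hb : MemLp b ⊤ ν)
    {e : Triple μ σ} (he : gradL μ σ e = 0) (z : Triple μ σ) : convForm σ h hb e z = 0 := by
  rw [convForm, ContinuousLinearMap.bilinearComp_apply, ContinuousLinearMap.comp_apply,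
    ContinuousLinearMap.comp_apply, he, map_zero, map_zero, map_zero]
  rfl

lemma gradForm_of_gradL_eq_zero_left {ν : Measure (Space d)} (h : ν ≤ μ)
    {e : Triple μ σ} (he : gradL μ σ e = 0) (z : Triple μ σ) : gradForm σ h e z = 0 := by
  simp [gradForm, he]

lemma gradForm_of_gradL_eq_zero_right {ν : Measure (Space d)} (h : ν ≤ μ)
    {e : Triple μ σ} (he : gradL μ σ e = 0) (z : Triple μ σ) : gradForm σ h z e = 0 := by
  simp [gradForm, he]

lemma fluxForm_of_gradL_eq_zero {ν : Measure (Space d)} [IsFiniteMeasure ν] (h : ν ≤ μ)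
    {e : Triple μ σ} (he : gradL μ σ e = 0) (v : Space d) : fluxForm σ h v e = 0 := by
  simp [fluxForm, he]

variable (c : Coefficients)

/-- The bilinear form of the heat equation. -/
def heatForm (σ : Measure (Space d)) (hg : volume.restrict (gasCell Ys) ≤ μ)
    (hs : volume.restrict Ys ≤ μ) (hb : MemLp b ⊤ (volume.restrict (gasCell Ys))) :
    Triple μ σ →L[ℝ] Triple μ σ →L[ℝ] ℝ :=
  c.cg • convForm σ hg hb + c.lamg • gradForm σ hg + c.lams • gradForm σ hs

/-- The bilinear form of the concentration equation. -/
def concForm (σ : Measure (Space d)) (hg : volume.restrict (gasCell Ys) ≤ μ)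
    (hb : MemLp b ⊤ (volume.restrict (gasCell Ys))) :
    Triple μ σ →L[ℝ] Triple μ σ →L[ℝ] ℝ :=
  convForm σ hg hb + c.D • gradForm σ hg

lemma memLp_source (hb : MemLp b ⊤ (volume.restrict (gasCell Ys))) (v e : Space d) :
    MemLp (fun y => ⟪v - b y, e⟫) 2 (volume.restrict (gasCell Ys)) :=
  (((memLp_const v).sub (hb.mono_exponent le_top)).inner_const e)

/-- The right-hand side of the heat equation. -/
def heatSource (σ : Measure (Space d)) [IsFiniteMeasure (volume.restrict Ys)]
    (hg : volume.restrict (gasCell Ys) ≤ μ)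
    (hs : volume.restrict Ys ≤ μ) (hb : MemLp b ⊤ (volume.restrict (gasCell Ys)))
    (v e : Space d) : Triple μ σ →L[ℝ] ℝ :=
  c.cg • sourceForm σ hg (memLp_source hb v e) + c.cs • sourceForm σ hs (memLp_const ⟪v, e⟫) -
    c.lamg • fluxForm σ hg e - c.lams • fluxForm σ hs e

/-- The right-hand side of the concentration equation. -/
def concSource (σ : Measure (Space d)) (hg : volume.restrict (gasCell Ys) ≤ μ)
    (hb : MemLp b ⊤ (volume.restrict (gasCell Ys))) (w e : Space d) : Triple μ σ →L[ℝ] ℝ :=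
  sourceForm σ hg (memLp_source hb w e) - c.D • fluxForm σ hg e

variable {c} {T0 C0 : ℝ} {ρ : Measure (Space d)} {χ ω τχ τω φ τφ : Space d → ℝ}
  {Dχ Dω Dφ : Space d → Space d}

/-- The weak heat equation in terms of the forms. -/
lemma heat_equation_iff [IsFiniteMeasure (volume.restrict Ys)]
    (hg : volume.restrict (gasCell Ys) ≤ μ)
    (hs : volume.restrict Ys ≤ μ) (hb : MemLp b ⊤ (volume.restrict (gasCell Ys))) (v e : Space d)
    {z y : Triple μ σ} {w : Triple ρ σ} (hz : Represents z χ Dχ τχ) (hw : Represents w ω Dω τω)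
    (hy : Represents y φ Dφ τφ) :
    ((∫ y in gasCell Ys, c.cg * ⟪b y, Dχ y⟫ * φ y)
        + (∫ y in gasCell Ys, c.lamg * ⟪Dχ y + e, Dφ y⟫)
        + (∫ y in Ys, c.lams * ⟪Dχ y + e, Dφ y⟫)
        + c.Q * c.A * (∫ y, rate c T0 C0 (τχ y) (τω y) * τφ y ∂σ)
      = (∫ y in gasCell Ys, c.cg * ⟪v - b y, e⟫ * φ y) + ∫ y in Ys, c.cs * ⟪v, e⟫ * φ y) ↔
    heatForm c σ hg hs hb z y + c.Q * c.A * ⟪(deriv (arrhenius c.Ta) T0 * C0) • traceL μ σ z +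
        arrhenius c.Ta T0 • traceL ρ σ w, traceL μ σ y⟫ = heatSource c σ hg hs hb v e y := by
  rw [inner_traceL_eq _ _ hz hw hy]
  simp only [heatForm, heatSource, add_apply, smul_apply,
    sub_apply, smul_eq_mul, mul_assoc, integral_const_mul]
  rw [convForm_eq hg hb hz hy, sourceForm_eq hg _ hy, sourceForm_eq hs _ hy,
    ← gradForm_add_fluxForm hg e hz hy, ← gradForm_add_fluxForm hs e hz hy]
  simp only [rate, integral_const_mul, mul_assoc]
  constructor <;> intro h <;> linarith

/-- The weak concentration equation in terms of the forms. -/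
lemma conc_equation_iff (hg : volume.restrict (gasCell Ys) ≤ ρ)
    (hb : MemLp b ⊤ (volume.restrict (gasCell Ys))) (v e : Space d)
    {z : Triple μ σ} {w y : Triple ρ σ} (hz : Represents z χ Dχ τχ) (hw : Represents w ω Dω τω)
    (hy : Represents y φ Dφ τφ) :
    ((∫ y in gasCell Ys, ⟪b y, Dω y⟫ * φ y)
        + (∫ y in gasCell Ys, c.D * ⟪Dω y + e, Dφ y⟫)
        + c.A * (∫ y, rate c T0 C0 (τχ y) (τω y) * τφ y ∂σ)
      = ∫ y in gasCell Ys, ⟪v - b y, e⟫ * φ y) ↔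
    concForm c σ hg hb w y + c.A * ⟪(deriv (arrhenius c.Ta) T0 * C0) • traceL μ σ z +
        arrhenius c.Ta T0 • traceL ρ σ w, traceL ρ σ y⟫ = concSource c σ hg hb v e y := by
  rw [inner_traceL_eq _ _ hz hw hy]
  simp only [concForm, concSource, add_apply, smul_apply,
    sub_apply, smul_eq_mul, integral_const_mul]
  rw [convForm_eq hg hb hw hy, sourceForm_eq hg _ hy, ← gradForm_add_fluxForm hg e hw hy]
  simp only [rate]
  constructor <;> intro h <;> linarith

end Transport

end FiltrationCombustion

end

/-! ### Coercivity of the heat and concentration forms, and their coupling. -/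

noncomputable section

namespace FiltrationCombustion

variable {n : ℕ} {Ys : Set (Space (n + 1))} {b : Space (n + 1) → Space (n + 1)}

/-- The Sobolev space of temperatures. -/
abbrev TempSpace (Ys : Set (Space (n + 1))) : Submodule ℝ (Triple (cellVolume univ) (surface Ys)) :=
  sobolev (cellVolume univ) (surface Ys)

/-- The Sobolev space of concentrations. -/
abbrev ConcSpace (Ys : Set (Space (n + 1))) :
    Submodule ℝ (Triple (cellVolume (periodicGas Ys)) (surface Ys)) :=
  sobolev (cellVolume (periodicGas Ys)) (surface Ys)

lemma IsSolidPart.restrict_gasCell_le_periodic (hY : IsSolidPart Ys) :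
    volume.restrict (gasCell Ys) ≤ cellVolume (periodicGas Ys) :=
  (cellVolume_periodicGas hY.closure_subset).ge

/-- Gas, solid and interface cover the cell, and the interface is Lebesgue null. -/
lemma IsSolidPart.lintegral_cellVolume_le (hY : IsSolidPart Ys) (F : Space (n + 1) → ℝ≥0∞) :
    ∫⁻ x, F x ∂(cellVolume univ) ≤ (∫⁻ x in gasCell Ys, F x) + ∫⁻ x in Ys, F x := by
  rw [cellVolume_univ]
  have hsub : unitCell (n + 1) ⊆ gasCell Ys ∪ (Ys ∪ frontier Ys) := by
    intro x hx
    by_cases h : x ∈ closure Ys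
    · right
      by_cases hxY : x ∈ Ys
      · exact Or.inl hxY
      · right; rw [hY.isOpen.frontier_eq]; exact ⟨h, hxY⟩
    · exact Or.inl ⟨hx, h⟩
  refine (lintegral_mono_set hsub).trans ((lintegral_union_le _ _ _).trans ?_)
  refine add_le_add le_rfl ((lintegral_union_le _ _ _).trans ?_)
  rw [setLIntegral_measure_zero _ _ hY.volume_frontier, add_zero]

lemma IsSolidPart.norm_sq_le (hY : IsSolidPart Ys)
    (f : Lp (Space (n + 1)) 2 (cellVolume (univ : Set (Space (n + 1))))) :
    ‖f‖ ^ 2 ≤ ‖LpRestrict (Space (n + 1)) (restrict_gasCell_le (Ys := Ys)) f‖ ^ 2 +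
      ‖LpRestrict (Space (n + 1)) (restrict_solid_le hY.closure_subset) f‖ ^ 2 := by
  have key : ‖f‖ₑ ^ 2 ≤ ‖LpRestrict (Space (n + 1)) (restrict_gasCell_le (Ys := Ys)) f‖ₑ ^ 2 +
        ‖LpRestrict (Space (n + 1)) (restrict_solid_le hY.closure_subset) f‖ₑ ^ 2 := by
    rw [enorm_Lp_sq (f := f) .rfl, enorm_Lp_sq (coeFn_LpRestrict restrict_gasCell_le f),
      enorm_Lp_sq (coeFn_LpRestrict (restrict_solid_le hY.closure_subset) f)]
    exact hY.lintegral_cellVolume_le _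
  simp only [enorm_eq_nnnorm] at key
  exact_mod_cast key

/-- The two measures coincide, but only by a proved equality, so the restriction operator between
their L² spaces has to be shown not to lose norm. -/
lemma IsSolidPart.norm_sq_le_gas (hY : IsSolidPart Ys)
    (f : Lp (Space (n + 1)) 2 (cellVolume (periodicGas Ys))) :
    ‖f‖ ^ 2 ≤ ‖LpRestrict (Space (n + 1)) hY.restrict_gasCell_le_periodic f‖ ^ 2 := by
  have key : ‖f‖ₑ ^ 2 ≤ ‖LpRestrict (Space (n + 1)) hY.restrict_gasCell_le_periodic f‖ₑ ^ 2 := by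
    rw [enorm_Lp_sq (f := f) .rfl, enorm_Lp_sq (coeFn_LpRestrict hY.restrict_gasCell_le_periodic f)]
    generalize (fun x => (f x)) = g
    exact (lintegral_mono' (cellVolume_periodicGas hY.closure_subset).le le_rfl)
  simp only [enorm_eq_nnnorm] at key
  exact_mod_cast key

lemma valL_ne_zero {d : ℕ} {μ σ : Measure (Space d)} {e : Triple μ σ} {τ : Space d → ℝ}
    {De : Space d → Space d} (he : Represents e (fun _ => 1) De τ) (hμ : μ univ ≠ 0) :
    valL μ σ e ≠ 0 := by
  intro h
  have h1 := enorm_Lp_sq he.val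
  rw [h] at h1
  simp at h1
  exact hμ (by simpa using h1.symm)

lemma traceL_ne_zero {d : ℕ} {μ σ : Measure (Space d)} {e : Triple μ σ} {u : Space d → ℝ}
    {De : Space d → Space d} (he : Represents e u De (fun _ => 1)) (hσ : σ univ ≠ 0) :
    traceL μ σ e ≠ 0 := by
  intro h
  have h1 := enorm_Lp_sq he.trace
  rw [h] at h1
  simp at h1
  exact hσ (by simpa using h1.symm)

lemma unitCell_nonempty {d : ℕ} : (unitCell d).Nonempty :=
  ⟨WithLp.toLp 2 fun _ => 1 / 2, fun _ => by norm_num⟩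

lemma cellVolume_univ_ne_zero {d : ℕ} : cellVolume (univ : Set (Space d)) univ ≠ 0 := by
  rw [cellVolume_univ, Measure.restrict_apply_univ]
  exact (isOpen_unitCell.measure_pos _ unitCell_nonempty).ne'

/-- Transport drops out of the quadratic form by skew-symmetry; what remains is the conduction
energy. -/
lemma heatForm_self {d : ℕ} {Ys : Set (Space d)} {b : Space d → Space d} {μ σ : Measure (Space d)}
    (hb : IsVelocity Ys b) (c : Coefficients) (hg : volume.restrict (gasCell Ys) ≤ μ)
    (hs : volume.restrict Ys ≤ μ) {z : Triple μ σ} (hz : z ∈ sobolev μ σ) :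
    heatForm c σ hg hs hb.bounded z z =
      c.lamg * ‖LpRestrict (Space d) hg (gradL μ σ z)‖ ^ 2 +
        c.lams * ‖LpRestrict (Space d) hs (gradL μ σ z)‖ ^ 2 := by
  simp only [heatForm, add_apply, smul_apply, smul_eq_mul]
  rw [hb.convForm_self _ hz, gradForm_self, gradForm_self, mul_zero, zero_add]

/-- Coercivity of the heat form up to the mean value, for general cell and surface measures. -/
lemma exists_heatForm_coercive_of_bound {d : ℕ} {Ys : Set (Space d)} {b : Space d → Space d}
    {μ σ : Measure (Space d)} (hb : IsVelocity Ys b) (c : Coefficients)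
    (hg : volume.restrict (gasCell Ys) ≤ μ) (hs : volume.restrict Ys ≤ μ) {e : Triple μ σ}
    (hbound : ∃ K > 0, ∀ (z : Triple μ σ) η, IsSmoothPeriodic η → Represents z η (∇ η) η →
      ‖z‖ ^ 2 ≤ K * (‖gradL μ σ z‖ ^ 2 + ⟪valL μ σ e, valL μ σ z⟫ ^ 2))
    (hsplit : ∀ f : Lp (Space d) 2 μ,
      ‖f‖ ^ 2 ≤ ‖LpRestrict (Space d) hg f‖ ^ 2 + ‖LpRestrict (Space d) hs f‖ ^ 2) :
    ∃ k > 0, ∀ z ∈ sobolev μ σ, k * ‖z‖ ^ 2 ≤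
      heatForm c σ hg hs hb.bounded z z + ⟪valL μ σ e, valL μ σ z⟫ ^ 2 := by
  obtain ⟨K, hK, hbound⟩ := hbound
  -- `l` is a lower bound for both conductivities and for the coefficient 1 of the mean term, so `l
  -- / K` is a coercivity constant.
  obtain ⟨l, hl⟩ : ∃ l, l = min (min c.lamg c.lams) 1 := ⟨_, rfl⟩
  have hl0 : 0 < l := hl ▸ lt_min (lt_min c.lamg_pos c.lams_pos) one_pos
  have l1 : l ≤ c.lamg := hl ▸ (min_le_left _ _).trans (min_le_left _ _)
  have l2 : l ≤ c.lams := hl ▸ (min_le_left _ _).trans (min_le_right _ _)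
  have l3 : l ≤ 1 := hl ▸ min_le_right _ _
  refine ⟨l / K, by positivity, fun z hz => ?_⟩
  -- Both sides are continuous in the triple, so smooth triples suffice.
  refine sobolev_le_of_smooth (f := fun z => l / K * ‖z‖ ^ 2)
    (g := fun z => heatForm c σ hg hs hb.bounded z z + ⟪valL μ σ e, valL μ σ z⟫ ^ 2)
    (by fun_prop) (Continuous.add ((heatForm c σ hg hs hb.bounded).continuous.clm_apply
      continuous_id) (by fun_prop)) (fun z η hη hr => ?_) hz
  rw [heatForm_self hb c hg hs (smoothTriples_le_sobolev ⟨η, hη, hr⟩)]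
  have h1 := hbound z η hη hr
  have h2 := hsplit (gradL μ σ z)
  have hx : 0 ≤ ‖LpRestrict (Space d) hg (gradL μ σ z)‖ ^ 2 := sq_nonneg _
  have hy : 0 ≤ ‖LpRestrict (Space d) hs (gradL μ σ z)‖ ^ 2 := sq_nonneg _
  have hp : 0 ≤ ⟪valL μ σ e, valL μ σ z⟫ ^ 2 := sq_nonneg _
  generalize ‖LpRestrict (Space d) hg (gradL μ σ z)‖ ^ 2 = x at *
  generalize ‖LpRestrict (Space d) hs (gradL μ σ z)‖ ^ 2 = y at *
  generalize ⟪valL μ σ e, valL μ σ z⟫ ^ 2 = p at *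
  calc l / K * ‖z‖ ^ 2 ≤ l / K * (K * (x + y + p)) := by
        gcongr
        exact h1.trans (by gcongr)
    _ = l * x + l * y + l * p := by field_simp
    _ ≤ c.lamg * x + c.lams * y + 1 * p := by gcongr
    _ = _ := by ring

/-- Coercivity of the heat form up to the mean value. -/
lemma exists_heatForm_coercive (hY : IsSolidPart Ys) (hb : IsVelocity Ys b) (c : Coefficients)
    {e : Triple (cellVolume univ) (surface Ys)}
    (he : Represents e (fun _ => 1) (∇ fun _ : Space (n + 1) => (1 : ℝ)) fun _ => 1) :
    ∃ k > 0, ∀ z ∈ TempSpace Ys, k * ‖z‖ ^ 2 ≤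
      heatForm c (surface Ys) restrict_gasCell_le (restrict_solid_le hY.closure_subset)
        hb.bounded z z + ⟪valL (cellVolume univ) (surface Ys) e,
          valL (cellVolume univ) (surface Ys) z⟫ ^ 2 :=
  exists_heatForm_coercive_of_bound hb c _ _
    (exists_norm_sq_le_grad_add_mean (valL_ne_zero he cellVolume_univ_ne_zero)
      (hasPoincare_unitCell.exists_triple cellVolume_univ he)
      (exists_trace_triple hY restrict_gasCell_le)) hY.norm_sq_le

lemma concForm_self {d : ℕ} {Ys : Set (Space d)} {b : Space d → Space d} {μ σ : Measure (Space d)}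
    (hb : IsVelocity Ys b) (c : Coefficients) (hg : volume.restrict (gasCell Ys) ≤ μ)
    {z : Triple μ σ} (hz : z ∈ sobolev μ σ) :
    concForm c σ hg hb.bounded z z = c.D * ‖LpRestrict (Space d) hg (gradL μ σ z)‖ ^ 2 := by
  simp only [concForm, add_apply, smul_apply, smul_eq_mul]
  rw [hb.convForm_self _ hz, gradForm_self, zero_add]

/-- Coercivity of the concentration form up to the trace, for general measures. -/
lemma exists_concForm_coercive_of_bound {d : ℕ} {Ys : Set (Space d)} {b : Space d → Space d}
    {μ σ : Measure (Space d)} (hb : IsVelocity Ys b) (c : Coefficients)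
    (hg : volume.restrict (gasCell Ys) ≤ μ)
    (hbound : ∃ K > 0, ∀ (z : Triple μ σ) η, IsSmoothPeriodic η → Represents z η (∇ η) η →
      ‖z‖ ^ 2 ≤ K * (‖gradL μ σ z‖ ^ 2 + ‖traceL μ σ z‖ ^ 2))
    (hsplit : ∀ f : Lp (Space d) 2 μ, ‖f‖ ^ 2 ≤ ‖LpRestrict (Space d) hg f‖ ^ 2) :
    ∃ k > 0, ∀ z ∈ sobolev μ σ, k * ‖z‖ ^ 2 ≤
      concForm c σ hg hb.bounded z z + ‖traceL μ σ z‖ ^ 2 := by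
  obtain ⟨K, hK, hbound⟩ := hbound
  obtain ⟨l, hl⟩ : ∃ l, l = min c.D 1 := ⟨_, rfl⟩
  have hl0 : 0 < l := hl ▸ lt_min c.D_pos one_pos
  have l1 : l ≤ c.D := hl ▸ min_le_left _ _
  have l2 : l ≤ 1 := hl ▸ min_le_right _ _
  refine ⟨l / K, by positivity, fun z hz => ?_⟩
  refine sobolev_le_of_smooth (f := fun z => l / K * ‖z‖ ^ 2)
    (g := fun z => concForm c σ hg hb.bounded z z + ‖traceL μ σ z‖ ^ 2)
    (by fun_prop) (Continuous.add ((concForm c σ hg hb.bounded).continuous.clm_apply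
      continuous_id) (by fun_prop)) (fun z η hη hr => ?_) hz
  rw [concForm_self hb c hg (smoothTriples_le_sobolev ⟨η, hη, hr⟩)]
  have h1 := hbound z η hη hr
  have h2 := hsplit (gradL μ σ z)
  have hx : 0 ≤ ‖LpRestrict (Space d) hg (gradL μ σ z)‖ ^ 2 := sq_nonneg _
  have hp : 0 ≤ ‖traceL μ σ z‖ ^ 2 := sq_nonneg _
  generalize ‖LpRestrict (Space d) hg (gradL μ σ z)‖ ^ 2 = x at *
  generalize ‖traceL μ σ z‖ ^ 2 = p at *
  calc l / K * ‖z‖ ^ 2 ≤ l / K * (K * (x + p)) := by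
        gcongr
        exact h1.trans (by gcongr)
    _ = l * x + l * p := by field_simp
    _ ≤ c.D * x + 1 * p := by gcongr
    _ = _ := by ring

/-- Coercivity of the concentration form up to the trace. -/
lemma exists_concForm_coercive (hY : IsSolidPart Ys) (hb : IsVelocity Ys b) (c : Coefficients)
    {e : Triple (cellVolume (periodicGas Ys)) (surface Ys)}
    (he : Represents e (fun _ => 1) (∇ fun _ : Space (n + 1) => (1 : ℝ)) fun _ => 1) :
    ∃ k > 0, ∀ z ∈ ConcSpace Ys, k * ‖z‖ ^ 2 ≤
      concForm c (surface Ys) hY.restrict_gasCell_le_periodic hb.bounded z z +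
        ‖traceL (cellVolume (periodicGas Ys)) (surface Ys) z‖ ^ 2 :=
  exists_concForm_coercive_of_bound hb c _
    (exists_norm_sq_le_grad_add_trace he (traceL_ne_zero he hY.surface_ne_zero)
      (hY.hasPoincare_gasCell.exists_triple (cellVolume_periodicGas hY.closure_subset) he)
      (exists_trace_triple hY hY.restrict_gasCell_le_periodic)) hY.norm_sq_le_gas

section ConstantKernel

variable {d : ℕ} {Ys : Set (Space d)} {b : Space d → Space d} {μ σ : Measure (Space d)}
  {e z : Triple μ σ}

lemma heatForm_const_left (c : Coefficients) (hg : volume.restrict (gasCell Ys) ≤ μ)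
    (hs : volume.restrict Ys ≤ μ) (hb : MemLp b ⊤ (volume.restrict (gasCell Ys)))
    (he : gradL μ σ e = 0) (z : Triple μ σ) : heatForm c σ hg hs hb e z = 0 := by
  simp only [heatForm, add_apply, smul_apply, smul_eq_mul]
  rw [convForm_of_gradL_eq_zero _ _ he, gradForm_of_gradL_eq_zero_left _ he,
    gradForm_of_gradL_eq_zero_left _ he]
  simp

lemma heatForm_const_right (c : Coefficients) (hg : volume.restrict (gasCell Ys) ≤ μ)
    (hs : volume.restrict Ys ≤ μ) (hb : IsVelocity Ys b)
    (he : Represents e (fun _ => 1) (∇ fun _ : Space d => (1 : ℝ)) fun _ => 1)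
    (hz : z ∈ sobolev μ σ) : heatForm c σ hg hs hb.bounded z e = 0 := by
  simp only [heatForm, add_apply, smul_apply, smul_eq_mul]
  rw [hb.convForm_const_right _ he hz, gradForm_of_gradL_eq_zero_right _ he.gradL_eq_zero,
    gradForm_of_gradL_eq_zero_right _ he.gradL_eq_zero]
  simp

lemma concForm_const_left (c : Coefficients) (hg : volume.restrict (gasCell Ys) ≤ μ)
    (hb : MemLp b ⊤ (volume.restrict (gasCell Ys)))
    (he : gradL μ σ e = 0) (z : Triple μ σ) : concForm c σ hg hb e z = 0 := by
  simp only [concForm, add_apply, smul_apply, smul_eq_mul]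
  rw [convForm_of_gradL_eq_zero _ _ he, gradForm_of_gradL_eq_zero_left _ he]
  simp

lemma concForm_const_right (c : Coefficients) (hg : volume.restrict (gasCell Ys) ≤ μ)
    (hb : IsVelocity Ys b)
    (he : Represents e (fun _ => 1) (∇ fun _ : Space d => (1 : ℝ)) fun _ => 1)
    (hz : z ∈ sobolev μ σ) : concForm c σ hg hb.bounded z e = 0 := by
  simp only [concForm, add_apply, smul_apply, smul_eq_mul]
  rw [hb.convForm_const_right _ he hz, gradForm_of_gradL_eq_zero_right _ he.gradL_eq_zero]
  simp

end ConstantKernel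

/-- The heat form on the Sobolev space. -/
def tempBilin (c : Coefficients) (hY : IsSolidPart Ys) (hb : IsVelocity Ys b) :
    TempSpace Ys →L[ℝ] TempSpace Ys →L[ℝ] ℝ :=
  (heatForm c (surface Ys) restrict_gasCell_le (restrict_solid_le hY.closure_subset)
    hb.bounded).bilinearComp (TempSpace Ys).subtypeL (TempSpace Ys).subtypeL

/-- The concentration form on the Sobolev space. -/
def concBilin (c : Coefficients) (hY : IsSolidPart Ys) (hb : IsVelocity Ys b) :
    ConcSpace Ys →L[ℝ] ConcSpace Ys →L[ℝ] ℝ :=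
  (concForm c (surface Ys) hY.restrict_gasCell_le_periodic hb.bounded).bilinearComp
    (ConcSpace Ys).subtypeL (ConcSpace Ys).subtypeL

/-- The trace operator on a Sobolev space. -/
def sobolevTrace {d : ℕ} (μ σ : Measure (Space d)) : sobolev μ σ →L[ℝ] Lp ℝ 2 σ :=
  traceL μ σ ∘L (sobolev μ σ).subtypeL

/-- The abstract data of the cell problem: the kernels are spanned by the constant functions, whose
traces both equal 1, and `m` is the pairing with 1, that is ∫χ over `Y`. -/
lemma exists_coupledForms (c : Coefficients) (hY : IsSolidPart Ys) (hb : IsVelocity Ys b)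
    {e₁ : TempSpace Ys} {e₂ : ConcSpace Ys}
    (he₁ : Represents (e₁ : Triple (cellVolume univ) (surface Ys)) (fun _ => 1)
      (∇ fun _ : Space (n + 1) => (1 : ℝ)) fun _ => 1)
    (he₂ : Represents (e₂ : Triple (cellVolume (periodicGas Ys)) (surface Ys)) (fun _ => 1)
      (∇ fun _ : Space (n + 1) => (1 : ℝ)) fun _ => 1) :
    ∃ k, CoupledForms (tempBilin c hY hb) (concBilin c hY hb)
      (innerBilin _ (valL (cellVolume univ) (surface Ys) e₁) ∘L
        valL (cellVolume univ) (surface Ys) ∘L (TempSpace Ys).subtypeL)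
      (sobolevTrace (cellVolume univ) (surface Ys))
      (sobolevTrace (cellVolume (periodicGas Ys)) (surface Ys)) e₁ e₂ k := by
  obtain ⟨k₁, hk₁, h₁⟩ := exists_heatForm_coercive hY hb c he₁
  obtain ⟨k₂, hk₂, h₂⟩ := exists_concForm_coercive hY hb c he₂
  have hg₁ := he₁.gradL_eq_zero
  have hg₂ := he₂.gradL_eq_zero
  refine ⟨min k₁ k₂, lt_min hk₁ hk₂, fun u => ?_, fun w => ?_, fun w => ?_, ?_, ?_, fun u => ?_,
    fun u => ?_, fun u => ?_, fun u => ?_⟩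
  · refine le_trans ?_ (h₁ u u.2)
    rw [Submodule.norm_coe]
    gcongr; exact min_le_left _ _
  · refine le_trans ?_ (h₂ w w.2)
    rw [Submodule.norm_coe]
    gcongr; exact min_le_right _ _
  · have h := concForm_self hb c hY.restrict_gasCell_le_periodic w.2
    have hD := c.D_pos
    exact (by positivity : (0 : ℝ) ≤ c.D * _).trans h.ge
  · exact Lp.ext (he₁.trace.trans he₂.trace.symm)
  · exact (inner_self_eq_zero (𝕜 := ℝ)).not.2 (valL_ne_zero he₁ cellVolume_univ_ne_zero)
  · exact heatForm_const_left c _ _ _ hg₁ _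
  · exact heatForm_const_right c _ _ hb he₁ u.2
  · exact concForm_const_left c _ _ hg₂ _
  · exact concForm_const_right c _ hb he₂ u.2

end FiltrationCombustion

end

/-! ### Compatibility, the sign of the reaction, and solutions of the cell problem. -/

noncomputable section

namespace FiltrationCombustion

section Compatibility

variable {d : ℕ} {Ys : Set (Space d)} {b : Space d → Space d}

lemma IsVelocity.integrable (hb : IsVelocity Ys b) : Integrable b (volume.restrict (gasCell Ys)) :=
  hb.bounded.integrable le_top

lemma inner_unitVec (x : Space d) (j : Fin d) : ⟪x, unitVec j⟫ = x j := by
  simp [unitVec, EuclideanSpace.inner_single_right]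

lemma IsVelocity.integral_inner_sub (hb : IsVelocity Ys b) (v : Space d) (j : Fin d) :
    ∫ y in gasCell Ys, ⟪v - b y, unitVec j⟫ =
      volume.real (gasCell Ys) * v j - (∫ y in gasCell Ys, b y) j := by
  have h := integral_inner ((integrable_const v).sub hb.integrable) (unitVec j) (𝕜 := ℝ)
  simp_rw [real_inner_comm (unitVec j)]
  refine h.trans ?_
  simp only [Pi.sub_apply]
  rw [integral_sub (integrable_const v) hb.integrable, setIntegral_const, real_inner_comm,
    inner_unitVec]
  simp

lemma gasCell_real_pos (h : (gasCell Ys).Nonempty) : 0 < volume.real (gasCell Ys) :=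
  ENNReal.toReal_pos ((isOpen_gasCell Ys).measure_pos _ h).ne'
    ((measure_mono (gasCell_subset_unitCell Ys)).trans_lt isBounded_unitCell.measure_lt_top).ne

lemma effCapacity_eq (c : Coefficients) :
    effCapacity c Ys = c.cg * volume.real (gasCell Ys) + c.cs * volume.real Ys := by
  simp [effCapacity, mul_comm]

/-- The compatibility conditions determine the effective drifts. -/
theorem compatible_iff (hY : IsSolidPart Ys) (hb : IsVelocity Ys b) (c : Coefficients)
    (v w : Space d) : Compatible c Ys b v w ↔ v = driftT c Ys b ∧ w = driftC Ys b := by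
  have hg := gasCell_real_pos hY.connected.nonempty
  have hcap : 0 < effCapacity c Ys := by
    have := c.cg_pos
    have := c.cs_pos
    rw [effCapacity_eq]
    positivity
  -- The condition reads `effCapacity c Ys * v j` = c_g ∫ b_j, an equation for the single coordinate
  -- `v j`.
  have hT : ∀ j : Fin d, (∫ y in gasCell Ys, c.cg * ⟪v - b y, unitVec j⟫) +
      (∫ _ in Ys, c.cs * ⟪v, unitVec j⟫) = 0 ↔ v j = driftT c Ys b j := by
    intro j
    rw [integral_const_mul, hb.integral_inner_sub, setIntegral_const, inner_unitVec, driftT,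
      PiLp.smul_apply,
      smul_eq_mul, smul_eq_mul, div_mul_eq_mul_div, eq_div_iff hcap.ne', effCapacity_eq]
    constructor <;> intro h <;> linarith
  have hC : ∀ j : Fin d, ∫ y in gasCell Ys, ⟪w - b y, unitVec j⟫ = 0 ↔
      w j = driftC Ys b j := by
    intro j
    rw [hb.integral_inner_sub, driftC, PiLp.smul_apply, smul_eq_mul, eq_inv_mul_iff_mul_eq₀ hg.ne',
      sub_eq_zero]
  rw [Compatible]
  simp_rw [hT, hC, forall_and]
  exact and_congr ⟨fun h => PiLp.ext h, fun h j => by rw [h]⟩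
    ⟨fun h => PiLp.ext h, fun h j => by rw [h]⟩

end Compatibility

section Arrhenius

lemma arrhenius_pos (Ta T : ℝ) : 0 < arrhenius Ta T := Real.exp_pos _

/-- f'(T) = f(T) T_a / T². Together with C⁰ ≥ 0 this gives α ≥ 0, the sign that coercivity requires.
-/
lemma deriv_arrhenius_nonneg {Ta T : ℝ} (hTa : 0 < Ta) (hT : 0 < T) :
    0 ≤ deriv (arrhenius Ta) T := by
  have h : HasDerivAt (arrhenius Ta) (Real.exp (-Ta / T) * (-Ta * (-(T ^ 2)⁻¹))) T := by
    have := ((hasDerivAt_inv hT.ne').const_mul (-Ta)).exp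
    exact this
  rw [h.deriv]
  have : -Ta * (-(T ^ 2)⁻¹) = Ta * (T ^ 2)⁻¹ := by ring
  rw [this]
  positivity

end Arrhenius

section Shift

variable {d : ℕ} {U : Set (Space d)} {σ : Measure (Space d)}

lemma gradient_add_const (η : Space d → ℝ) (a : ℝ) : (∇ fun x => η x + a) = ∇ η := by
  ext1 x
  simp [gradient]

lemma HasTrace.add_const [IsFiniteMeasure σ] {u τ : Space d → ℝ} {Du : Space d → Space d}
    (h : HasTrace U σ u Du τ) (a : ℝ) :
    HasTrace U σ (fun x => u x + a) Du fun x => τ x + a := by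
  obtain ⟨hτ, η, hη, h1, h2, h3⟩ := h
  have hsub : ∀ f g : Space d → ℝ, ((fun x => f x + a) - fun x => g x + a) = f - g :=
    fun f g => by ext x; simp
  refine ⟨hτ.add (memLp_const a), fun n x => η n x + a,
    fun n => ⟨(hη n).1.add contDiff_const, fun i x => ?_⟩, ?_, ?_, ?_⟩
  · simp only [(hη n).2 i x]
  · simpa only [hsub] using h1
  · simpa only [gradient_add_const] using h2
  · simpa only [hsub] using h3

/-- The trace hypothesis supplies smooth approximations; the weak gradient identity for the shifted
function follows from these in the limit. -/
lemma MemH1Per.add_const (hU : IsPeriodicSet U) (hUm : MeasurableSet U) [IsFiniteMeasure σ]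
    {u τ : Space d → ℝ} {Du : Space d → Space d} (h : MemH1Per U u Du)
    (hτ : HasTrace U σ u Du τ) (a : ℝ) : MemH1Per U (fun x => u x + a) Du := by
  obtain ⟨-, η, hη, h1, h2, -⟩ := hτ.add_const a
  exact memH1Per_of_tendsto hU hUm (fun i x => by simp only [h.periodic i x]) h.periodic_grad
    (h.memLp.add (memLp_const a)) h.memLp_grad hη h1 h2

/-- The direction (f(T⁰), -f'(T⁰)C⁰) is annihilated by the reaction rate, which produces the kernel
of the cell problem. -/
lemma rate_shift (c : Coefficients) (T0 C0 κ x y : ℝ) :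
    rate c T0 C0 (x + κ * arrhenius c.Ta T0) (y + -(κ * (deriv (arrhenius c.Ta) T0 * C0))) =
      rate c T0 C0 x y := by
  simp only [rate]; ring

/-- Solutions of the cell problem may be shifted along the kernel. -/
lemma IsCellSolution.shift {n : ℕ} {Ys : Set (Space (n + 1))} (hY : IsSolidPart Ys)
    {b : Space (n + 1) → Space (n + 1)} {c : Coefficients} {T0 C0 : ℝ} {v w : Space (n + 1)}
    {j : Fin (n + 1)} {χ ω : Space (n + 1) → ℝ} (h : IsCellSolution c Ys b T0 C0 v w j χ ω)
    (κ : ℝ) :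
    IsCellSolution c Ys b T0 C0 v w j (fun y => χ y + κ * arrhenius c.Ta T0)
      (fun y => ω y - κ * (deriv (arrhenius c.Ta) T0 * C0)) := by
  have := hY.isFiniteMeasure_surface
  obtain ⟨Dχ, Dω, τχ, τω, hχ, hτχ, hω, hτω, h1, h2⟩ := h
  simp only [sub_eq_add_neg (ω _)]
  refine ⟨Dχ, Dω, _, _, hχ.add_const isPeriodicSet_univ .univ hτχ _, hτχ.add_const _,
    hω.add_const isPeriodicSet_periodicGas measurableSet_periodicGas hτω _, hτω.add_const _,
    ?_, ?_⟩
  · simpa only [rate_shift] using h1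
  · simpa only [rate_shift] using h2

end Shift

section FormSolution

variable {n : ℕ} {Ys : Set (Space (n + 1))} {b : Space (n + 1) → Space (n + 1)}

/-- The source of the heat equation on the Sobolev space. -/
def tempSource (c : Coefficients) (hY : IsSolidPart Ys) (hb : IsVelocity Ys b)
    (v e : Space (n + 1)) : TempSpace Ys →L[ℝ] ℝ :=
  haveI := isFiniteMeasure_restrict_solid hY.closure_subset
  heatSource c (surface Ys) restrict_gasCell_le (restrict_solid_le hY.closure_subset)
    hb.bounded v e ∘L (TempSpace Ys).subtypeL

/-- The source of the concentration equation on the Sobolev space. -/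
def gasSource (c : Coefficients) (hY : IsSolidPart Ys) (hb : IsVelocity Ys b)
    (w e : Space (n + 1)) : ConcSpace Ys →L[ℝ] ℝ :=
  concSource c (surface Ys) hY.restrict_gasCell_le_periodic hb.bounded w e ∘L
    (ConcSpace Ys).subtypeL

lemma tempBilin_apply (c : Coefficients) (hY : IsSolidPart Ys) (hb : IsVelocity Ys b)
    (z y : TempSpace Ys) : tempBilin c hY hb z y = heatForm c (surface Ys) restrict_gasCell_le
      (restrict_solid_le hY.closure_subset) hb.bounded z y := rfl

lemma tempSource_apply (c : Coefficients) (hY : IsSolidPart Ys)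
    [IsFiniteMeasure (volume.restrict Ys)] (hb : IsVelocity Ys b) (v e : Space (n + 1))
    (z : TempSpace Ys) : tempSource c hY hb v e z = heatSource c (surface Ys) restrict_gasCell_le
      (restrict_solid_le hY.closure_subset) hb.bounded v e z := rfl

lemma gasSource_apply (c : Coefficients) (hY : IsSolidPart Ys) (hb : IsVelocity Ys b)
    (w e : Space (n + 1)) (z : ConcSpace Ys) : gasSource c hY hb w e z =
      concSource c (surface Ys) hY.restrict_gasCell_le_periodic hb.bounded w e z := rfl

/-- The cell problem in the Sobolev spaces. -/
def IsFormSolution (c : Coefficients) (hY : IsSolidPart Ys) (hb : IsVelocity Ys b)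
    (T0 C0 : ℝ) (v w e : Space (n + 1)) (z : TempSpace Ys) (y : ConcSpace Ys) : Prop :=
  (∀ φ, tempBilin c hY hb z φ + c.Q * c.A *
      ⟪(deriv (arrhenius c.Ta) T0 * C0) • sobolevTrace (cellVolume univ) (surface Ys) z +
        arrhenius c.Ta T0 • sobolevTrace (cellVolume (periodicGas Ys)) (surface Ys) y,
        sobolevTrace (cellVolume univ) (surface Ys) φ⟫ = tempSource c hY hb v e φ) ∧
  ∀ ψ, concBilin c hY hb y ψ + c.A *
      ⟪(deriv (arrhenius c.Ta) T0 * C0) • sobolevTrace (cellVolume univ) (surface Ys) z +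
        arrhenius c.Ta T0 • sobolevTrace (cellVolume (periodicGas Ys)) (surface Ys) y,
        sobolevTrace (cellVolume (periodicGas Ys)) (surface Ys) ψ⟫ = gasSource c hY hb w e ψ

variable {c : Coefficients} {T0 C0 : ℝ} {v w : Space (n + 1)} {j : Fin (n + 1)}

/-- A solution in the Sobolev spaces is realized by functions. -/
lemma IsFormSolution.exists_isCellSolution (hY : IsSolidPart Ys) (hb : IsVelocity Ys b)
    {z : TempSpace Ys} {y : ConcSpace Ys}
    (h : IsFormSolution c hY hb T0 C0 v w (unitVec j) z y) :
    ∃ χ ω, IsCellSolution c Ys b T0 C0 v w j χ ω := by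
  have := isFiniteMeasure_restrict_solid hY.closure_subset
  have := hY.isFiniteMeasure_surface
  have hσ := ae_surface_mem hY.closure_subset
  obtain ⟨χ, Dχ, τχ, hχ, hτχ, hz⟩ := exists_hasTrace_of_sobolev isPeriodicSet_univ .univ hσ z
  obtain ⟨ω, Dω, τω, hω, hτω, hy⟩ :=
    exists_hasTrace_of_sobolev isPeriodicSet_periodicGas measurableSet_periodicGas hσ y
  refine ⟨χ, ω, Dχ, Dω, τχ, τω, hχ, hτχ, hω, hτω, fun φ Dφ τφ hφ hτφ => ?_,
    fun ψ Dψ τψ hψ hτψ => ?_⟩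
  · obtain ⟨p, hp⟩ := exists_represents_of_hasTrace .univ hσ hφ hτφ
    exact (heat_equation_iff restrict_gasCell_le (restrict_solid_le hY.closure_subset) hb.bounded
      v (unitVec j) hz hy hp).2 (h.1 p)
  · obtain ⟨p, hp⟩ := exists_represents_of_hasTrace measurableSet_periodicGas hσ hψ hτψ
    exact (conc_equation_iff hY.restrict_gasCell_le_periodic hb.bounded
      w (unitVec j) hz hy hp).2 (h.2 p)

set_option maxHeartbeats 1000000 in
/-- A solution of the cell problem represents a solution in the Sobolev spaces. -/
lemma IsCellSolution.exists_isFormSolution (hY : IsSolidPart Ys) (hb : IsVelocity Ys b)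
    {χ ω : Space (n + 1) → ℝ} (h : IsCellSolution c Ys b T0 C0 v w j χ ω) :
    ∃ (z : TempSpace Ys) (y : ConcSpace Ys), IsFormSolution c hY hb T0 C0 v w (unitVec j) z y ∧
      valL (cellVolume univ) (surface Ys) z =ᵐ[volume.restrict (unitCell (n + 1))] χ ∧
      valL (cellVolume (periodicGas Ys)) (surface Ys) y =ᵐ[volume.restrict (gasCell Ys)] ω := by
  have := isFiniteMeasure_restrict_solid hY.closure_subset
  have := hY.isFiniteMeasure_surface
  have hσ := ae_surface_mem hY.closure_subset
  obtain ⟨Dχ, Dω, τχ, τω, hχ, hτχ, hω, hτω, h1, h2⟩ := h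
  obtain ⟨z, hz⟩ := exists_represents_of_hasTrace .univ hσ hχ hτχ
  obtain ⟨y, hy⟩ := exists_represents_of_hasTrace measurableSet_periodicGas hσ hω hτω
  refine ⟨z, y, ⟨fun p => ?_, fun p => ?_⟩, cellVolume_univ.ge.absolutelyContinuous.ae_le hz.val,
    hY.restrict_gasCell_le_periodic.absolutelyContinuous.ae_le hy.val⟩
  · rw [tempBilin_apply c hY hb z p, tempSource_apply c hY hb v _ p]
    obtain ⟨φ, Dφ, τφ, hφ, hτφ, hp⟩ := exists_hasTrace_of_sobolev isPeriodicSet_univ .univ hσ p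
    exact (heat_equation_iff restrict_gasCell_le (restrict_solid_le hY.closure_subset) hb.bounded
      v (unitVec j) hz hy hp).1 (h1 φ Dφ τφ hφ hτφ)
  · obtain ⟨φ, Dφ, τφ, hφ, hτφ, hp⟩ :=
      exists_hasTrace_of_sobolev isPeriodicSet_periodicGas measurableSet_periodicGas hσ p
    exact (conc_equation_iff hY.restrict_gasCell_le_periodic hb.bounded
      w (unitVec j) hz hy hp).1 (h2 φ Dφ τφ hφ hτφ)

/-- The constant function one in a Sobolev space. -/
lemma exists_sobolev_one {d : ℕ} {μ σ : Measure (Space d)} [IsFiniteMeasure μ] [IsFiniteMeasure σ]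
    (hμ : ∀ᵐ x ∂μ, x ∈ unitCell d) (hσ : ∀ᵐ x ∂σ, x ∈ unitCell d) :
    ∃ e : sobolev μ σ, Represents (e : Triple μ σ) (fun _ => 1)
      (∇ fun _ : Space d => (1 : ℝ)) fun _ => 1 := by
  obtain ⟨e, he⟩ := IsSmoothPeriodic.exists_represents hμ hσ (IsSmoothPeriodic.const (d := d) 1)
  exact ⟨⟨e, smoothTriples_le_sobolev ⟨_, .const 1, he⟩⟩, he⟩

/-- On constants the flux terms vanish, and the remaining value of the source is the compatibility
condition. -/
lemma heatSource_one {d : ℕ} {Ys : Set (Space d)} {b : Space d → Space d} {v w : Space d}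
    {μ σ : Measure (Space d)} [IsFiniteMeasure (volume.restrict Ys)]
    (hg : volume.restrict (gasCell Ys) ≤ μ) (hs : volume.restrict Ys ≤ μ)
    (hb : MemLp b ⊤ (volume.restrict (gasCell Ys))) (hc : Compatible c Ys b v w) (j : Fin d)
    {e : Triple μ σ} (he : Represents e (fun _ => 1) (∇ fun _ : Space d => (1 : ℝ)) fun _ => 1) :
    heatSource c σ hg hs hb v (unitVec j) e = 0 := by
  simp only [heatSource, add_apply, sub_apply, smul_apply, smul_eq_mul]
  rw [fluxForm_of_gradL_eq_zero _ he.gradL_eq_zero, fluxForm_of_gradL_eq_zero _ he.gradL_eq_zero,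
    sourceForm_eq _ _ he, sourceForm_eq _ _ he, ← integral_const_mul, ← integral_const_mul]
  simp only [mul_one, mul_zero, sub_zero]
  exact (hc j).1

lemma concSource_one {d : ℕ} {Ys : Set (Space d)} {b : Space d → Space d} {v w : Space d}
    {μ σ : Measure (Space d)} (hg : volume.restrict (gasCell Ys) ≤ μ)
    (hb : MemLp b ⊤ (volume.restrict (gasCell Ys))) (hc : Compatible c Ys b v w) (j : Fin d)
    {e : Triple μ σ} (he : Represents e (fun _ => 1) (∇ fun _ : Space d => (1 : ℝ)) fun _ => 1) :
    concSource c σ hg hb w (unitVec j) e = 0 := by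
  simp only [concSource, sub_apply, smul_apply, smul_eq_mul]
  rw [fluxForm_of_gradL_eq_zero _ he.gradL_eq_zero, sourceForm_eq _ _ he]
  simp only [mul_one, mul_zero, sub_zero]
  exact (hc j).2

lemma ae_eq_add_of_sub_eq {d : ℕ} {μ σ : Measure (Space d)} {e z z' : Triple μ σ}
    {τ : Space d → ℝ} {De : Space d → Space d} (he : Represents e (fun _ => 1) De τ) {k : ℝ}
    (h : z' - z = k • e) : ∀ᵐ x ∂μ, valL μ σ z' x = valL μ σ z x + k := by
  have h1 : valL μ σ z' = valL μ σ z + k • valL μ σ e := by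
    rw [← map_smul, ← h, map_sub, add_sub_cancel]
  rw [h1]
  filter_upwards [Lp.coeFn_add (valL μ σ z) (k • valL μ σ e), Lp.coeFn_smul k (valL μ σ e), he.val]
    with x h2 h3 h4
  rw [h2, Pi.add_apply, h3, Pi.smul_apply, h4, smul_eq_mul, mul_one]

/-- The cell problem with compatible drifts has a solution. -/
theorem exists_isCellSolution (hY : IsSolidPart Ys) (hb : IsVelocity Ys b)
    (hc : Compatible c Ys b v w) (hT0 : 0 < T0) (hC0 : 0 ≤ C0) (j : Fin (n + 1)) :
    ∃ χ ω, IsCellSolution c Ys b T0 C0 v w j χ ω := by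
  have := hY.isFiniteMeasure_surface
  have := isFiniteMeasure_restrict_solid hY.closure_subset
  have hσ := ae_surface_mem hY.closure_subset
  obtain ⟨e₁, he₁⟩ := exists_sobolev_one (ae_cellVolume_mem .univ) hσ
  obtain ⟨e₂, he₂⟩ := exists_sobolev_one (ae_cellVolume_mem measurableSet_periodicGas) hσ
  obtain ⟨k, hk⟩ := exists_coupledForms c hY hb he₁ he₂
  obtain ⟨z, y, h1, h2⟩ := hk.exists_solution c.Q_pos c.A_pos
    (mul_nonneg (deriv_arrhenius_nonneg c.Ta_pos hT0) hC0) (arrhenius_pos c.Ta T0)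
    (ℓ₁ := tempSource c hY hb v (unitVec j)) (ℓ₂ := gasSource c hY hb w (unitVec j))
    ((tempSource_apply c hY hb _ _ _).trans (heatSource_one _ _ _ hc j he₁))
    ((gasSource_apply c hY hb _ _ _).trans (concSource_one _ _ hc j he₂))
  exact IsFormSolution.exists_isCellSolution hY hb (z := z) (y := y) ⟨h1, h2⟩

/-- Two solutions of the cell problem differ by an element of the kernel. -/
theorem IsCellSolution.eq_add (hY : IsSolidPart Ys) (hb : IsVelocity Ys b)
    (hT0 : 0 < T0) (hC0 : 0 ≤ C0) {χ ω χ' ω' : Space (n + 1) → ℝ}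
    (h : IsCellSolution c Ys b T0 C0 v w j χ ω) (h' : IsCellSolution c Ys b T0 C0 v w j χ' ω') :
    ∃ κ : ℝ,
      (∀ᵐ y ∂(volume.restrict (unitCell (n + 1))), χ' y = χ y + κ * arrhenius c.Ta T0) ∧
      ∀ᵐ y ∂(volume.restrict (gasCell Ys)),
        ω' y = ω y - κ * (deriv (arrhenius c.Ta) T0 * C0) := by
  have := hY.isFiniteMeasure_surface
  have hσ := ae_surface_mem hY.closure_subset
  obtain ⟨e₁, he₁⟩ := exists_sobolev_one (ae_cellVolume_mem .univ) hσ
  obtain ⟨e₂, he₂⟩ := exists_sobolev_one (ae_cellVolume_mem measurableSet_periodicGas) hσ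
  obtain ⟨k, hk⟩ := exists_coupledForms c hY hb he₁ he₂
  obtain ⟨z, y, ⟨h1, h2⟩, hz, hy⟩ := h.exists_isFormSolution hY hb
  obtain ⟨z', y', ⟨h1', h2'⟩, hz', hy'⟩ := h'.exists_isFormSolution hY hb
  obtain ⟨κ, hκ₁, hκ₂⟩ := hk.sub_eq_of_solutions c.Q_pos c.A_pos
    (mul_nonneg (deriv_arrhenius_nonneg c.Ta_pos hT0) hC0) (arrhenius_pos c.Ta T0) h1 h2 h1' h2'
  have hχ := ae_eq_add_of_sub_eq he₁ (congrArg Subtype.val hκ₁)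
  have hω := ae_eq_add_of_sub_eq he₂ (congrArg Subtype.val hκ₂)
  refine ⟨κ, ?_, ?_⟩
  · filter_upwards [hz, hz', cellVolume_univ.ge.absolutelyContinuous.ae_le hχ] with x a1 a2 a3
    rw [← a1, ← a2, a3]
  · filter_upwards [hy, hy', hY.restrict_gasCell_le_periodic.absolutelyContinuous.ae_le hω]
      with x a1 a2 a3
    rw [← a1, ← a2, a3, sub_eq_add_neg]

end FormSolution

end FiltrationCombustion

end

theorem lemma4p1 (d : ℕ) (hd : d = 2 ∨ d = 3)
    (c : Coefficients)
    (Ys : Set (Space d)) (hYs : IsSolidPart Ys)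
    (b : Space d → Space d)
    (hb : IsVelocity Ys b)
    (T0 C0 : ℝ) (hT0 : 0 < T0) (hC0 : 0 ≤ C0) :
    (∀ v w : Space d, Compatible c Ys b v w ↔
      v = driftT c Ys b ∧ w = driftC Ys b) ∧
    ∃ χ ω : Fin d → Space d → ℝ,
      (∀ j, IsCellSolution c Ys b T0 C0
        (driftT c Ys b) (driftC Ys b) j (χ j) (ω j)) ∧
      (∀ χ' ω' : Fin d → Space d → ℝ,
        (∀ j, IsCellSolution c Ys b T0 C0
          (driftT c Ys b) (driftC Ys b) j
          (χ' j) (ω' j)) →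
        ∃ κ : Fin d → ℝ, ∀ j,
          (∀ᵐ y ∂(volume.restrict (unitCell d)),
            χ' j y = χ j y + κ j * arrhenius c.Ta T0) ∧
          (∀ᵐ y ∂(volume.restrict (gasCell Ys)),
            ω' j y = ω j y - κ j * (deriv (arrhenius c.Ta) T0 * C0))) ∧
      (∀ κ : Fin d → ℝ, ∀ j, IsCellSolution c Ys b T0 C0
        (driftT c Ys b) (driftC Ys b) j
        (fun y => χ j y + κ j * arrhenius c.Ta T0)
        (fun y => ω j y - κ j * (deriv (arrhenius c.Ta) T0 * C0))) := by
  -- The boundary geometry singles out one coordinate, so the dimension is written as a successor.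
  have hn : ∃ n, d = n + 1 := by
    rcases hd with rfl | rfl
    exacts [⟨1, rfl⟩, ⟨2, rfl⟩]
  obtain ⟨n, rfl⟩ := hn
  refine ⟨compatible_iff hYs hb c, ?_⟩
  -- By part (i) the effective drifts are compatible, which is the solvability condition for each
  -- `j`.
  have hc := (compatible_iff hYs hb c _ _).2 ⟨rfl, rfl⟩
  choose χ ω hsol using exists_isCellSolution hYs hb hc hT0 hC0
  refine ⟨χ, ω, hsol, fun χ' ω' hsol' => ?_, fun κ j => (hsol j).shift hYs (κ j)⟩
  choose κ hκ using fun j => (hsol j).eq_add hYs hb hT0 hC0 (hsol' j)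
  exact ⟨κ, hκ⟩
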